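/- Let $A\in\mathbb R^{n_x\times n_x}$, $B\in\mathbb R^{n_x\times n_u}$, $Q\succeq 0$, $R\succ 0$, $\sigma_w>0$, and consider $x_{t+1}=Ax_t+Bu_t+\sigma_w w_t+\delta_t$, where $x_0$ and the i.i.d. noise $(w_t)$ are square integrable with zero mean, $\mathbb E[w_tw_t^\top]=I$ and $\mathbb E[x_0w_t^\top]=0$. For a gain $F$ let $$\mathrm{NC}(F)=\limsup_{T\to\infty}\frac1T\,\mathbb E\sum_{t=0}^{T-1}\big(x_t^\top Qx_t+u_t^\top Ru_t\big),\qquad u_t=Fx_t,\ \delta_t=0 .$$ Norms of matrices are spectral norms, $\rho(\cdot)$ is the spectral radius, $\sigma_{\min},\sigma_{\max}$ are the extreme singular values, and $\mathrm{DARE}(A,B,Q,R)$ is the equation $P=Q+A^\top PA-A^\top PB(B^\top PB+R)^{-1}B^\top PA$. Let $P_\star\succeq0$ solve $\mathrm{DARE}(A,B,Q,R)$ and $F_\star=-(R+B^\top P_\star B)^{-1}B^\top P_\star A$. For $\gamma>0$ let $P_\gamma$ be the smallest (in the Loewner order) solution of $\mathrm{DARE}\big(A,[I\ B],Q,\mathrm{diag}(-\gamma^2I,R)\big)$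 with $P_\gamma\succeq0$ and $P_\gamma\prec\gamma^2I$, and define $F_\gamma$ by $$\begin{bmatrix}E_\gamma\\F_\gamma\end{bmatrix}=-\Big([I\ B]^\top P_\gamma[I\ B]+\mathrm{diag}(-\gamma^2I,R)\Big)^{-1}[I\ B]^\top P_\gamma A .$$ Let $\gamma_\infty$ be the infimum of the $\gamma>0$ for which a solution with $0\preceq P\prec\gamma^2I$ exists. Let $W_\ell(A,B)=\sum_{t=0}^{\ell}A^tBB^\top(A^t)^\top$, and let $W_\infty$ be its limit as $\ell\to\infty$ when $\rho(A)<1$. Put $$\kappa(Q,R)=\frac{\max\{\sigma_{\max}(Q),\sigma_{\max}(R)\}}{\min\{\sigma_{\min}(Q),\sigma_{\min}(R)\}},\qquad \tau(A,\rho)=\sup_{k\ge0}\|A^k\|\rho^{-k},$$ $$\beta=\max\Big\{1,\ \frac{\gamma_\infty^2\max\{\|A\|,\|B\|\}}{\gamma^2-\gamma_\infty^2}\,\tau(A,\rho)+\rho\Big\}.$$ **Theorem.** There is a universal constant $c>0$ such that the following holds. Suppose that $(A,B)$ is controllable and $(A,Q^{1/2})$ is detectable, let $\rho>\rho(A)$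 and $1\le\ell\le n_x$, and assume $\sigma_{\min}(Q)>0$ and $\sigma_{\min}(W_\ell(A,B))>0$ (so that $\kappa(Q,R)$ and $\sigma_{\min}(W_\ell(A,B))^{-1/2}$ are finite). If $\gamma>0$ satisfies $$\gamma^2\ \ge\ \gamma_\infty^2+\tfrac32\,\ell^{3/2}\beta^{\ell-1}\sigma_{\min}(W_\ell(A,B))^{-1/2}\,\tau(A,\rho)^2(\|B\|+1)\max\{\|A\|,\|B\|\}\,\gamma_\infty^2,$$ then $P_\star$ and $P_\gamma$ exist, $\rho(A+BF_\star)<1$, $\rho(A+BF_\gamma)<1$, both nominal costs are finite, and $$\begin{aligned}\mathrm{NC}(F_\gamma)-\mathrm{NC}(F_\star)\ \le\ {}& c\,\sigma_w^2\Big(\frac{\gamma_\infty^2}{\gamma^2-\gamma_\infty^2}\Big)^2 n_u\,\ell^5\beta^{4(\ell-1)}\big(1+\sigma_{\min}(W_\ell(A,B))^{-1/2}\big)^2\\&\times\|A+BF_\star\|^2\,\|W_\infty(A+BF_\gamma,I)\|\,\tau(A,\rho)^6\\&\times\frac{\|R+B^\top P_\star B\|}{\sigma_{\min}(R+B^\top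 P_\star B)^2}\,\kappa(Q,R)^2\|B\|^2(\|B\|+1)^4\\&\times\big(\max\{\|A\|,\|B\|\}^2\|P_\star\|^2+\gamma_\infty^2\big).\end{aligned}$$ -/

import Mathlib

open MeasureTheory ProbabilityTheory Filter
open scoped Matrix MatrixOrder Matrix.Norms.L2Operator ENNReal

/-! Throughout, `‖M‖` for a real matrix `M` is the spectral norm (largest singular value),
i.e. the operator norm with respect to the Euclidean norms. -/

noncomputable section

namespace AdvLQR

variable {n m : ℕ}

/-- The smallest singular value of a square matrix (Mathlib lists the singular values in
decreasing order, starting from index `0`). -/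
def sigmaMin (M : Matrix (Fin n) (Fin n) ℝ) : ℝ :=
  (Matrix.toEuclideanLin M).singularValues (n - 1)

/-- The spectral radius of a real square matrix: the largest modulus of a complex eigenvalue. -/
def specRad (A : Matrix (Fin n) (Fin n) ℝ) : ℝ≥0∞ :=
  spectralRadius ℂ (A.map (algebraMap ℝ ℂ))

/-- `(A, B)` is controllable: the matrix `[B, A B, …, A ^ (n - 1) B]` has rank `n`. -/
def IsControllable (A : Matrix (Fin n) (Fin n) ℝ) (B : Matrix (Fin n) (Fin m) ℝ) : Prop :=
  (Matrix.of fun (i : Fin n) (kj : Fin n × Fin m) => (A ^ (kj.1 : ℕ) * B) i kj.2).rank = n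

/-- `(A, C)` is detectable: some output injection `L` makes `A + L C` Schur stable. -/
def IsDetectable {p : ℕ} (A : Matrix (Fin n) (Fin n) ℝ) (C : Matrix (Fin p) (Fin n) ℝ) : Prop :=
  ∃ L : Matrix (Fin n) (Fin p) ℝ, specRad (A + L * C) < 1

/-- The `ℓ`-step controllability gramian `∑_{t=0}^ℓ A ^ t B Bᵀ (A ^ t)ᵀ`. -/
def gramian (A : Matrix (Fin n) (Fin n) ℝ) (B : Matrix (Fin n) (Fin m) ℝ) (ℓ : ℕ) :
    Matrix (Fin n) (Fin n) ℝ :=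
  ∑ t ∈ Finset.range (ℓ + 1), A ^ t * B * Bᵀ * (A ^ t)ᵀ

/-- The infinite-horizon controllability gramian; meaningful when `specRad A < 1`. -/
def gramianInf (A : Matrix (Fin n) (Fin n) ℝ) (B : Matrix (Fin n) (Fin m) ℝ) :
    Matrix (Fin n) (Fin n) ℝ :=
  ∑' t : ℕ, A ^ t * B * Bᵀ * (A ^ t)ᵀ

/-- `P` solves the discrete algebraic Riccati equation
`Q + Aᵀ P A - Aᵀ P B (Bᵀ P B + R)⁻¹ Bᵀ P A = P`. -/
def IsDARESolution {ι : Type} [Fintype ι] [DecidableEq ι] (A : Matrix (Fin n) (Fin n) ℝ)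
    (B : Matrix (Fin n) ι ℝ) (Q : Matrix (Fin n) (Fin n) ℝ) (R : Matrix ι ι ℝ)
    (P : Matrix (Fin n) (Fin n) ℝ) : Prop :=
  Q + Aᵀ * P * A - Aᵀ * P * B * (Bᵀ * P * B + R)⁻¹ * Bᵀ * P * A = P

/-- `P = P_⋆`: the positive semidefinite solution of the nominal Riccati equation. -/
def IsNominalValue (A : Matrix (Fin n) (Fin n) ℝ) (B : Matrix (Fin n) (Fin m) ℝ)
    (Q : Matrix (Fin n) (Fin n) ℝ) (R : Matrix (Fin m) (Fin m) ℝ)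
    (P : Matrix (Fin n) (Fin n) ℝ) : Prop :=
  P.PosSemidef ∧ IsDARESolution A B Q R P

/-- The block matrix `[I, B]` through which adversary and controller enter the dynamics. -/
def gameInput (B : Matrix (Fin n) (Fin m) ℝ) : Matrix (Fin n) (Fin n ⊕ Fin m) ℝ :=
  Matrix.fromCols 1 B

/-- The block weight `diag(-γ² I, R)` on adversary and controller. -/
def gameWeight (n : ℕ) (R : Matrix (Fin m) (Fin m) ℝ) (γ : ℝ) :
    Matrix (Fin n ⊕ Fin m) (Fin n ⊕ Fin m) ℝ :=
  Matrix.fromBlocks (-(γ ^ 2) • (1 : Matrix (Fin n) (Fin n) ℝ)) 0 0 R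

/-- The solvability conditions of the `γ`-adversarially robust problem: `P ⪰ 0`, `P ≺ γ² I`, and
`P` solves the Riccati equation of the game. -/
def IsRobustSolution (A : Matrix (Fin n) (Fin n) ℝ) (B : Matrix (Fin n) (Fin m) ℝ)
    (Q : Matrix (Fin n) (Fin n) ℝ) (R : Matrix (Fin m) (Fin m) ℝ) (γ : ℝ)
    (P : Matrix (Fin n) (Fin n) ℝ) : Prop :=
  P.PosSemidef ∧ (γ ^ 2 • (1 : Matrix (Fin n) (Fin n) ℝ) - P).PosDef ∧
    IsDARESolution A (gameInput B) Q (gameWeight n R γ) P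

/-- `P = P_γ`: the smallest (in the Loewner order) matrix satisfying the solvability conditions.
It is the limit of the finite-horizon Riccati recursion of the game. -/
def IsRobustValue (A : Matrix (Fin n) (Fin n) ℝ) (B : Matrix (Fin n) (Fin m) ℝ)
    (Q : Matrix (Fin n) (Fin n) ℝ) (R : Matrix (Fin m) (Fin m) ℝ) (γ : ℝ)
    (P : Matrix (Fin n) (Fin n) ℝ) : Prop :=
  IsRobustSolution A B Q R γ P ∧
    ∀ P' : Matrix (Fin n) (Fin n) ℝ, IsRobustSolution A B Q R γ P' → (P' - P).PosSemidef

/-- `γ_∞`: the infimum of the levels `γ > 0` at which the robust problem is solvable. -/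
def gammaInf (A : Matrix (Fin n) (Fin n) ℝ) (B : Matrix (Fin n) (Fin m) ℝ)
    (Q : Matrix (Fin n) (Fin n) ℝ) (R : Matrix (Fin m) (Fin m) ℝ) : ℝ :=
  sInf {γ : ℝ | 0 < γ ∧ ∃ P : Matrix (Fin n) (Fin n) ℝ, IsRobustSolution A B Q R γ P}

/-- The nominal (LQR) gain `F_⋆ = -(R + Bᵀ P B)⁻¹ Bᵀ P A`. -/
def nominalGain (A : Matrix (Fin n) (Fin n) ℝ) (B : Matrix (Fin n) (Fin m) ℝ)
    (R : Matrix (Fin m) (Fin m) ℝ) (P : Matrix (Fin n) (Fin n) ℝ) :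
    Matrix (Fin m) (Fin n) ℝ :=
  -((R + Bᵀ * P * B)⁻¹ * Bᵀ * P * A)

/-- The robust gain `F_γ`: the lower block of
`[E_γ; F_γ] = -Ψ⁻¹ [I, B]ᵀ P A`, with `Ψ = [I, B]ᵀ P [I, B] + diag(-γ² I, R)`. -/
def robustGain (A : Matrix (Fin n) (Fin n) ℝ) (B : Matrix (Fin n) (Fin m) ℝ)
    (R : Matrix (Fin m) (Fin m) ℝ) (γ : ℝ) (P : Matrix (Fin n) (Fin n) ℝ) :
    Matrix (Fin m) (Fin n) ℝ :=
  (-(((gameInput B)ᵀ * P * gameInput B + gameWeight n R γ)⁻¹ * (gameInput B)ᵀ * P * A)).toRows₂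

/-- The condition number
`κ(Q, R) = max {σ_max(Q), σ_max(R)} / min {σ_min(Q), σ_min(R)}`. -/
def kappa (Q : Matrix (Fin n) (Fin n) ℝ) (R : Matrix (Fin m) (Fin m) ℝ) : ℝ :=
  max ‖Q‖ ‖R‖ / min (sigmaMin Q) (sigmaMin R)

/-- `τ(A, ρ) = sup_k ‖A ^ k‖ ρ ^ (-k)`. -/
def tau (A : Matrix (Fin n) (Fin n) ℝ) (ρ : ℝ) : ℝ :=
  ⨆ k : ℕ, ‖A ^ k‖ / ρ ^ k

/-- `β = max {1, γ_∞² max {‖A‖, ‖B‖} / (γ² - γ_∞²) · τ(A, ρ) + ρ}`. -/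
def beta (A : Matrix (Fin n) (Fin n) ℝ) (B : Matrix (Fin n) (Fin m) ℝ)
    (Q : Matrix (Fin n) (Fin n) ℝ) (R : Matrix (Fin m) (Fin m) ℝ) (γ ρ : ℝ) : ℝ :=
  max 1 (gammaInf A B Q R ^ 2 * max ‖A‖ ‖B‖ / (γ ^ 2 - gammaInf A B Q R ^ 2) * tau A ρ + ρ)

/-- The stochastic data: a square-integrable zero-mean initial state `x₀` and a square-integrable,
i.i.d., zero-mean noise sequence `w` with covariance `I`, such that `E[x₀ w_tᵀ] = 0`. -/
structure IsNoise {Ω : Type*} [MeasurableSpace Ω] (μ : Measure Ω)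
    (x₀ : Ω → Fin n → ℝ) (w : ℕ → Ω → Fin n → ℝ) : Prop where
  memLp_init : ∀ i, MemLp (fun ω => x₀ ω i) 2 μ
  mean_init : ∀ i, ∫ ω, x₀ ω i ∂μ = 0
  indep : iIndepFun w μ
  identDistrib : ∀ t, IdentDistrib (w t) (w 0) μ μ
  memLp_noise : ∀ t i, MemLp (fun ω => w t ω i) 2 μ
  mean_noise : ∀ t i, ∫ ω, w t ω i ∂μ = 0
  cov_noise : ∀ t i j, ∫ ω, w t ω i * w t ω j ∂μ = if i = j then 1 else 0
  uncorr : ∀ t i j, ∫ ω, x₀ ω i * w t ω j ∂μ = 0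

/-- The nominal closed loop `x_{t+1} = A x_t + B u_t + σ w_t`, `u_t = F x_t` (no adversary). -/
def closedLoop {Ω : Type*} (A : Matrix (Fin n) (Fin n) ℝ) (B : Matrix (Fin n) (Fin m) ℝ)
    (σ : ℝ) (F : Matrix (Fin m) (Fin n) ℝ) (x₀ : Ω → Fin n → ℝ) (w : ℕ → Ω → Fin n → ℝ) :
    ℕ → Ω → Fin n → ℝ
  | 0 => x₀
  | t + 1 => fun ω =>
      A *ᵥ closedLoop A B σ F x₀ w t ω + B *ᵥ (F *ᵥ closedLoop A B σ F x₀ w t ω) + σ • w t ω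

/-- The squared performance output `‖z‖² = xᵀ Q x + uᵀ R u` for
`z = [Q^{1/2}; 0] x + [0; R^{1/2}] u`. -/
def stageCost (Q : Matrix (Fin n) (Fin n) ℝ) (R : Matrix (Fin m) (Fin m) ℝ)
    (x : Fin n → ℝ) (u : Fin m → ℝ) : ℝ :=
  x ⬝ᵥ Q *ᵥ x + u ⬝ᵥ R *ᵥ u

/-- The nominal cost `NC(F) = limsup_T (1/T) E[∑_{t<T} ‖z_t‖²]`, as an extended nonnegative
number. -/
def nominalCost {Ω : Type*} [MeasurableSpace Ω] (μ : Measure Ω)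
    (A : Matrix (Fin n) (Fin n) ℝ) (B : Matrix (Fin n) (Fin m) ℝ)
    (Q : Matrix (Fin n) (Fin n) ℝ) (R : Matrix (Fin m) (Fin m) ℝ) (σ : ℝ)
    (x₀ : Ω → Fin n → ℝ) (w : ℕ → Ω → Fin n → ℝ) (F : Matrix (Fin m) (Fin n) ℝ) : ℝ≥0∞ :=
  limsup (fun T : ℕ =>
    (∫⁻ ω, ∑ t ∈ Finset.range T, ENNReal.ofReal
      (stageCost Q R (closedLoop A B σ F x₀ w t ω) (F *ᵥ closedLoop A B σ F x₀ w t ω)) ∂μ)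
      / (T : ℝ≥0∞)) atTop

end AdvLQR

end

/-! Maximising over the disturbance turns the Riccati equation of the game into the ordinary one
with an inflated value: `P` solves it exactly when `ric A B Q R (adv γ P) = P`, and the robust gain
is the nominal gain computed from `adv γ P` (`isDARESolution_game_iff`, `robustGain_eq`). Everything
thus reduces to comparing `adv γ P_γ` with `P_⋆`.

A solution at a lower level is a supersolution at a higher one, so the minimal solution at level `γ`
lies below solutions at levels arbitrarily close to `γ_∞`, whence `P_γ ⪯ γ_∞² I`
(`exists_isRobustValue`). With `ε = γ_∞² / (γ² - γ_∞²)` this gives `adv γ P_γ ⪯ (1 + ε) P_γ`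
(`quad_adv_le`), so `P_γ` obeys the nominal Bellman inequality with the future cost multiplied by `1
+ ε`. Over an infinite horizon this factor would compound. Instead, in each block of `ℓ + 1` steps
the nominal trajectory is perturbed so as to end at a slightly shrunken point, which cancels the
expansion; the gramian prices the steering (`value_le_of_expansion`). The result is `‖adv γ P_γ -
P_⋆‖ = O(ε) ‖P_⋆‖` (`norm_adv_sub_le`).

The gain is Lipschitz in the value matrix (`norm_gain_sub_le`). The nominal cost is `σ²` times the
trace of a Lyapunov solution (`nominalCost_eq`), whose excess over `P_⋆` is quadratic in the gain
error (`exists_lyapunov_solution`); hence the factor `ε²`.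

Existence of both values comes from a trace-maximal subsolution in a compact set
(`exists_fixed_point`). Stability comes from `σ_min(Q) > 0`, which makes the value matrices strict
Lyapunov functions (`exists_decay`). -/

noncomputable section

namespace AdvLQR

/-! ### Quadratic forms and spectral norms of real matrices -/

section QuadraticForms

variable {n m k : ℕ}

/-- The value `xᵀ P x` of the quadratic form of `P`. -/
def quad (P : Matrix (Fin n) (Fin n) ℝ) (x : Fin n → ℝ) : ℝ := x ⬝ᵥ P *ᵥ x

lemma dot_self_nonneg (x : Fin n → ℝ) : 0 ≤ x ⬝ᵥ x :=
  Finset.sum_nonneg fun i _ => mul_self_nonneg (x i)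

lemma dot_self_pos {x : Fin n → ℝ} (hx : x ≠ 0) : 0 < x ⬝ᵥ x :=
  lt_of_le_of_ne (dot_self_nonneg x) fun h => hx (dotProduct_self_eq_zero.mp h.symm)

lemma sq_norm_toLp (x : Fin n → ℝ) : ‖WithLp.toLp 2 x‖ ^ 2 = x ⬝ᵥ x := by
  rw [EuclideanSpace.norm_sq_eq]
  simp [dotProduct, sq]

lemma dot_mulVec_self_le (M : Matrix (Fin m) (Fin n) ℝ) (x : Fin n → ℝ) :
    (M *ᵥ x) ⬝ᵥ (M *ᵥ x) ≤ ‖M‖ ^ 2 * (x ⬝ᵥ x) := by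
  have h := Matrix.l2_opNorm_mulVec M (WithLp.toLp 2 x)
  rw [← sq_norm_toLp, ← sq_norm_toLp, ← mul_pow]
  exact pow_le_pow_left₀ (norm_nonneg _) h 2

lemma norm_le_of_dot_le {M : Matrix (Fin m) (Fin n) ℝ} {c : ℝ} (hc : 0 ≤ c)
    (h : ∀ x, (M *ᵥ x) ⬝ᵥ (M *ᵥ x) ≤ c ^ 2 * (x ⬝ᵥ x)) : ‖M‖ ≤ c := by
  rw [Matrix.l2_opNorm_def]
  refine ContinuousLinearMap.opNorm_le_bound _ hc fun x => ?_
  refine le_of_sq_le_sq ?_ (by positivity)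
  have := h x.ofLp
  rw [← sq_norm_toLp, ← sq_norm_toLp, ← mul_pow] at this
  exact this

lemma quad_transpose_mul_mul (P : Matrix (Fin n) (Fin n) ℝ) (L : Matrix (Fin n) (Fin k) ℝ)
    (x : Fin k → ℝ) : quad (Lᵀ * P * L) x = quad P (L *ᵥ x) := by
  simp only [quad, ← Matrix.mulVec_mulVec]
  rw [Matrix.dotProduct_mulVec, Matrix.vecMul_transpose]

lemma dot_mulVec_mulVec (M : Matrix (Fin m) (Fin n) ℝ) (x : Fin m → ℝ) (y : Fin n → ℝ) :
    x ⬝ᵥ M *ᵥ y = (Mᵀ *ᵥ x) ⬝ᵥ y := by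
  rw [Matrix.dotProduct_mulVec, Matrix.mulVec_transpose]

lemma quad_add_matrix (P P' : Matrix (Fin n) (Fin n) ℝ) (x : Fin n → ℝ) :
    quad (P + P') x = quad P x + quad P' x := by
  simp [quad, Matrix.add_mulVec]

lemma quad_sub_matrix (P P' : Matrix (Fin n) (Fin n) ℝ) (x : Fin n → ℝ) :
    quad (P - P') x = quad P x - quad P' x := by
  simp [quad, Matrix.sub_mulVec]

lemma quad_smul_matrix (c : ℝ) (P : Matrix (Fin n) (Fin n) ℝ) (x : Fin n → ℝ) :
    quad (c • P) x = c * quad P x := by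
  simp [quad, Matrix.smul_mulVec]

@[simp] lemma quad_one (x : Fin n → ℝ) : quad 1 x = x ⬝ᵥ x := by simp [quad]

@[simp] lemma quad_zero (P : Matrix (Fin n) (Fin n) ℝ) : quad P 0 = 0 := by simp [quad]

lemma quad_smul (P : Matrix (Fin n) (Fin n) ℝ) (c : ℝ) (x : Fin n → ℝ) :
    quad P (c • x) = c ^ 2 * quad P x := by
  simp [quad, Matrix.mulVec_smul]; ring

lemma dot_mulVec_comm {P : Matrix (Fin n) (Fin n) ℝ} (hP : P.IsHermitian) (x y : Fin n → ℝ) :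
    x ⬝ᵥ P *ᵥ y = y ⬝ᵥ P *ᵥ x := by
  rw [dot_mulVec_mulVec, dotProduct_comm]
  congr 2

lemma quad_add {P : Matrix (Fin n) (Fin n) ℝ} (hP : P.IsHermitian) (x y : Fin n → ℝ) :
    quad P (x + y) = quad P x + 2 * (x ⬝ᵥ P *ᵥ y) + quad P y := by
  simp only [quad, Matrix.mulVec_add, dotProduct_add, add_dotProduct, dot_mulVec_comm hP y x]
  ring

lemma quad_nonneg {P : Matrix (Fin n) (Fin n) ℝ} (hP : P.PosSemidef) (x : Fin n → ℝ) :
    0 ≤ quad P x := by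
  simpa [quad] using hP.dotProduct_mulVec_nonneg x

lemma quad_pos {P : Matrix (Fin n) (Fin n) ℝ} (hP : P.PosDef) {x : Fin n → ℝ} (hx : x ≠ 0) :
    0 < quad P x := by
  simpa [quad] using hP.dotProduct_mulVec_pos hx

lemma posSemidef_of_quad {P : Matrix (Fin n) (Fin n) ℝ} (hP : P.IsHermitian)
    (h : ∀ x, 0 ≤ quad P x) : P.PosSemidef :=
  .of_dotProduct_mulVec_nonneg hP fun x => by simpa [quad] using h x

lemma posDef_of_quad {P : Matrix (Fin n) (Fin n) ℝ} (hP : P.IsHermitian)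
    (h : ∀ x, x ≠ 0 → 0 < quad P x) : P.PosDef :=
  .of_dotProduct_mulVec_pos hP fun x hx => by simpa [quad] using h x hx

lemma le_of_quad {P P' : Matrix (Fin n) (Fin n) ℝ} (hP : P.IsHermitian) (hP' : P'.IsHermitian)
    (h : ∀ x, quad P x ≤ quad P' x) : P ≤ P' :=
  Matrix.le_iff.mpr <| posSemidef_of_quad (hP'.sub hP) fun x => by
    rw [quad_sub_matrix]; linarith [h x]

lemma quad_le_of_le {P P' : Matrix (Fin n) (Fin n) ℝ} (h : P ≤ P') (x : Fin n → ℝ) :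
    quad P x ≤ quad P' x := by
  have := quad_nonneg (Matrix.le_iff.mp h) x
  rw [quad_sub_matrix] at this
  linarith

/-- Nonnegativity of the form at `η x - y`, divided by `η`. The weight stays free: it is later
matched to the adversary's penalty and to the size of a steering deviation. -/
lemma quad_add_le {P : Matrix (Fin n) (Fin n) ℝ} (hP : P.PosSemidef) {η : ℝ} (hη : 0 < η)
    (x y : Fin n → ℝ) :
    quad P (x + y) ≤ (1 + η) * quad P x + (1 + η⁻¹) * quad P y := by
  have h := quad_nonneg hP (η • x - y)
  rw [sub_eq_add_neg, ← neg_one_smul ℝ y, quad_add hP.1, quad_smul, quad_smul] at h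
  simp only [Matrix.mulVec_smul, dotProduct_smul, smul_dotProduct, smul_eq_mul] at h
  rw [quad_add hP.1]
  have h2 : 2 * (x ⬝ᵥ P *ᵥ y) ≤ η * quad P x + η⁻¹ * quad P y := by
    have : 0 ≤ η⁻¹ * (η ^ 2 * quad P x + 2 * (η * (-1 * (x ⬝ᵥ P *ᵥ y))) + (-1) ^ 2 * quad P y) :=
      mul_nonneg (by positivity) (by linarith)
    have e : η⁻¹ * (η ^ 2 * quad P x + 2 * (η * (-1 * (x ⬝ᵥ P *ᵥ y))) + (-1) ^ 2 * quad P y) =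
      η * quad P x - 2 * (x ⬝ᵥ P *ᵥ y) + η⁻¹ * quad P y := by
      field_simp
      ring
    linarith
  linarith

lemma quad_add_le_two {P : Matrix (Fin n) (Fin n) ℝ} (hP : P.PosSemidef) (x y : Fin n → ℝ) :
    quad P (x + y) ≤ 2 * quad P x + 2 * quad P y := by
  have := quad_add_le hP one_pos x y
  norm_num at this
  linarith

lemma dot_add_self_le (x y : Fin n → ℝ) :
    (x + y) ⬝ᵥ (x + y) ≤ 2 * (x ⬝ᵥ x) + 2 * (y ⬝ᵥ y) := by
  simpa using quad_add_le_two (P := (1 : Matrix (Fin n) (Fin n) ℝ)) .one x y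

lemma dot_sq_le (x y : Fin n → ℝ) : (x ⬝ᵥ y) ^ 2 ≤ (x ⬝ᵥ x) * (y ⬝ᵥ y) := by
  simpa [dotProduct, sq] using Finset.sum_mul_sq_le_sq_mul_sq Finset.univ x y

lemma dot_mulVec_le (M : Matrix (Fin m) (Fin n) ℝ) (x : Fin m → ℝ) (y : Fin n → ℝ) :
    (x ⬝ᵥ M *ᵥ y) ^ 2 ≤ ‖M‖ ^ 2 * (x ⬝ᵥ x) * (y ⬝ᵥ y) :=
  calc (x ⬝ᵥ M *ᵥ y) ^ 2 ≤ (x ⬝ᵥ x) * ((M *ᵥ y) ⬝ᵥ (M *ᵥ y)) := dot_sq_le _ _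
    _ ≤ (x ⬝ᵥ x) * (‖M‖ ^ 2 * (y ⬝ᵥ y)) :=
      mul_le_mul_of_nonneg_left (dot_mulVec_self_le M y) (dot_self_nonneg x)
    _ = _ := by ring

lemma quad_le_norm (P : Matrix (Fin n) (Fin n) ℝ) (x : Fin n → ℝ) :
    quad P x ≤ ‖P‖ * (x ⬝ᵥ x) := by
  have h := dot_mulVec_le P x x
  refine le_of_sq_le_sq (h.trans_eq (by ring)) (mul_nonneg (norm_nonneg _) (dot_self_nonneg x))

lemma quad_sum_vec_le {ι : Type*} (s : Finset ι) (f : ι → Fin n → ℝ) :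
    (∑ i ∈ s, f i) ⬝ᵥ (∑ i ∈ s, f i) ≤ s.card * ∑ i ∈ s, f i ⬝ᵥ f i := by
  simp only [dotProduct, Finset.sum_apply]
  rw [Finset.sum_comm, Finset.mul_sum]
  refine Finset.sum_le_sum fun j _ => ?_
  simpa [sq] using sq_sum_le_card_mul_sum_sq (s := s) (f := fun i => f i j)

/-- For positive semidefinite `P`, a bound on the quadratic form bounds the spectral norm. -/
lemma norm_le_of_quad_le {P : Matrix (Fin n) (Fin n) ℝ} (hP : P.PosSemidef) {c : ℝ} (hc : 0 ≤ c)
    (h : ∀ x, quad P x ≤ c * (x ⬝ᵥ x)) : ‖P‖ ≤ c := by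
  refine norm_le_of_dot_le hc fun x => ?_
  -- Cauchy–Schwarz in the form of `P`, applied to `x` and `P x`
  set y := P *ᵥ x with hy
  rcases eq_or_lt_of_le (dot_self_nonneg y) with h0 | h0
  · rw [← h0]; exact mul_nonneg (sq_nonneg c) (dot_self_nonneg x)
  · have key : ∀ t : ℝ, 0 ≤ quad P x - 2 * t * (y ⬝ᵥ y) + t ^ 2 * (c * (y ⬝ᵥ y)) := by
      intro t
      have h1 := quad_nonneg hP (x + (-t) • y)
      rw [quad_add hP.1, quad_smul, Matrix.mulVec_smul, dotProduct_smul,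
        dot_mulVec_comm hP.1 x y, ← hy, smul_eq_mul] at h1
      nlinarith [h y, sq_nonneg t]
    have hcpos : 0 < c := by
      rcases eq_or_lt_of_le hc with rfl | hc'
      -- For `c = 0` the expression in `key` is affine in `t` with negative slope, and this `t`
      -- makes it negative. For `c > 0` the choice `c⁻¹` below is its minimiser.
      · have := key ((quad P x + 1) / (y ⬝ᵥ y))
        have e : (quad P x + 1) / (y ⬝ᵥ y) * (y ⬝ᵥ y) = quad P x + 1 := by field_simp
        have h2 := h x
        nlinarith [quad_nonneg hP x]
      · exact hc'
    have h1 := key c⁻¹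
    have e : quad P x - 2 * c⁻¹ * (y ⬝ᵥ y) + c⁻¹ ^ 2 * (c * (y ⬝ᵥ y)) =
        quad P x - c⁻¹ * (y ⬝ᵥ y) := by field_simp; ring
    rw [e] at h1
    have h2 : y ⬝ᵥ y ≤ c * quad P x := by
      have : c⁻¹ * (y ⬝ᵥ y) ≤ quad P x := by linarith
      calc y ⬝ᵥ y = c * (c⁻¹ * (y ⬝ᵥ y)) := by field_simp
        _ ≤ _ := mul_le_mul_of_nonneg_left this hc
    nlinarith [h x]

lemma norm_le_norm_of_quad_le {P P' : Matrix (Fin n) (Fin n) ℝ} (hP : P.PosSemidef) {c : ℝ}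
    (hc : 0 ≤ c) (h : ∀ x, quad P x ≤ c * quad P' x) : ‖P‖ ≤ c * ‖P'‖ :=
  norm_le_of_quad_le hP (by positivity) fun x =>
    (h x).trans <| (mul_le_mul_of_nonneg_left (quad_le_norm P' x) hc).trans_eq (by ring)

lemma norm_transpose (M : Matrix (Fin m) (Fin n) ℝ) : ‖Mᵀ‖ = ‖M‖ := by
  rw [← Matrix.conjTranspose_eq_transpose_of_trivial, Matrix.l2_opNorm_conjTranspose]

lemma isHermitian_transpose_mul_mul {P : Matrix (Fin n) (Fin n) ℝ} (hP : P.IsHermitian)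
    (L : Matrix (Fin n) (Fin k) ℝ) : (Lᵀ * P * L).IsHermitian := by
  rw [Matrix.IsHermitian, Matrix.conjTranspose_eq_transpose_of_trivial] at *
  simp [Matrix.transpose_mul, hP, Matrix.mul_assoc]

lemma posSemidef_transpose_mul_mul {P : Matrix (Fin n) (Fin n) ℝ} (hP : P.PosSemidef)
    (L : Matrix (Fin n) (Fin k) ℝ) : (Lᵀ * P * L).PosSemidef :=
  posSemidef_of_quad (isHermitian_transpose_mul_mul hP.1 L) fun x => by
    rw [quad_transpose_mul_mul]; exact quad_nonneg hP _

lemma trace_eq_sum_quad (P : Matrix (Fin n) (Fin n) ℝ) :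
    P.trace = ∑ i, quad P (Pi.single i 1) := by
  simp [Matrix.trace, quad]

/-! ### The smallest singular value -/

/-- The squared singular values are the eigenvalues of `T* T` in decreasing order, so index `n - 1`
carries the smallest one; expand in an eigenbasis. -/
lemma sigmaMin_sq_mul_le (M : Matrix (Fin n) (Fin n) ℝ) (x : Fin n → ℝ) :
    sigmaMin M ^ 2 * (x ⬝ᵥ x) ≤ (M *ᵥ x) ⬝ᵥ (M *ᵥ x) := by
  rcases Nat.eq_zero_or_pos n with rfl | hn
  · simp [dotProduct]
  set T := Matrix.toEuclideanLin M with hT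
  have hf : Module.finrank ℝ (EuclideanSpace ℝ (Fin n)) = n := by simp
  set hs := T.isSymmetric_adjoint_comp_self
  set b := hs.eigenvectorBasis hf
  set v : EuclideanSpace ℝ (Fin n) := WithLp.toLp 2 x
  have h1 : (M *ᵥ x) ⬝ᵥ (M *ᵥ x) = inner ℝ ((T.adjoint ∘ₗ T) v) v := by
    rw [LinearMap.comp_apply, LinearMap.adjoint_inner_left, real_inner_self_eq_norm_sq,
      ← sq_norm_toLp]
    rfl
  have h2 : inner ℝ ((T.adjoint ∘ₗ T) v) v =
      ∑ i, hs.eigenvalues hf i * (b.repr v i) ^ 2 := by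
    rw [← b.repr.inner_map_map, PiLp.inner_apply]
    refine Finset.sum_congr rfl fun i _ => ?_
    rw [hs.eigenvectorBasis_apply_self_apply hf]
    simp [b]; ring
  have h3 : x ⬝ᵥ x = ∑ i, (b.repr v i) ^ 2 := by
    rw [← sq_norm_toLp, ← b.repr.norm_map, EuclideanSpace.norm_sq_eq]
    simp [v]
  rw [h1, h2, h3, Finset.mul_sum]
  refine Finset.sum_le_sum fun i _ => mul_le_mul_of_nonneg_right ?_ (sq_nonneg _)
  rw [sigmaMin, ← hT, T.sq_singularValues_of_lt hf (by omega : n - 1 < n)]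
  exact hs.eigenvalues_antitone hf (by rw [Fin.le_def]; simp; omega)

/-- Testing `sigmaMin_sq_mul_le` on eigenvectors puts every eigenvalue of `P` above `sigmaMin P`, so
`P - sigmaMin P • 1` is positive semidefinite by the spectral theorem. -/
lemma sigmaMin_mul_le_quad {P : Matrix (Fin n) (Fin n) ℝ} (hP : P.PosSemidef) (x : Fin n → ℝ) :
    sigmaMin P * (x ⬝ᵥ x) ≤ quad P x := by
  have hev : ∀ i, sigmaMin P ≤ hP.1.eigenvalues i := by
    intro i
    have h := sigmaMin_sq_mul_le P (hP.1.eigenvectorBasis i).ofLp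
    rw [hP.1.mulVec_eigenvectorBasis i, smul_dotProduct, dotProduct_smul, smul_eq_mul,
      smul_eq_mul, ← mul_assoc, ← sq_norm_toLp] at h
    have hn : ‖WithLp.toLp 2 (hP.1.eigenvectorBasis i).ofLp‖ = 1 :=
      hP.1.eigenvectorBasis.norm_eq_one i
    rw [hn] at h
    exact le_of_sq_le_sq (by linarith) (hP.eigenvalues_nonneg i)
  have hpsd : (P - sigmaMin P • 1).PosSemidef := by
    have hsub : (P - sigmaMin P • 1) = (hP.1.eigenvectorUnitary : Matrix (Fin n) (Fin n) ℝ) *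
        Matrix.diagonal (fun i => hP.1.eigenvalues i - sigmaMin P) *
        (hP.1.eigenvectorUnitary : Matrix (Fin n) (Fin n) ℝ)ᴴ := by
      have h1 := hP.1.spectral_theorem
      rw [Unitary.conjStarAlgAut_apply] at h1
      have h2 : Matrix.diagonal (fun i => hP.1.eigenvalues i - sigmaMin P) =
        Matrix.diagonal (RCLike.ofReal ∘ hP.1.eigenvalues) - sigmaMin P • 1 := by
        ext i j
        by_cases hij : i = j <;> simp [hij]
      have h3 : (hP.1.eigenvectorUnitary : Matrix (Fin n) (Fin n) ℝ) *
          (hP.1.eigenvectorUnitary : Matrix (Fin n) (Fin n) ℝ)ᴴ = 1 :=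
        Unitary.coe_mul_star_self _
      rw [h2, mul_sub, sub_mul, mul_smul_comm, smul_mul_assoc, mul_one, h3]
      nth_rw 1 [h1]
      rfl
    rw [hsub]
    exact (Matrix.PosSemidef.diagonal fun i => sub_nonneg.mpr (hev i)).mul_mul_conjTranspose_same _
  have := quad_nonneg hpsd x
  rw [quad_sub_matrix, quad_smul_matrix, quad_one] at this
  linarith

lemma sigmaMin_pos_of_posDef [NeZero n] {P : Matrix (Fin n) (Fin n) ℝ} (hP : P.PosDef) :
    0 < sigmaMin P := by
  have hinj : Function.Injective (Matrix.toEuclideanLin P) := by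
    rw [← LinearMap.ker_eq_bot, LinearMap.ker_eq_bot']
    intro v hv
    have h1 : P *ᵥ v.ofLp = 0 := congrArg WithLp.ofLp hv
    by_contra hne
    have h2 : v.ofLp ≠ 0 := fun h => hne (by ext i; simp [h])
    have := quad_pos hP h2
    simp [quad, h1] at this
  refine (LinearMap.injective_iff_forall_lt_finrank_singularValues_pos _).mp hinj _ ?_
  simpa using Nat.sub_lt (NeZero.pos n) one_pos

lemma sigmaMin_le_norm [NeZero n] (P : Matrix (Fin n) (Fin n) ℝ) : sigmaMin P ≤ ‖P‖ := by
  have h := (sigmaMin_sq_mul_le P (Pi.single 0 1)).trans (dot_mulVec_self_le P _)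
  simp only [single_dotProduct, Pi.single_eq_same, mul_one] at h
  exact le_of_sq_le_sq h (norm_nonneg _)

lemma posDef_of_sigmaMin_pos {P : Matrix (Fin n) (Fin n) ℝ} (hP : P.PosSemidef)
    (h : 0 < sigmaMin P) : P.PosDef :=
  posDef_of_quad hP.1 fun x hx =>
    (mul_pos h (dot_self_pos hx)).trans_le (sigmaMin_mul_le_quad hP x)

end QuadraticForms

/-! ### The Riccati operator -/

section Riccati

variable {n m : ℕ} {A : Matrix (Fin n) (Fin n) ℝ} {B : Matrix (Fin n) (Fin m) ℝ}
  {Q : Matrix (Fin n) (Fin n) ℝ} {R : Matrix (Fin m) (Fin m) ℝ}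

/-- The Riccati operator `Y ↦ Q + Aᵀ Y A - Aᵀ Y B (Bᵀ Y B + R)⁻¹ Bᵀ Y A`. -/
def ric (A : Matrix (Fin n) (Fin n) ℝ) (B : Matrix (Fin n) (Fin m) ℝ)
    (Q : Matrix (Fin n) (Fin n) ℝ) (R : Matrix (Fin m) (Fin m) ℝ)
    (Y : Matrix (Fin n) (Fin n) ℝ) : Matrix (Fin n) (Fin n) ℝ :=
  Q + Aᵀ * Y * A - Aᵀ * Y * B * (Bᵀ * Y * B + R)⁻¹ * Bᵀ * Y * A

lemma transpose_eq_of_isHermitian {P : Matrix (Fin n) (Fin n) ℝ} (hP : P.IsHermitian) :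
    Pᵀ = P := by
  rw [← Matrix.conjTranspose_eq_transpose_of_trivial]; exact hP

lemma posDef_input_weight (hR : R.PosDef) {Y : Matrix (Fin n) (Fin n) ℝ} (hY : Y.PosSemidef) :
    (R + Bᵀ * Y * B).PosDef :=
  hR.add_posSemidef (posSemidef_transpose_mul_mul hY B)

/-- Stationarity in `u` of the Bellman expression. Later computations use the gain through this
equation rather than through the inverse. -/
lemma input_weight_mul_nominalGain (hR : R.PosDef) {Y : Matrix (Fin n) (Fin n) ℝ}
    (hY : Y.PosSemidef) :
    (R + Bᵀ * Y * B) * nominalGain A B R Y = -(Bᵀ * Y * A) := by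
  have h := (posDef_input_weight (B := B) hR hY).isUnit
  rw [nominalGain, Matrix.mul_neg, Matrix.mul_assoc _ Bᵀ, Matrix.mul_assoc _ (Bᵀ * Y),
    Matrix.mul_nonsing_inv_cancel_left _ _ ((Matrix.isUnit_iff_isUnit_det _).mp h)]

lemma ric_eq (Y : Matrix (Fin n) (Fin n) ℝ) :
    ric A B Q R Y = Q + Aᵀ * Y * (A + B * nominalGain A B R Y) := by
  simp only [ric, nominalGain, Matrix.mul_add, Matrix.mul_neg, Matrix.mul_assoc, add_comm (Bᵀ * (Y * B)) R,
    sub_eq_add_neg, add_assoc]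

lemma isHermitian_ric (hQ : Q.IsHermitian) (hR : R.IsHermitian) {Y : Matrix (Fin n) (Fin n) ℝ}
    (hY : Y.IsHermitian) : (ric A B Q R Y).IsHermitian := by
  have h1 := (isHermitian_transpose_mul_mul hY B).add hR
  have h2 := transpose_eq_of_isHermitian h1.inv
  rw [Matrix.mul_assoc] at h2
  refine (hQ.add (isHermitian_transpose_mul_mul hY A)).sub ?_
  rw [Matrix.IsHermitian, Matrix.conjTranspose_eq_transpose_of_trivial]
  simp only [Matrix.transpose_mul, Matrix.transpose_transpose, transpose_eq_of_isHermitian hY, h2,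
    Matrix.mul_assoc]

/-- Completing the square in the Bellman equation. -/
lemma stageCost_add_quad (hR : R.PosDef) {Y : Matrix (Fin n) (Fin n) ℝ}
    (hY : Y.PosSemidef) (x : Fin n → ℝ) (u : Fin m → ℝ) :
    stageCost Q R x u + quad Y (A *ᵥ x + B *ᵥ u) =
      quad (ric A B Q R Y) x + quad (R + Bᵀ * Y * B) (u - nominalGain A B R Y *ᵥ x) := by
  set K := nominalGain A B R Y with hK
  have hS := posDef_input_weight (B := B) hR hY
  have hSK : (R + Bᵀ * Y * B) *ᵥ (K *ᵥ x) = -(Bᵀ *ᵥ (Y *ᵥ (A *ᵥ x))) := by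
    rw [Matrix.mulVec_mulVec, input_weight_mul_nominalGain hR hY]
    simp [Matrix.neg_mulVec, Matrix.mulVec_mulVec, Matrix.mul_assoc]
  have h1 : quad (R + Bᵀ * Y * B) (u - K *ᵥ x) = quad R u + quad Y (B *ᵥ u) +
      2 * ((B *ᵥ u) ⬝ᵥ Y *ᵥ (A *ᵥ x)) - (K *ᵥ x) ⬝ᵥ Bᵀ *ᵥ (Y *ᵥ (A *ᵥ x)) := by
    rw [sub_eq_add_neg, quad_add hS.1, Matrix.mulVec_neg, hSK, quad_add_matrix,
      quad_transpose_mul_mul, neg_neg, dot_mulVec_mulVec Bᵀ u, Matrix.transpose_transpose]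
    simp only [quad, Matrix.mulVec_neg, hSK, neg_dotProduct, neg_neg]
    rw [dotProduct_comm (K *ᵥ x)]
    ring
  have h2 : quad (ric A B Q R Y) x = quad Q x + quad Y (A *ᵥ x) +
      (K *ᵥ x) ⬝ᵥ Bᵀ *ᵥ (Y *ᵥ (A *ᵥ x)) := by
    rw [ric_eq, ← hK, Matrix.mul_add, ← add_assoc, quad_add_matrix, quad_add_matrix,
      quad_transpose_mul_mul]
    congr 1
    rw [quad, Matrix.mul_assoc, ← Matrix.mulVec_mulVec, ← Matrix.mulVec_mulVec,
      ← Matrix.mulVec_mulVec, dot_mulVec_mulVec, Matrix.transpose_transpose,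
      dot_mulVec_comm hY.1, dot_mulVec_mulVec Bᵀ, Matrix.transpose_transpose]
  rw [h1, h2, quad_add hY.1, dot_mulVec_comm hY.1 (A *ᵥ x)]
  simp only [stageCost, quad]
  ring

lemma quad_ric_le (hR : R.PosDef) {Y : Matrix (Fin n) (Fin n) ℝ} (hY : Y.PosSemidef)
    (x : Fin n → ℝ) (u : Fin m → ℝ) :
    quad (ric A B Q R Y) x ≤ stageCost Q R x u + quad Y (A *ᵥ x + B *ᵥ u) := by
  rw [stageCost_add_quad hR hY]
  linarith [quad_nonneg (posDef_input_weight (B := B) hR hY).posSemidef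
    (u - nominalGain A B R Y *ᵥ x)]

lemma quad_ric (hR : R.PosDef) {Y : Matrix (Fin n) (Fin n) ℝ} (hY : Y.PosSemidef)
    (x : Fin n → ℝ) :
    quad (ric A B Q R Y) x = stageCost Q R x (nominalGain A B R Y *ᵥ x) +
      quad Y ((A + B * nominalGain A B R Y) *ᵥ x) := by
  have h := stageCost_add_quad (A := A) (B := B) (Q := Q) hR hY x (nominalGain A B R Y *ᵥ x)
  rw [sub_self, quad_zero, add_zero] at h
  rw [← h, Matrix.add_mulVec, ← Matrix.mulVec_mulVec]

lemma stageCost_eq (x : Fin n → ℝ) (u : Fin m → ℝ) :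
    stageCost Q R x u = quad Q x + quad R u := rfl

lemma stageCost_nonneg (hQ : Q.PosSemidef) (hR : R.PosSemidef) (x : Fin n → ℝ) (u : Fin m → ℝ) :
    0 ≤ stageCost Q R x u := add_nonneg (quad_nonneg hQ x) (quad_nonneg hR u)

lemma ric_posSemidef (hQ : Q.PosSemidef) (hR : R.PosDef) {Y : Matrix (Fin n) (Fin n) ℝ}
    (hY : Y.PosSemidef) : (ric A B Q R Y).PosSemidef :=
  posSemidef_of_quad (isHermitian_ric hQ.1 hR.1 hY.1) fun x => by
    rw [quad_ric hR hY]
    exact add_nonneg (stageCost_nonneg hQ hR.posSemidef _ _) (quad_nonneg hY _)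

/-- The gain that is optimal for `Y'` is admissible, possibly suboptimal, for `Y`. -/
lemma quad_ric_mono (hR : R.PosDef) {Y Y' : Matrix (Fin n) (Fin n) ℝ} (hY : Y.PosSemidef)
    (hY' : Y'.PosSemidef) (h : ∀ x, quad Y x ≤ quad Y' x) (x : Fin n → ℝ) :
    quad (ric A B Q R Y) x ≤ quad (ric A B Q R Y') x := by
  have h1 := quad_ric_le (A := A) (B := B) (Q := Q) hR hY x (nominalGain A B R Y' *ᵥ x)
  rw [quad_ric hR hY']
  rw [Matrix.mulVec_mulVec, ← Matrix.add_mulVec] at h1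
  linarith [h ((A + B * nominalGain A B R Y') *ᵥ x)]

/-- The difference of two gains, in terms of the difference of the value matrices. -/
lemma input_weight_mul_gain_sub (hR : R.PosDef) {Y Y' : Matrix (Fin n) (Fin n) ℝ}
    (hY : Y.PosSemidef) (hY' : Y'.PosSemidef) :
    (R + Bᵀ * Y * B) * (nominalGain A B R Y - nominalGain A B R Y') =
      -(Bᵀ * (Y - Y') * (A + B * nominalGain A B R Y')) := by
  have h1 := input_weight_mul_nominalGain (A := A) (B := B) hR hY
  have h2 := input_weight_mul_nominalGain (A := A) (B := B) hR hY'
  rw [Matrix.mul_sub, h1]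
  have e : (R + Bᵀ * Y * B) * nominalGain A B R Y' =
      (R + Bᵀ * Y' * B) * nominalGain A B R Y' + Bᵀ * (Y - Y') * (B * nominalGain A B R Y') := by
    simp only [Matrix.add_mul, Matrix.mul_sub, Matrix.sub_mul, Matrix.mul_assoc]
    abel
  rw [e, h2, Matrix.mul_add]
  simp only [Matrix.mul_sub, Matrix.sub_mul]
  abel

/-! ### Eliminating the adversary -/

/-- The value matrix `P + P (γ² I - P)⁻¹ P` seen by the controller once the adversary has been
maximised out. -/
def adv (γ : ℝ) (P : Matrix (Fin n) (Fin n) ℝ) : Matrix (Fin n) (Fin n) ℝ :=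
  P + P * (γ ^ 2 • 1 - P)⁻¹ * P

lemma isHermitian_adv {γ : ℝ} {P : Matrix (Fin n) (Fin n) ℝ} (hP : P.IsHermitian) :
    (adv γ P).IsHermitian := by
  have h1 : (γ ^ 2 • (1 : Matrix (Fin n) (Fin n) ℝ) - P).IsHermitian :=
    (Matrix.isHermitian_one.smul (IsSelfAdjoint.all _)).sub hP
  have h2 := isHermitian_transpose_mul_mul h1.inv P
  rw [transpose_eq_of_isHermitian hP] at h2
  exact hP.add h2

/-- Completing the square in the disturbance `d`. The left side is concave in `d` because `γ² I - P
≻ 0`, so `adv γ P` is its maximum, attained at `(γ² I - P)⁻¹ P x`. -/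
lemma quad_adv_sub {γ : ℝ} {P : Matrix (Fin n) (Fin n) ℝ} (hP : P.PosSemidef)
    (hG : (γ ^ 2 • 1 - P).PosDef) (x d : Fin n → ℝ) :
    quad P (x + d) - γ ^ 2 * (d ⬝ᵥ d) =
      quad (adv γ P) x - quad (γ ^ 2 • 1 - P) (d - (γ ^ 2 • 1 - P)⁻¹ *ᵥ (P *ᵥ x)) := by
  set G := γ ^ 2 • 1 - P with hGdef
  have hGinv : G *ᵥ (G⁻¹ *ᵥ (P *ᵥ x)) = P *ᵥ x := by
    rw [Matrix.mulVec_mulVec, Matrix.mul_nonsing_inv _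
      ((Matrix.isUnit_iff_isUnit_det _).mp hG.isUnit), Matrix.one_mulVec]
  have h1 : quad (adv γ P) x = quad P x + (G⁻¹ *ᵥ (P *ᵥ x)) ⬝ᵥ (P *ᵥ x) := by
    rw [adv, quad_add_matrix, ← hGdef]
    congr 1
    nth_rw 1 [← transpose_eq_of_isHermitian hP.1]
    rw [quad_transpose_mul_mul, quad, dotProduct_comm]
  have h2 : quad G d = γ ^ 2 * (d ⬝ᵥ d) - quad P d := by
    rw [hGdef, quad_sub_matrix, quad_smul_matrix, quad_one]
  rw [h1, quad_add hP.1, sub_eq_add_neg d, quad_add hG.1, h2, Matrix.mulVec_neg, hGinv,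
    dotProduct_neg, dot_mulVec_comm hP.1 x d]
  simp only [quad, Matrix.mulVec_neg, hGinv, neg_dotProduct, dotProduct_neg]
  ring

lemma le_quad_adv {γ : ℝ} {P : Matrix (Fin n) (Fin n) ℝ} (hP : P.PosSemidef)
    (hG : (γ ^ 2 • 1 - P).PosDef) (x d : Fin n → ℝ) :
    quad P (x + d) - γ ^ 2 * (d ⬝ᵥ d) ≤ quad (adv γ P) x := by
  rw [quad_adv_sub hP hG]
  linarith [quad_nonneg hG.posSemidef (d - (γ ^ 2 • 1 - P)⁻¹ *ᵥ (P *ᵥ x))]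

lemma exists_quad_adv {γ : ℝ} {P : Matrix (Fin n) (Fin n) ℝ} (hP : P.PosSemidef)
    (hG : (γ ^ 2 • 1 - P).PosDef) (x : Fin n → ℝ) :
    ∃ d, quad (adv γ P) x = quad P (x + d) - γ ^ 2 * (d ⬝ᵥ d) :=
  ⟨_, by rw [quad_adv_sub hP hG, sub_self, quad_zero, sub_zero]⟩

lemma quad_le_quad_adv {γ : ℝ} {P : Matrix (Fin n) (Fin n) ℝ} (hP : P.PosSemidef)
    (hG : (γ ^ 2 • 1 - P).PosDef) (x : Fin n → ℝ) : quad P x ≤ quad (adv γ P) x := by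
  simpa using le_quad_adv hP hG x 0

lemma adv_posSemidef {γ : ℝ} {P : Matrix (Fin n) (Fin n) ℝ} (hP : P.PosSemidef)
    (hG : (γ ^ 2 • 1 - P).PosDef) : (adv γ P).PosSemidef :=
  posSemidef_of_quad (isHermitian_adv hP.1) fun x =>
    (quad_nonneg hP x).trans (quad_le_quad_adv hP hG x)

/-- Insert the maximiser for `(γ, P)` into the problem for `(γ', P')`: a larger value and a smaller
penalty both help the adversary. -/
lemma quad_adv_mono {γ γ' : ℝ} {P P' : Matrix (Fin n) (Fin n) ℝ} (hP : P.PosSemidef)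
    (hG : (γ ^ 2 • 1 - P).PosDef) (hP' : P'.PosSemidef) (hG' : (γ' ^ 2 • 1 - P').PosDef)
    (hγ : γ' ^ 2 ≤ γ ^ 2) (h : ∀ x, quad P x ≤ quad P' x) (x : Fin n → ℝ) :
    quad (adv γ P) x ≤ quad (adv γ' P') x := by
  obtain ⟨d, hd⟩ := exists_quad_adv hP hG x
  have := le_quad_adv hP' hG' x d
  rw [hd]
  nlinarith [h (x + d), dot_self_nonneg d]

lemma posDef_smul_one_sub {c : ℝ} {P : Matrix (Fin n) (Fin n) ℝ} (hP : P.IsHermitian) {g : ℝ}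
    (hg : g < c) (h : ∀ x, quad P x ≤ g * (x ⬝ᵥ x)) : (c • 1 - P).PosDef := by
  refine posDef_of_quad ((Matrix.isHermitian_one.smul (IsSelfAdjoint.all _)).sub hP) fun x hx => ?_
  rw [quad_sub_matrix, quad_smul_matrix, quad_one]
  nlinarith [h x, dot_self_pos hx]

/-- If `P ⪯ g I` with `g < γ²`, the adversary inflates the value by at most the factor
`γ² / (γ² - g) = 1 + g / (γ² - g)`. -/
lemma quad_adv_le {γ g : ℝ} {P : Matrix (Fin n) (Fin n) ℝ} (hP : P.PosSemidef) (hg0 : 0 < g)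
    (hg : g < γ ^ 2) (h : ∀ x, quad P x ≤ g * (x ⬝ᵥ x)) (x : Fin n → ℝ) :
    quad (adv γ P) x ≤ (1 + g / (γ ^ 2 - g)) * quad P x := by
  obtain ⟨d, hd⟩ := exists_quad_adv hP (posDef_smul_one_sub hP.1 hg h) x
  have hpos : 0 < γ ^ 2 - g := sub_pos.mpr hg
  -- With this weight `(1 + η⁻¹) g = γ²`, so the penalty exactly pays for the disturbance part of
  -- the splitting.
  have h1 := quad_add_le hP (div_pos hg0 hpos) x d
  have h2 : (1 + (g / (γ ^ 2 - g))⁻¹) * quad P d ≤ γ ^ 2 * (d ⬝ᵥ d) := by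
    have e : 1 + (g / (γ ^ 2 - g))⁻¹ = γ ^ 2 / g := by field_simp; ring
    rw [e]
    calc γ ^ 2 / g * quad P d ≤ γ ^ 2 / g * (g * (d ⬝ᵥ d)) :=
          mul_le_mul_of_nonneg_left (h d) (by positivity)
      _ = _ := by field_simp
  rw [hd]
  linarith

/-! ### The Riccati equation of the game -/

lemma game_matrix_eq (γ : ℝ) (P : Matrix (Fin n) (Fin n) ℝ) :
    (gameInput B)ᵀ * P * gameInput B + gameWeight n R γ =
      Matrix.fromBlocks (-(γ ^ 2 • 1 - P)) (P * B) (Bᵀ * P) (Bᵀ * P * B + R) := by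
  rw [gameInput, gameWeight, Matrix.transpose_fromCols, Matrix.fromRows_mul,
    Matrix.fromRows_mul_fromCols, Matrix.fromBlocks_add]
  simp [sub_eq_add_neg, add_comm]

/-- The block matrix is indefinite, so invertibility goes through the Schur complement: eliminating
the adversary block leaves `R + Bᵀ (adv γ P) B`, which is positive definite. -/
lemma isUnit_game_matrix (hR : R.PosDef) {γ : ℝ} {P : Matrix (Fin n) (Fin n) ℝ}
    (hP : P.PosSemidef) (hG : (γ ^ 2 • 1 - P).PosDef) :
    IsUnit ((gameInput B)ᵀ * P * gameInput B + gameWeight n R γ) := by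
  rw [← Matrix.mulVec_injective_iff_isUnit, game_matrix_eq,
    ← Matrix.coe_mulVecLin, ← LinearMap.ker_eq_bot, LinearMap.ker_eq_bot']
  intro v hv
  rw [Matrix.mulVecLin_apply, Matrix.fromBlocks_mulVec] at hv
  set G := γ ^ 2 • 1 - P with hGdef
  set e := v ∘ Sum.inl
  set f := v ∘ Sum.inr
  have h1 : -G *ᵥ e + (P * B) *ᵥ f = 0 := by
    ext i; exact congrFun hv (Sum.inl i)
  have h2 : (Bᵀ * P) *ᵥ e + (Bᵀ * P * B + R) *ᵥ f = 0 := by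
    ext i; exact congrFun hv (Sum.inr i)
  have hGu := (Matrix.isUnit_iff_isUnit_det _).mp hG.isUnit
  have he : e = (G⁻¹ * (P * B)) *ᵥ f := by
    have : G *ᵥ e = (P * B) *ᵥ f := by
      rw [Matrix.neg_mulVec] at h1
      rw [eq_comm, ← sub_eq_zero, sub_eq_neg_add, h1]
    rw [← Matrix.mulVec_mulVec, ← this, Matrix.mulVec_mulVec, Matrix.nonsing_inv_mul _ hGu,
      Matrix.one_mulVec]
  have hf : (R + Bᵀ * adv γ P * B) *ᵥ f = 0 := by
    rw [← h2, he, Matrix.mulVec_mulVec, ← Matrix.add_mulVec, adv, ← hGdef]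
    congr 1
    simp only [Matrix.mul_add, Matrix.add_mul, Matrix.mul_assoc]
    abel
  have hf0 : f = 0 := by
    by_contra hne
    have := quad_pos (posDef_input_weight (B := B) hR (adv_posSemidef hP hG)) hne
    rw [quad, hf, dotProduct_zero] at this
    exact lt_irrefl _ this
  have he0 : e = 0 := by rw [he, hf0, Matrix.mulVec_zero]
  ext i
  cases i with
  | inl i => exact congrFun he0 i
  | inr i => exact congrFun hf0 i

/-- Instead of inverting blocks, the candidate is checked against the linear system. Up to sign, its
blocks are the maximising disturbance of `quad_adv_sub` along the closed loop and the nominal gain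
of the inflated value. -/
lemma game_solve (hR : R.PosDef) {γ : ℝ} {P : Matrix (Fin n) (Fin n) ℝ}
    (hP : P.PosSemidef) (hG : (γ ^ 2 • 1 - P).PosDef) :
    ((gameInput B)ᵀ * P * gameInput B + gameWeight n R γ)⁻¹ * (gameInput B)ᵀ * P * A =
      Matrix.fromRows (-((γ ^ 2 • 1 - P)⁻¹ * P * (A + B * nominalGain A B R (adv γ P))))
        (-nominalGain A B R (adv γ P)) := by
  set K := nominalGain A B R (adv γ P) with hK
  have hu := (Matrix.isUnit_iff_isUnit_det _).mp (isUnit_game_matrix (B := B) hR hP hG)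
  have hGu := (Matrix.isUnit_iff_isUnit_det _).mp hG.isUnit
  have key : ((gameInput B)ᵀ * P * gameInput B + gameWeight n R γ) *
      Matrix.fromRows (-((γ ^ 2 • 1 - P)⁻¹ * P * (A + B * K))) (-K) = (gameInput B)ᵀ * (P * A) := by
    rw [game_matrix_eq, Matrix.fromBlocks_mul_fromRows, gameInput, Matrix.transpose_fromCols,
      Matrix.fromRows_mul]
    congr 1
    · rw [neg_mul_neg, ← Matrix.mul_assoc, ← Matrix.mul_assoc, Matrix.mul_nonsing_inv _ hGu]
      simp [Matrix.mul_add, Matrix.mul_assoc]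
    · have h1 := input_weight_mul_nominalGain (A := A) (B := B) hR (adv_posSemidef hP hG)
      rw [← hK] at h1
      have h2 : R * K = -(Bᵀ * adv γ P * (A + B * K)) := by
        rw [Matrix.add_mul] at h1
        rw [Matrix.mul_add, neg_add, ← h1]
        simp [Matrix.mul_assoc]
      have h3 : Bᵀ * P * -((γ ^ 2 • 1 - P)⁻¹ * P * (A + B * K)) + (Bᵀ * P * B + R) * -K =
          Bᵀ * (P * A) - Bᵀ * adv γ P * (A + B * K) - R * K := by
        rw [adv]
        simp only [Matrix.mul_add, Matrix.add_mul, Matrix.mul_neg, Matrix.mul_assoc]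
        abel
      rw [h3, h2]
      abel
  rw [Matrix.mul_assoc _ P A, Matrix.mul_assoc, ← key, Matrix.nonsing_inv_mul_cancel_left _ _ hu]

lemma robustGain_eq (hR : R.PosDef) {γ : ℝ} {P : Matrix (Fin n) (Fin n) ℝ}
    (hP : P.PosSemidef) (hG : (γ ^ 2 • 1 - P).PosDef) :
    robustGain A B R γ P = nominalGain A B R (adv γ P) := by
  rw [robustGain, game_solve hR hP hG]
  ext i j
  simp [Matrix.toRows₂]

lemma isDARESolution_game_iff (hR : R.PosDef) {γ : ℝ} {P : Matrix (Fin n) (Fin n) ℝ}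
    (hP : P.PosSemidef) (hG : (γ ^ 2 • 1 - P).PosDef) :
    IsDARESolution A (gameInput B) Q (gameWeight n R γ) P ↔ ric A B Q R (adv γ P) = P := by
  have h := game_solve (A := A) (B := B) hR hP hG
  set K := nominalGain A B R (adv γ P) with hK
  have e : Q + Aᵀ * P * A - Aᵀ * P * gameInput B *
      ((gameInput B)ᵀ * P * gameInput B + gameWeight n R γ)⁻¹ * (gameInput B)ᵀ * P * A =
      ric A B Q R (adv γ P) := by
    have e1 : Aᵀ * P * gameInput B *
      ((gameInput B)ᵀ * P * gameInput B + gameWeight n R γ)⁻¹ * (gameInput B)ᵀ * P * A =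
      Aᵀ * P * (gameInput B * (((gameInput B)ᵀ * P * gameInput B + gameWeight n R γ)⁻¹ *
        (gameInput B)ᵀ * P * A)) := by
      simp only [Matrix.mul_assoc]
    rw [e1, h, gameInput, Matrix.fromCols_mul_fromRows, ric_eq, ← hK, adv]
    simp only [Matrix.mul_add, Matrix.add_mul, Matrix.mul_neg, Matrix.mul_assoc, Matrix.one_mul]
    abel
  rw [IsDARESolution, e]

lemma isRobustSolution_iff (hR : R.PosDef) {γ : ℝ} {P : Matrix (Fin n) (Fin n) ℝ} :
    IsRobustSolution A B Q R γ P ↔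
      P.PosSemidef ∧ (γ ^ 2 • 1 - P).PosDef ∧ ric A B Q R (adv γ P) = P := by
  constructor
  · rintro ⟨h1, h2, h3⟩
    exact ⟨h1, h2, (isDARESolution_game_iff hR h1 h2).mp h3⟩
  · rintro ⟨h1, h2, h3⟩
    exact ⟨h1, h2, (isDARESolution_game_iff hR h1 h2).mpr h3⟩

end Riccati

/-! ### Steering and trajectories -/

section Trajectories

variable {n m : ℕ} {A : Matrix (Fin n) (Fin n) ℝ} {B : Matrix (Fin n) (Fin m) ℝ}
  {Q : Matrix (Fin n) (Fin n) ℝ} {R : Matrix (Fin m) (Fin m) ℝ}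

/-- The zero-state response of `x_{t+1} = A x_t + B v_t`. -/
def resp (A : Matrix (Fin n) (Fin n) ℝ) (B : Matrix (Fin n) (Fin m) ℝ) (v : ℕ → Fin m → ℝ) :
    ℕ → Fin n → ℝ
  | 0 => 0
  | t + 1 => A *ᵥ resp A B v t + B *ᵥ v t

lemma resp_eq_sum (v : ℕ → Fin m → ℝ) (t : ℕ) :
    resp A B v t = ∑ k ∈ Finset.range t, (A ^ (t - 1 - k) * B) *ᵥ v k := by
  induction t with
  | zero => simp [resp]
  | succ t ih =>
    rw [resp, ih, Finset.sum_range_succ, Matrix.mulVec_sum]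
    congr 1
    · refine Finset.sum_congr rfl fun k hk => ?_
      have : k < t := Finset.mem_range.mp hk
      rw [Matrix.mulVec_mulVec, ← Matrix.mul_assoc, ← pow_succ']
      congr 3
      omega
    · simp

lemma isHermitian_gramian (ℓ : ℕ) : (gramian A B ℓ).IsHermitian := by
  rw [Matrix.IsHermitian, Matrix.conjTranspose_eq_transpose_of_trivial, gramian,
    Matrix.transpose_sum]
  simp [Matrix.transpose_mul, Matrix.mul_assoc]

lemma quad_gramian (ℓ : ℕ) (z : Fin n → ℝ) :
    quad (gramian A B ℓ) z =
      ∑ t ∈ Finset.range (ℓ + 1), ((A ^ t * B)ᵀ *ᵥ z) ⬝ᵥ ((A ^ t * B)ᵀ *ᵥ z) := by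
  rw [quad, gramian, Matrix.sum_mulVec, dotProduct_sum]
  refine Finset.sum_congr rfl fun t _ => ?_
  rw [Matrix.mul_assoc (A ^ t * B), ← Matrix.transpose_mul, ← Matrix.mulVec_mulVec,
    dot_mulVec_mulVec]

lemma gramian_posSemidef (ℓ : ℕ) : (gramian A B ℓ).PosSemidef :=
  posSemidef_of_quad (isHermitian_gramian ℓ) fun z => by
    rw [quad_gramian]
    exact Finset.sum_nonneg fun _ _ => dot_self_nonneg _

/-- Minimum-energy steering from the origin. -/
lemma exists_steering {ℓ : ℕ} (hW : 0 < sigmaMin (gramian A B ℓ)) (d : Fin n → ℝ) :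
    ∃ v : ℕ → Fin m → ℝ, resp A B v (ℓ + 1) = d ∧
      sigmaMin (gramian A B ℓ) * ∑ k ∈ Finset.range (ℓ + 1), v k ⬝ᵥ v k ≤ d ⬝ᵥ d := by
  set W := gramian A B ℓ with hWdef
  have hPD := posDef_of_sigmaMin_pos (gramian_posSemidef ℓ) hW
  set z := W⁻¹ *ᵥ d with hz
  have hWz : W *ᵥ z = d := by
    rw [hz, Matrix.mulVec_mulVec, Matrix.mul_nonsing_inv _
      ((Matrix.isUnit_iff_isUnit_det _).mp hPD.isUnit), Matrix.one_mulVec]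
  -- With `z = W⁻¹ d` the energy of this input is `zᵀ W z = zᵀ d`; Cauchy–Schwarz together with
  -- `σ_min(W) |z|² ≤ zᵀ W z` then bounds it. The gramian includes `t = ℓ`, so the horizon is `ℓ +
  -- 1`.
  refine ⟨fun k => (A ^ (ℓ - k) * B)ᵀ *ᵥ z, ?_, ?_⟩
  · rw [resp_eq_sum, ← hWz, hWdef, gramian, Matrix.sum_mulVec, ← Finset.sum_range_reflect]
    refine Finset.sum_congr rfl fun k hk => ?_
    have hk' : k < ℓ + 1 := Finset.mem_range.mp hk
    have e : ℓ + 1 - 1 - (ℓ + 1 - 1 - k) = k := by omega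
    have e' : ℓ - (ℓ + 1 - 1 - k) = k := by omega
    rw [e, e', Matrix.mulVec_mulVec, Matrix.mul_assoc (A ^ k * B), ← Matrix.transpose_mul]
  · have hq : ∑ k ∈ Finset.range (ℓ + 1),
        ((A ^ (ℓ - k) * B)ᵀ *ᵥ z) ⬝ᵥ ((A ^ (ℓ - k) * B)ᵀ *ᵥ z) = quad W z := by
      rw [hWdef, quad_gramian, ← Finset.sum_range_reflect]
      refine Finset.sum_congr rfl fun k hk => ?_
      have hk' : k < ℓ + 1 := Finset.mem_range.mp hk
      have e : ℓ - (ℓ + 1 - 1 - k) = k := by omega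
      rw [e]
    rw [hq]
    have h1 := sigmaMin_mul_le_quad hPD.posSemidef z
    have h2 : quad W z ^ 2 ≤ (z ⬝ᵥ z) * (d ⬝ᵥ d) := by
      rw [quad, hWz]; exact dot_sq_le z d
    have h3 := dot_self_nonneg d
    have h4 := quad_nonneg hPD.posSemidef z
    rcases eq_or_lt_of_le h4 with h0 | h0
    · rw [← h0, mul_zero]; exact h3
    · refine le_of_mul_le_mul_right ?_ h0
      nlinarith [mul_le_mul_of_nonneg_right h1 h3]

/-- Bound on the energy of a forced response over `ℓ + 1` steps. -/
lemma sum_resp_le {ℓ : ℕ} {a : ℝ} (ha : ∀ j < ℓ, ‖A ^ j‖ ≤ a) (v : ℕ → Fin m → ℝ) :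
    ∑ t ∈ Finset.range (ℓ + 1), resp A B v t ⬝ᵥ resp A B v t ≤
      (ℓ * a * ‖B‖) ^ 2 * ∑ k ∈ Finset.range (ℓ + 1), v k ⬝ᵥ v k := by
  set S := ∑ k ∈ Finset.range (ℓ + 1), v k ⬝ᵥ v k
  have hS : 0 ≤ S := Finset.sum_nonneg fun _ _ => dot_self_nonneg _
  -- The endpoint at time `ℓ + 1` is not part of the sum, so only powers `A ^ j` with `j < ℓ` occur.
  -- One factor `ℓ` is Cauchy–Schwarz over the inputs, the other counts the times.
  have h1 : ∀ t ∈ Finset.range ℓ,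
      resp A B v (t + 1) ⬝ᵥ resp A B v (t + 1) ≤ ℓ * (a * ‖B‖) ^ 2 * S := by
    intro t ht
    have ht' : t < ℓ := Finset.mem_range.mp ht
    rw [resp_eq_sum]
    refine (quad_sum_vec_le _ _).trans ?_
    rw [Finset.card_range, mul_assoc]
    have hsum : ∑ k ∈ Finset.range (t + 1), ((A ^ (t + 1 - 1 - k) * B) *ᵥ v k) ⬝ᵥ
        ((A ^ (t + 1 - 1 - k) * B) *ᵥ v k) ≤ (a * ‖B‖) ^ 2 * S := by
      rw [Finset.mul_sum]
      refine (Finset.sum_le_sum fun k hk => ?_).trans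
        (Finset.sum_le_sum_of_subset_of_nonneg
          (Finset.range_subset_range.mpr (by omega : t + 1 ≤ ℓ + 1))
          fun k _ _ => mul_nonneg (sq_nonneg _) (dot_self_nonneg _))
      refine (dot_mulVec_self_le _ _).trans (mul_le_mul_of_nonneg_right ?_ (dot_self_nonneg _))
      refine pow_le_pow_left₀ (norm_nonneg _) ?_ 2
      exact (Matrix.l2_opNorm_mul _ _).trans
        (mul_le_mul_of_nonneg_right (ha _ (by omega)) (norm_nonneg _))
    refine mul_le_mul ?_ hsum
      (Finset.sum_nonneg fun _ _ => dot_self_nonneg _) (Nat.cast_nonneg _)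
    exact_mod_cast ht'
  rw [Finset.sum_range_succ']
  simp only [resp, dotProduct_zero, add_zero]
  calc _ ≤ ∑ t ∈ Finset.range ℓ, ℓ * (a * ‖B‖) ^ 2 * S := Finset.sum_le_sum h1
    _ = _ := by rw [Finset.sum_const, Finset.card_range, nsmul_eq_mul]; ring

lemma stageCost_le (x : Fin n → ℝ) (u : Fin m → ℝ) :
    stageCost Q R x u ≤ max ‖Q‖ ‖R‖ * (x ⬝ᵥ x + u ⬝ᵥ u) := by
  rw [stageCost_eq, mul_add]
  exact add_le_add
    ((quad_le_norm Q x).trans (mul_le_mul_of_nonneg_right (le_max_left _ _) (dot_self_nonneg _)))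
    ((quad_le_norm R u).trans (mul_le_mul_of_nonneg_right (le_max_right _ _) (dot_self_nonneg _)))

lemma le_stageCost (hQ : Q.PosSemidef) (hR : R.PosSemidef) (x : Fin n → ℝ) (u : Fin m → ℝ) :
    min (sigmaMin Q) (sigmaMin R) * (x ⬝ᵥ x + u ⬝ᵥ u) ≤ stageCost Q R x u := by
  rw [stageCost_eq, mul_add]
  exact add_le_add
    ((mul_le_mul_of_nonneg_right (min_le_left _ _) (dot_self_nonneg _)).trans
      (sigmaMin_mul_le_quad hQ x))
    ((mul_le_mul_of_nonneg_right (min_le_right _ _) (dot_self_nonneg _)).trans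
      (sigmaMin_mul_le_quad hR u))

/-- Total cost of steering the origin to `d` in `ℓ + 1` steps. -/
lemma exists_steering_cost {ℓ : ℕ} (hW : 0 < sigmaMin (gramian A B ℓ)) {a : ℝ}
    (ha : ∀ j < ℓ, ‖A ^ j‖ ≤ a) (d : Fin n → ℝ) :
    ∃ v : ℕ → Fin m → ℝ, resp A B v (ℓ + 1) = d ∧
      ∑ t ∈ Finset.range (ℓ + 1), stageCost Q R (resp A B v t) (v t) ≤
        max ‖Q‖ ‖R‖ * ((1 + (ℓ * a * ‖B‖) ^ 2) / sigmaMin (gramian A B ℓ) * (d ⬝ᵥ d)) := by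
  obtain ⟨v, hv, hE⟩ := exists_steering hW d
  refine ⟨v, hv, (Finset.sum_le_sum fun t _ => stageCost_le _ _).trans ?_⟩
  rw [← Finset.mul_sum, Finset.sum_add_distrib]
  refine mul_le_mul_of_nonneg_left ?_ (le_max_of_le_left (norm_nonneg _))
  have h1 := sum_resp_le (B := B) ha v
  set S := ∑ k ∈ Finset.range (ℓ + 1), v k ⬝ᵥ v k
  have h2 : S ≤ (d ⬝ᵥ d) / sigmaMin (gramian A B ℓ) := by
    rw [le_div_iff₀ hW]; linarith
  calc _ ≤ (1 + (ℓ * a * ‖B‖) ^ 2) * S := by linarith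
    _ ≤ (1 + (ℓ * a * ‖B‖) ^ 2) * ((d ⬝ᵥ d) / sigmaMin (gramian A B ℓ)) :=
      mul_le_mul_of_nonneg_left h2 (by positivity)
    _ = _ := by ring

lemma stageCost_add_le (hQ : Q.PosSemidef) (hR : R.PosSemidef) {η : ℝ} (hη : 0 < η)
    (x y : Fin n → ℝ) (u v : Fin m → ℝ) :
    stageCost Q R (x + y) (u + v) ≤
      (1 + η) * stageCost Q R x u + (1 + η⁻¹) * stageCost Q R y v := by
  simp only [stageCost_eq]
  linarith [quad_add_le hQ hη x y, quad_add_le hR hη u v]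

/-- Iterating a Bellman inequality with expansion factor `s` along a trajectory. -/
lemma bellman_iterate {V : (Fin n → ℝ) → ℝ} {s : ℝ} (hs : 0 ≤ s)
    (hV : ∀ x u, V x ≤ stageCost Q R x u + s * V (A *ᵥ x + B *ᵥ u))
    {x : ℕ → Fin n → ℝ} {u : ℕ → Fin m → ℝ}
    (hx : ∀ t, x (t + 1) = A *ᵥ x t + B *ᵥ u t) (N : ℕ) :
    V (x 0) ≤ ∑ t ∈ Finset.range N, s ^ t * stageCost Q R (x t) (u t) + s ^ N * V (x N) := by
  induction N with
  | zero => simp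
  | succ N ih =>
    rw [Finset.sum_range_succ, pow_succ]
    have h := mul_le_mul_of_nonneg_left (hV (x N) (u N)) (pow_nonneg hs N)
    rw [hx]
    linarith

/-- Any subsolution of a Riccati equation is bounded by the cost of steering to the origin. -/
lemma exists_bound_of_subsolution (hQ : Q.PosSemidef) (hR : R.PosDef) {ℓ : ℕ}
    (hW : 0 < sigmaMin (gramian A B ℓ)) :
    ∃ c : ℝ, 0 ≤ c ∧ ∀ P : Matrix (Fin n) (Fin n) ℝ, P.PosSemidef → P ≤ ric A B Q R P →
      ‖P‖ ≤ c := by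
  set a := ∑ j ∈ Finset.range ℓ, ‖A ^ j‖
  have ha : ∀ j < ℓ, ‖A ^ j‖ ≤ a := fun j hj =>
    Finset.single_le_sum (f := fun j => ‖A ^ j‖) (fun _ _ => norm_nonneg _)
      (Finset.mem_range.mpr hj)
  set c₁ := ∑ t ∈ Finset.range (ℓ + 1), max ‖Q‖ ‖R‖ * ‖A ^ t‖ ^ 2
  set c₂ := max ‖Q‖ ‖R‖ * ((1 + (ℓ * a * ‖B‖) ^ 2) / sigmaMin (gramian A B ℓ) *
    ‖A ^ (ℓ + 1)‖ ^ 2)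
  have hm : 0 ≤ max ‖Q‖ ‖R‖ := le_max_of_le_left (norm_nonneg _)
  have hc₁ : 0 ≤ c₁ := Finset.sum_nonneg fun _ _ => by positivity
  have hc₂ : 0 ≤ c₂ := by positivity
  refine ⟨2 * c₁ + 2 * c₂, by positivity, fun P hP hsub => ?_⟩
  refine norm_le_of_quad_le hP (by positivity) fun x => ?_
  -- The forced response cancels the free response at time `ℓ + 1`; the trajectory ends at the
  -- origin, where `P` costs nothing, so the bound does not depend on `P`.
  obtain ⟨v, hv, hcost⟩ := exists_steering_cost (Q := Q) (R := R) hW ha (-(A ^ (ℓ + 1) *ᵥ x))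
  have hV : ∀ x u, quad P x ≤ stageCost Q R x u + 1 * quad P (A *ᵥ x + B *ᵥ u) := fun x u => by
    rw [one_mul]
    exact (quad_le_of_le hsub x).trans (quad_ric_le hR hP x u)
  have h := bellman_iterate zero_le_one hV (x := fun t => A ^ t *ᵥ x + resp A B v t) (u := v)
    (fun t => by
      simp only [resp, Matrix.mulVec_add, Matrix.mulVec_mulVec, ← pow_succ', add_assoc]) (ℓ + 1)
  rw [hv, add_neg_cancel, quad_zero] at h
  simp only [resp, pow_zero, Matrix.one_mulVec, add_zero, one_pow, one_mul, mul_zero] at h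
  refine h.trans ?_
  have hterm : ∀ t ∈ Finset.range (ℓ + 1),
      stageCost Q R (A ^ t *ᵥ x + resp A B v t) (v t) ≤
        2 * (max ‖Q‖ ‖R‖ * ‖A ^ t‖ ^ 2 * (x ⬝ᵥ x)) +
          2 * stageCost Q R (resp A B v t) (v t) := by
    intro t _
    have h1 := stageCost_add_le hQ hR.posSemidef one_pos (A ^ t *ᵥ x) (resp A B v t) 0 (v t)
    have h2 := stageCost_le (Q := Q) (R := R) (A ^ t *ᵥ x) 0
    have h3 := mul_le_mul_of_nonneg_left (dot_mulVec_self_le (A ^ t) x) hm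
    rw [zero_add] at h1
    rw [dotProduct_zero, add_zero] at h2
    norm_num at h1
    linarith
  refine (Finset.sum_le_sum hterm).trans ?_
  rw [Finset.sum_add_distrib, ← Finset.mul_sum, ← Finset.mul_sum, ← Finset.sum_mul]
  have h4 : max ‖Q‖ ‖R‖ * ((1 + (ℓ * a * ‖B‖) ^ 2) / sigmaMin (gramian A B ℓ) *
      (-(A ^ (ℓ + 1) *ᵥ x) ⬝ᵥ -(A ^ (ℓ + 1) *ᵥ x))) ≤ c₂ * (x ⬝ᵥ x) := by
    rw [neg_dotProduct_neg]
    have := mul_le_mul_of_nonneg_left (dot_mulVec_self_le (A ^ (ℓ + 1)) x)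
      (by positivity : 0 ≤ max ‖Q‖ ‖R‖ * ((1 + (ℓ * a * ‖B‖) ^ 2) / sigmaMin (gramian A B ℓ)))
    simp only [c₂]
    linarith
  linarith

end Trajectories

/-! ### Existence of solutions -/

section Existence

variable {n m : ℕ} {A : Matrix (Fin n) (Fin n) ℝ} {B : Matrix (Fin n) (Fin m) ℝ}
  {Q : Matrix (Fin n) (Fin n) ℝ} {R : Matrix (Fin m) (Fin m) ℝ}

/-- An inflationary self-map of a compact set of matrices has a fixed point: maximise the trace. -/
lemma exists_fixed_point {S : Set (Matrix (Fin n) (Fin n) ℝ)} (hS : IsCompact S)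
    (hne : S.Nonempty) {Φ : Matrix (Fin n) (Fin n) ℝ → Matrix (Fin n) (Fin n) ℝ}
    (hΦ : ∀ P ∈ S, Φ P ∈ S ∧ P ≤ Φ P) : ∃ P ∈ S, Φ P = P := by
  obtain ⟨P, hP, hmax⟩ := hS.exists_isMaxOn hne
    (f := Matrix.trace) (Continuous.matrix_trace continuous_id).continuousOn
  refine ⟨P, hP, ?_⟩
  have h1 := Matrix.le_iff.mp (hΦ P hP).2
  have h2 : (Φ P - P).trace = 0 := by
    refine le_antisymm ?_ h1.trace_nonneg
    rw [Matrix.trace_sub]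
    exact sub_nonpos.mpr (hmax (hΦ P hP).1)
  exact sub_eq_zero.mp (h1.trace_eq_zero_iff.mp h2)

lemma continuous_quad (x : Fin n → ℝ) :
    Continuous fun P : Matrix (Fin n) (Fin n) ℝ => quad P x := by
  unfold quad
  fun_prop

lemma isClosed_posSemidef : IsClosed {P : Matrix (Fin n) (Fin n) ℝ | P.PosSemidef} := by
  have : {P : Matrix (Fin n) (Fin n) ℝ | P.PosSemidef} =
      {P | Pᴴ = P} ∩ ⋂ x, {P | 0 ≤ quad P x} := by
    ext P
    simp only [Set.mem_ofPred_eq, Set.mem_inter_iff, Set.mem_iInter]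
    exact ⟨fun h => ⟨h.1, quad_nonneg h⟩, fun h => posSemidef_of_quad h.1 h.2⟩
  rw [this]
  exact (isClosed_eq (Continuous.matrix_conjTranspose continuous_id) continuous_id).inter
    (isClosed_iInter fun x => isClosed_le continuous_const (continuous_quad x))

lemma continuousAt_matrix_inv {k : ℕ} {M : Matrix (Fin k) (Fin k) ℝ} (hM : IsUnit M) :
    ContinuousAt (fun M : Matrix (Fin k) (Fin k) ℝ => M⁻¹) M := by
  obtain ⟨u, rfl⟩ := hM
  have : (fun M : Matrix (Fin k) (Fin k) ℝ => M⁻¹) = Ring.inverse := by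
    ext1 M; exact Matrix.nonsing_inv_eq_ringInverse M
  rw [this]
  exact NormedRing.inverse_continuousAt u

lemma continuousAt_ric (hR : R.PosDef) {Y : Matrix (Fin n) (Fin n) ℝ} (hY : Y.PosSemidef) :
    ContinuousAt (ric A B Q R) Y := by
  have hu : IsUnit (Bᵀ * Y * B + R) := by
    rw [add_comm]; exact (posDef_input_weight (B := B) hR hY).isUnit
  have h1 : ContinuousAt (fun Y : Matrix (Fin n) (Fin n) ℝ => (Bᵀ * Y * B + R)⁻¹) Y :=
    ContinuousAt.comp (g := fun M => M⁻¹) (f := fun Y => Bᵀ * Y * B + R)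
      (continuousAt_matrix_inv hu) (by fun_prop)
  have c1 : Continuous fun Y : Matrix (Fin n) (Fin n) ℝ => Q + Aᵀ * Y * A := by fun_prop
  have c2 : Continuous fun Y : Matrix (Fin n) (Fin n) ℝ => Aᵀ * Y * B := by fun_prop
  have c3 : Continuous fun p : Matrix (Fin n) (Fin m) ℝ × Matrix (Fin m) (Fin m) ℝ ×
      Matrix (Fin n) (Fin n) ℝ => p.1 * p.2.1 * Bᵀ * p.2.2 * A := by fun_prop
  have h2 := (c3.tendsto (Aᵀ * Y * B, (Bᵀ * Y * B + R)⁻¹, Y)).comp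
    ((c2.tendsto Y).prodMk_nhds (Tendsto.prodMk_nhds h1 tendsto_id))
  exact Tendsto.sub (c1.tendsto Y) h2

lemma continuousAt_adv {γ : ℝ} {P : Matrix (Fin n) (Fin n) ℝ} (hG : (γ ^ 2 • 1 - P).PosDef) :
    ContinuousAt (adv γ) P := by
  have h1 : ContinuousAt (fun P : Matrix (Fin n) (Fin n) ℝ => (γ ^ 2 • 1 - P)⁻¹) P :=
    ContinuousAt.comp (g := fun M => M⁻¹)
      (f := fun P : Matrix (Fin n) (Fin n) ℝ => γ ^ 2 • 1 - P)
      (continuousAt_matrix_inv hG.isUnit) (by fun_prop)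
  exact continuousAt_id.add ((continuousAt_id.mul h1).mul continuousAt_id)

lemma isCompact_of_norm_le {S : Set (Matrix (Fin n) (Fin n) ℝ)} (hS : IsClosed S) {c : ℝ}
    (h : ∀ P ∈ S, ‖P‖ ≤ c) : IsCompact S := by
  have : ProperSpace (Matrix (Fin n) (Fin n) ℝ) := FiniteDimensional.proper_real _
  exact Metric.isCompact_of_isClosed_isBounded hS (isBounded_iff_forall_norm_le.mpr ⟨c, h⟩)

lemma isClosed_subsolution {D : Set (Matrix (Fin n) (Fin n) ℝ)} (hD : IsClosed D)
    {Φ : Matrix (Fin n) (Fin n) ℝ → Matrix (Fin n) (Fin n) ℝ} (hΦ : ContinuousOn Φ D) :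
    IsClosed {P | P ∈ D ∧ P ≤ Φ P} := by
  have := (hΦ.sub continuousOn_id).preimage_isClosed_of_isClosed hD isClosed_posSemidef
  exact this

/-- The positive semidefinite subsolutions contain `0`, are preserved by `ric` through monotonicity,
and are bounded by the cost of steering to the origin, so `exists_fixed_point` applies. -/
lemma exists_isNominalValue (hQ : Q.PosSemidef) (hR : R.PosDef) {ℓ : ℕ}
    (hW : 0 < sigmaMin (gramian A B ℓ)) : ∃ P, IsNominalValue A B Q R P := by
  obtain ⟨c, -, hc⟩ := exists_bound_of_subsolution hQ hR hW
  have hclosed := isClosed_subsolution (Φ := ric A B Q R) isClosed_posSemidef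
    fun P hP => (continuousAt_ric hR hP).continuousWithinAt
  obtain ⟨P, hP, hfix⟩ := exists_fixed_point
    (isCompact_of_norm_le hclosed fun P hP => hc P hP.1 hP.2)
    ⟨0, .zero, Matrix.nonneg_iff_posSemidef.mpr (ric_posSemidef hQ hR .zero)⟩
    (Φ := ric A B Q R) (fun P hP => by
      have h := ric_posSemidef (A := A) (B := B) hQ hR hP.1
      exact ⟨⟨h, le_of_quad h.1 (ric_posSemidef hQ hR h).1
        (quad_ric_mono hR hP.1 h (quad_le_of_le hP.2))⟩, hP.2⟩)
  exact ⟨P, hP.1, hfix⟩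

/-- `X` is a supersolution of the Riccati equation of the game at level `γ`. -/
def IsSuper (A : Matrix (Fin n) (Fin n) ℝ) (B : Matrix (Fin n) (Fin m) ℝ)
    (Q : Matrix (Fin n) (Fin n) ℝ) (R : Matrix (Fin m) (Fin m) ℝ) (γ : ℝ)
    (X : Matrix (Fin n) (Fin n) ℝ) : Prop :=
  X.PosSemidef ∧ (γ ^ 2 • 1 - X).PosDef ∧ ∀ x, quad (ric A B Q R (adv γ X)) x ≤ quad X x

lemma posDef_sub_of_le {γ : ℝ} {P X : Matrix (Fin n) (Fin n) ℝ} (hX : (γ ^ 2 • 1 - X).PosDef)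
    (h : P ≤ X) : (γ ^ 2 • 1 - P).PosDef := by
  simpa using hX.add_posSemidef (Matrix.le_iff.mp h)

/-- Raising the level makes disturbances more expensive and hence lowers `adv γ X`. -/
lemma IsSuper.mono (hR : R.PosDef) {γ γ' : ℝ} {X : Matrix (Fin n) (Fin n) ℝ}
    (hX : IsSuper A B Q R γ' X) (hγ : γ' ^ 2 ≤ γ ^ 2) : IsSuper A B Q R γ X := by
  have hG : (γ ^ 2 • 1 - X).PosDef := by
    have h1 : ((γ ^ 2 - γ' ^ 2) • (1 : Matrix (Fin n) (Fin n) ℝ)).PosSemidef :=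
      Matrix.PosSemidef.one.smul (sub_nonneg.mpr hγ)
    have h2 := hX.2.1.add_posSemidef h1
    rw [sub_smul] at h2
    convert h2 using 1
    abel
  exact ⟨hX.1, hG, fun x => (quad_ric_mono hR (adv_posSemidef hX.1 hG)
    (adv_posSemidef hX.1 hX.2.1) (quad_adv_mono hX.1 hG hX.1 hX.2.1 hγ fun _ => le_rfl) x).trans
    (hX.2.2 x)⟩

lemma IsRobustSolution.isSuper (hR : R.PosDef) {γ : ℝ} {P : Matrix (Fin n) (Fin n) ℝ}
    (h : IsRobustSolution A B Q R γ P) : IsSuper A B Q R γ P := by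
  obtain ⟨h1, h2, h3⟩ := (isRobustSolution_iff hR).mp h
  exact ⟨h1, h2, fun x => by rw [h3]⟩

/-- Below any supersolution there is a solution, and it can be chosen below all supersolutions. -/
lemma exists_minimal_solution (hQ : Q.PosSemidef) (hR : R.PosDef) {γ : ℝ}
    {X : Matrix (Fin n) (Fin n) ℝ} (hX : IsSuper A B Q R γ X) :
    ∃ P, IsRobustSolution A B Q R γ P ∧ ∀ X', IsSuper A B Q R γ X' → P ≤ X' := by
  set Φ := fun P => ric A B Q R (adv γ P)
  -- Searching only below all supersolutions makes the fixed point minimal automatically. The single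
  -- supersolution `X` keeps `γ² I - P` positive definite on `D` and bounds `D`.
  set D := {P : Matrix (Fin n) (Fin n) ℝ | P.PosSemidef} ∩
    ⋂ X' : {X' // IsSuper A B Q R γ X'}, {P | P ≤ X'.1}
  have hD : IsClosed D := isClosed_posSemidef.inter <| isClosed_iInter fun X' =>
    isClosed_posSemidef.preimage (f := fun P => X'.1 - P) (by fun_prop)
  have hDle : ∀ P ∈ D, ∀ X', IsSuper A B Q R γ X' → P ≤ X' := fun P hP X' hX' =>
    Set.mem_iInter.mp hP.2 ⟨X', hX'⟩
  have hG : ∀ P ∈ D, (γ ^ 2 • 1 - P).PosDef := fun P hP =>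
    posDef_sub_of_le hX.2.1 (hDle P hP X hX)
  have hcont : ContinuousOn Φ D := fun P hP =>
    (ContinuousAt.comp (g := ric A B Q R) (continuousAt_ric hR (adv_posSemidef hP.1 (hG P hP)))
      (continuousAt_adv (hG P hP))).continuousWithinAt
  have hpsd : ∀ P ∈ D, (Φ P).PosSemidef := fun P hP =>
    ric_posSemidef hQ hR (adv_posSemidef hP.1 (hG P hP))
  have hmem : ∀ P ∈ D, Φ P ∈ D := fun P hP => ⟨hpsd P hP, Set.mem_iInter.mpr fun X' =>
    le_of_quad (hpsd P hP).1 X'.2.1.1 fun x =>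
      (quad_ric_mono hR (adv_posSemidef hP.1 (hG P hP)) (adv_posSemidef X'.2.1 X'.2.2.1)
        (quad_adv_mono hP.1 (hG P hP) X'.2.1 X'.2.2.1 le_rfl
          (quad_le_of_le (hDle P hP X' X'.2))) x).trans (X'.2.2.2 x)⟩
  have h0 : (0 : Matrix (Fin n) (Fin n) ℝ) ∈ D := ⟨.zero, Set.mem_iInter.mpr fun X' =>
    Matrix.nonneg_iff_posSemidef.mpr X'.2.1⟩
  obtain ⟨P, hP, hfix⟩ := exists_fixed_point
    (isCompact_of_norm_le (isClosed_subsolution hD hcont) (c := ‖X‖) fun P hP =>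
      (norm_le_norm_of_quad_le (c := 1) hP.1.1 zero_le_one fun x => by
        rw [one_mul]; exact quad_le_of_le (hDle P hP.1 X hX) x).trans_eq (one_mul _))
    ⟨0, h0, Matrix.nonneg_iff_posSemidef.mpr (hpsd 0 h0)⟩ (Φ := Φ) (fun P hP => by
      have hm := hmem P hP.1
      refine ⟨⟨hm, le_of_quad hm.1.1 (hpsd _ hm).1 ?_⟩, hP.2⟩
      exact quad_ric_mono hR (adv_posSemidef hP.1.1 (hG P hP.1)) (adv_posSemidef hm.1 (hG _ hm))
        (quad_adv_mono hP.1.1 (hG P hP.1) hm.1 (hG _ hm) le_rfl (quad_le_of_le hP.2)))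
  exact ⟨P, (isRobustSolution_iff hR).mpr ⟨hP.1.1, hG P hP.1, hfix⟩, hDle P hP.1⟩

end Existence

/-! ### Lyapunov inequalities and stability -/

section Stability

variable {n m : ℕ}

/-- `P` is a strict Lyapunov function: it contracts by `1 - q / b` per step and is squeezed between
`q |x|²` and `b |x|²`. Adding `q` to `‖P‖` ensures `b > 0` and `q ≤ b`. -/
lemma exists_decay {P L : Matrix (Fin n) (Fin n) ℝ} (hP : P.PosSemidef) {q : ℝ} (hq : 0 < q)
    (h : ∀ x, q * (x ⬝ᵥ x) + quad P (L *ᵥ x) ≤ quad P x) :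
    ∃ C r : ℝ, 0 ≤ C ∧ 0 ≤ r ∧ r < 1 ∧ ∀ t : ℕ, ‖L ^ t‖ ^ 2 ≤ C * r ^ t := by
  set b := ‖P‖ + q
  have hb : 0 < b := by positivity
  have hqb : q ≤ b := le_add_of_nonneg_left (norm_nonneg _)
  have hPb : ∀ x, quad P x ≤ b * (x ⬝ᵥ x) := fun x =>
    (quad_le_norm P x).trans
      (mul_le_mul_of_nonneg_right (le_add_of_nonneg_right hq.le) (dot_self_nonneg x))
  have hr : 0 ≤ 1 - q / b := sub_nonneg.mpr ((div_le_one hb).mpr hqb)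
  have hstep : ∀ x, quad P (L *ᵥ x) ≤ (1 - q / b) * quad P x := by
    intro x
    have h1 : q / b * quad P x ≤ q * (x ⬝ᵥ x) := by
      rw [div_mul_eq_mul_div, div_le_iff₀ hb]
      nlinarith [mul_le_mul_of_nonneg_left (hPb x) hq.le]
    linarith [h x]
  have hiter : ∀ (t : ℕ) (x), quad P (L ^ t *ᵥ x) ≤ (1 - q / b) ^ t * quad P x := by
    intro t
    induction t with
    | zero => intro x; simp
    | succ t ih =>
      intro x
      rw [pow_succ, ← Matrix.mulVec_mulVec, pow_succ, mul_assoc]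
      exact (ih _).trans (mul_le_mul_of_nonneg_left (hstep x) (pow_nonneg hr t))
  refine ⟨b / q, 1 - q / b, by positivity, hr, by have := div_pos hq hb; linarith, fun t => ?_⟩
  have hC : 0 ≤ b / q * (1 - q / b) ^ t := by positivity
  rw [← Real.sq_sqrt hC]
  refine pow_le_pow_left₀ (norm_nonneg _) (norm_le_of_dot_le (Real.sqrt_nonneg _) fun x => ?_) 2
  rw [Real.sq_sqrt hC]
  have h1 := hiter t x
  have h2 := h (L ^ t *ᵥ x)
  have h3 := quad_nonneg hP (L *ᵥ (L ^ t *ᵥ x))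
  have h4 := mul_le_mul_of_nonneg_left (hPb x) (pow_nonneg hr t)
  have e : b / q * (1 - q / b) ^ t * (x ⬝ᵥ x) = ((1 - q / b) ^ t * (b * (x ⬝ᵥ x))) / q := by ring
  rw [e, le_div_iff₀ hq]
  linarith

lemma tendsto_quad_pow {L : Matrix (Fin n) (Fin n) ℝ} {C r : ℝ} (hr0 : 0 ≤ r) (hr1 : r < 1)
    (h : ∀ t : ℕ, ‖L ^ t‖ ^ 2 ≤ C * r ^ t) (D : Matrix (Fin n) (Fin n) ℝ) (x : Fin n → ℝ) :
    Tendsto (fun t : ℕ => quad D (L ^ t *ᵥ x)) atTop (nhds 0) := by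
  have hlim : Tendsto (fun t : ℕ => ‖D‖ * ((C * r ^ t) * (x ⬝ᵥ x))) atTop (nhds 0) := by
    simpa using (((tendsto_pow_atTop_nhds_zero_of_lt_one hr0 hr1).const_mul C).mul_const
      (x ⬝ᵥ x)).const_mul ‖D‖
  refine squeeze_zero_norm (fun t => ?_) hlim
  have h1 : (L ^ t *ᵥ x) ⬝ᵥ (L ^ t *ᵥ x) ≤ C * r ^ t * (x ⬝ᵥ x) :=
    (dot_mulVec_self_le _ x).trans (mul_le_mul_of_nonneg_right (h t) (dot_self_nonneg x))
  have h2 := quad_le_norm D (L ^ t *ᵥ x)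
  have h3 := quad_le_norm (-D) (L ^ t *ᵥ x)
  have e : quad (-D) (L ^ t *ᵥ x) = -quad D (L ^ t *ᵥ x) := by simp [quad, Matrix.neg_mulVec]
  rw [e, norm_neg] at h3
  have h4 := mul_le_mul_of_nonneg_left h1 (norm_nonneg D)
  rw [Real.norm_eq_abs, abs_le]
  constructor <;> linarith

/-- A quadratic form that does not increase along a stable linear map is nonnegative. -/
lemma quad_nonneg_of_decay {L : Matrix (Fin n) (Fin n) ℝ} {C r : ℝ} (hr0 : 0 ≤ r) (hr1 : r < 1)
    (h : ∀ t : ℕ, ‖L ^ t‖ ^ 2 ≤ C * r ^ t) {D : Matrix (Fin n) (Fin n) ℝ}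
    (hD : ∀ x, quad D (L *ᵥ x) ≤ quad D x) (x : Fin n → ℝ) : 0 ≤ quad D x := by
  have hiter : ∀ t : ℕ, quad D (L ^ t *ᵥ x) ≤ quad D x := by
    intro t
    induction t with
    | zero => simp
    | succ t ih =>
      rw [pow_succ', ← Matrix.mulVec_mulVec]
      exact (hD _).trans ih
  exact le_of_tendsto (tendsto_quad_pow hr0 hr1 h D x) (Eventually.of_forall hiter)

/-- The spectral radius lives over `ℂ`, the norms over `ℝ`. Since only the asymptotics of powers
matter, any finite-dimensional norm equivalence suffices. -/
lemma exists_norm_map_le (n : ℕ) : ∃ C : ℝ, 0 < C ∧ ∀ M : Matrix (Fin n) (Fin n) ℝ,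
    ‖M.map (algebraMap ℝ ℂ)‖ ≤ C * ‖M‖ ∧ ‖M‖ ≤ C * ‖M.map (algebraMap ℝ ℂ)‖ := by
  let f : Matrix (Fin n) (Fin n) ℝ →ₗ[ℝ] Matrix (Fin n) (Fin n) ℂ :=
    (Algebra.linearMap ℝ ℂ).mapMatrix
  let g : Matrix (Fin n) (Fin n) ℂ →ₗ[ℝ] Matrix (Fin n) (Fin n) ℝ :=
    Complex.reLm.mapMatrix
  have hgf : ∀ M, g (f M) = M := fun M => by
    ext i j
    simp [f, g]
  refine ⟨‖LinearMap.toContinuousLinearMap f‖ + ‖LinearMap.toContinuousLinearMap g‖ + 1,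
    by positivity, fun M => ⟨?_, ?_⟩⟩
  · refine ((LinearMap.toContinuousLinearMap f).le_opNorm M).trans
      (mul_le_mul_of_nonneg_right ?_ (norm_nonneg _))
    linarith [norm_nonneg (LinearMap.toContinuousLinearMap g)]
  · have := (LinearMap.toContinuousLinearMap g).le_opNorm (f M)
    rw [LinearMap.coe_toContinuousLinearMap', hgf] at this
    refine this.trans (mul_le_mul_of_nonneg_right ?_ (norm_nonneg _))
    linarith [norm_nonneg (LinearMap.toContinuousLinearMap f)]

lemma map_pow_algebraMap (M : Matrix (Fin n) (Fin n) ℝ) (k : ℕ) :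
    (M ^ k).map (algebraMap ℝ ℂ) = M.map (algebraMap ℝ ℂ) ^ k :=
  map_pow (algebraMap ℝ ℂ).mapMatrix M k

lemma specRad_lt_one_of_decay {L : Matrix (Fin n) (Fin n) ℝ} {C r : ℝ} (hr0 : 0 ≤ r)
    (hr1 : r < 1) (h : ∀ t : ℕ, ‖L ^ t‖ ^ 2 ≤ C * r ^ t) : specRad L < 1 := by
  obtain ⟨c, hc, hcM⟩ := exists_norm_map_le n
  have hlim : Tendsto (fun t : ℕ => ‖(L.map (algebraMap ℝ ℂ)) ^ (t + 1)‖ *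
      ‖(1 : Matrix (Fin n) (Fin n) ℂ)‖) atTop (nhds 0) := by
    have h1 : Tendsto (fun t : ℕ => C * r ^ t) atTop (nhds 0) := by
      simpa using (tendsto_pow_atTop_nhds_zero_of_lt_one hr0 hr1).const_mul C
    have h2 : Tendsto (fun t : ℕ => ‖L ^ t‖) atTop (nhds 0) := by
      have h3 : Tendsto (fun t : ℕ => √(C * r ^ t)) atTop (nhds 0) := by
        simpa using h1.sqrt
      refine squeeze_zero (fun t => norm_nonneg _) (fun t => ?_) h3
      exact Real.le_sqrt_of_sq_le (h t)
    have h4 : Tendsto (fun t : ℕ => ‖(L.map (algebraMap ℝ ℂ)) ^ t‖) atTop (nhds 0) := by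
      refine squeeze_zero (fun t => norm_nonneg _) (fun t => ?_)
        (by simpa using h2.const_mul c)
      rw [← map_pow_algebraMap]
      exact (hcM _).1
    simpa using ((tendsto_add_atTop_iff_nat 1).mpr h4).mul_const
      ‖(1 : Matrix (Fin n) (Fin n) ℂ)‖
  -- A single power suffices: `r(L) ≤ (‖L ^ (k + 1)‖ ‖1‖) ^ (1 / (k + 1))`, which is below `1` as
  -- soon as the product is.
  obtain ⟨k, hk⟩ := (hlim.eventually (gt_mem_nhds one_pos)).exists
  refine (spectrum.spectralRadius_le_pow_nnnorm_pow_one_div ℂ _ k).trans_lt ?_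
  rw [← ENNReal.mul_rpow_of_nonneg _ _ (by positivity), ← ENNReal.coe_mul]
  refine ENNReal.rpow_lt_one ?_ (by positivity)
  exact_mod_cast hk

/-- Gelfand's formula gives `‖A ^ k‖ ^ (1 / k) < ρ` eventually, over `ℂ`. Without boundedness the
real supremum defining `tau` would take a default value and bound nothing. -/
lemma tau_bddAbove {A : Matrix (Fin n) (Fin n) ℝ} {ρ : ℝ} (h : specRad A < ENNReal.ofReal ρ) :
    BddAbove (Set.range fun k : ℕ => ‖A ^ k‖ / ρ ^ k) := by
  have hρ : 0 < ρ := ENNReal.ofReal_pos.mp (bot_le.trans_lt h)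
  obtain ⟨c, hc, hcM⟩ := exists_norm_map_le n
  have hlim := spectrum.pow_nnnorm_pow_one_div_tendsto_nhds_spectralRadius
    (A.map (algebraMap ℝ ℂ))
  refine Filter.IsBoundedUnder.bddAbove_range (f := fun k : ℕ => ‖A ^ k‖ / ρ ^ k) ⟨c, ?_⟩
  rw [eventually_map]
  filter_upwards [hlim.eventually (gt_mem_nhds h), eventually_gt_atTop 0] with k hk hk0
  rw [div_le_iff₀ (pow_pos hρ k)]
  refine (hcM _).2.trans (mul_le_mul_of_nonneg_left ?_ hc.le)
  rw [map_pow_algebraMap]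
  have hk0' : (0 : ℝ) < k := by exact_mod_cast hk0
  have h1 := ENNReal.rpow_lt_rpow hk hk0'
  rw [← ENNReal.rpow_mul, one_div_mul_cancel hk0'.ne', ENNReal.rpow_one,
    ENNReal.rpow_natCast, ← ENNReal.ofReal_pow hρ.le] at h1
  exact ((ENNReal.lt_ofReal_iff_toReal_lt ENNReal.coe_ne_top).mp h1).le

lemma norm_pow_le_tau {A : Matrix (Fin n) (Fin n) ℝ} {ρ : ℝ}
    (h : specRad A < ENNReal.ofReal ρ) (k : ℕ) : ‖A ^ k‖ ≤ tau A ρ * ρ ^ k := by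
  have hρ : 0 < ρ := ENNReal.ofReal_pos.mp (bot_le.trans_lt h)
  rw [← div_le_iff₀ (pow_pos hρ k)]
  exact le_ciSup (tau_bddAbove h) k

lemma one_le_tau [NeZero n] {A : Matrix (Fin n) (Fin n) ℝ} {ρ : ℝ}
    (h : specRad A < ENNReal.ofReal ρ) : 1 ≤ tau A ρ := by
  simpa using norm_pow_le_tau h 0

end Stability

/-! ### Comparison of the robust and the nominal value -/

section Comparison

variable {n m : ℕ} {A : Matrix (Fin n) (Fin n) ℝ} {B : Matrix (Fin n) (Fin m) ℝ}
  {Q : Matrix (Fin n) (Fin n) ℝ} {R : Matrix (Fin m) (Fin m) ℝ}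

lemma quad_eq_of_ric_fixed (hR : R.PosDef) {P : Matrix (Fin n) (Fin n) ℝ} (hP : P.PosSemidef)
    (hfix : ric A B Q R P = P) (x : Fin n → ℝ) :
    quad P x = stageCost Q R x (nominalGain A B R P *ᵥ x) +
      quad P ((A + B * nominalGain A B R P) *ᵥ x) := by
  have h := quad_ric (A := A) (B := B) (Q := Q) hR hP x
  rwa [hfix] at h

lemma sigmaMin_mul_le_stageCost (hQ : Q.PosSemidef) (hR : R.PosSemidef) (x : Fin n → ℝ)
    (u : Fin m → ℝ) : sigmaMin Q * (x ⬝ᵥ x) ≤ stageCost Q R x u :=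
  (sigmaMin_mul_le_quad hQ x).trans (le_add_of_nonneg_right (quad_nonneg hR u))

/-- If `P` satisfies the Bellman inequality with expansion factor `1 + ε`, it is bounded by a
multiple of the nominal value: follow the nominal trajectory, shrunk by `(1 + ε)⁻¹` per step,
resynchronising every `ℓ + 1` steps by minimum-energy steering. -/
lemma value_le_of_expansion (hQ : Q.PosSemidef) (hR : R.PosDef) (hQ0 : 0 < sigmaMin Q)
    (hR0 : 0 < sigmaMin R) {Pst P : Matrix (Fin n) (Fin n) ℝ} (hPst : Pst.PosSemidef)
    (hfix : ric A B Q R Pst = Pst) (hP : P.PosSemidef) {ε : ℝ} (hε : 0 ≤ ε)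
    (hV : ∀ x u, quad P x ≤ stageCost Q R x u + (1 + ε) * quad P (A *ᵥ x + B *ᵥ u))
    {ℓ : ℕ} (hW : 0 < sigmaMin (gramian A B ℓ)) {a : ℝ} (ha : ∀ j < ℓ, ‖A ^ j‖ ≤ a)
    {η : ℝ} (hη : 0 < η)
    (hηle : max ‖Q‖ ‖R‖ * ((1 + (ℓ * a * ‖B‖) ^ 2) / sigmaMin (gramian A B ℓ) *
      (((ℓ + 1 : ℕ) * ε) ^ 2 * (2 * max ‖A‖ ‖B‖ ^ 2 / min (sigmaMin Q) (sigmaMin R)))) ≤ η ^ 2)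
    (x : Fin n → ℝ) :
    quad P x ≤ (1 + ε) ^ (ℓ + 1) * (1 + η) ^ 2 * quad Pst x := by
  set K := nominalGain A B R Pst with hK
  set L := A + B * K with hL
  set N := ℓ + 1 with hN
  set s := 1 + ε with hs
  have hs1 : 1 ≤ s := by linarith
  have hs0 : 0 < s := by linarith
  set cst : ℕ → (Fin n → ℝ) → ℝ := fun t x => stageCost Q R (L ^ t *ᵥ x) (K *ᵥ (L ^ t *ᵥ x))
    with hcst
  have hcst0 : ∀ t x, 0 ≤ cst t x := fun t x => stageCost_nonneg hQ hR.posSemidef _ _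
  have htele : ∀ (k : ℕ) (x), ∑ t ∈ Finset.range k, cst t x = quad Pst x - quad Pst (L ^ k *ᵥ x) := by
    intro k x
    induction k with
    | zero => simp
    | succ k ih =>
      rw [Finset.sum_range_succ, ih, pow_succ', ← Matrix.mulVec_mulVec,
        quad_eq_of_ric_fixed hR hPst hfix (L ^ k *ᵥ x)]
      ring
  have hm0 : 0 < min (sigmaMin Q) (sigmaMin R) := lt_min hQ0 hR0
  -- one block of `ℓ + 1` steps
  have hblock : ∀ x, quad P x - quad P (L ^ N *ᵥ x) ≤
      s ^ N * (1 + η) ^ 2 * (quad Pst x - quad Pst (L ^ N *ᵥ x)) := by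
    intro x
    -- The perturbed block ends at `s⁻ᴺ Lᴺ x` instead of `Lᴺ x`. As `P` is quadratic, `sᴺ` times its
    -- value there is `s⁻ᴺ` times its value at `Lᴺ x`, so the expansion factor disappears from the
    -- terminal term.
    set θ := 1 - (s ^ N)⁻¹ with hθ
    have hsN : 1 ≤ s ^ N := one_le_pow₀ hs1
    have hθ0 : 0 ≤ θ := sub_nonneg.mpr (inv_le_one_of_one_le₀ hsN)
    -- Bernoulli's inequality for `s⁻¹ ≥ 1 - ε`.
    have hθ1 : θ ≤ (N : ℕ) * ε := by
      have h1 : 1 - ε ≤ s⁻¹ := by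
        rw [← one_div, le_div_iff₀ hs0, hs]
        nlinarith [sq_nonneg ε]
      have h2 := one_add_mul_sub_le_pow (a := s⁻¹)
        (by linarith [inv_pos.mpr hs0]) N
      rw [inv_pow] at h2
      nlinarith [Nat.cast_nonneg (α := ℝ) N]
    obtain ⟨v, hv, hcost⟩ := exists_steering_cost (Q := Q) (R := R) hW ha (-(θ • (L ^ N *ᵥ x)))
    set C := ∑ t ∈ Finset.range N, cst t x with hC
    -- The endpoint is one step after `L ^ ℓ x`, so it is controlled by the last stage cost alone,
    -- which dominates both state and input.
    have hend : (L ^ N *ᵥ x) ⬝ᵥ (L ^ N *ᵥ x) ≤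
        2 * max ‖A‖ ‖B‖ ^ 2 / min (sigmaMin Q) (sigmaMin R) * C := by
      set y := L ^ ℓ *ᵥ x
      have e : L ^ N *ᵥ x = A *ᵥ y + B *ᵥ (K *ᵥ y) := by
        rw [hN, pow_succ', ← Matrix.mulVec_mulVec, hL, Matrix.add_mulVec, Matrix.mulVec_mulVec _ B]
      have h1 := dot_add_self_le (A *ᵥ y) (B *ᵥ (K *ᵥ y))
      have h2 : (A *ᵥ y) ⬝ᵥ (A *ᵥ y) ≤ max ‖A‖ ‖B‖ ^ 2 * (y ⬝ᵥ y) :=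
        (dot_mulVec_self_le A y).trans (mul_le_mul_of_nonneg_right
          (pow_le_pow_left₀ (norm_nonneg _) (le_max_left _ _) 2) (dot_self_nonneg _))
      have h3 : (B *ᵥ (K *ᵥ y)) ⬝ᵥ (B *ᵥ (K *ᵥ y)) ≤
          max ‖A‖ ‖B‖ ^ 2 * ((K *ᵥ y) ⬝ᵥ (K *ᵥ y)) :=
        (dot_mulVec_self_le B _).trans (mul_le_mul_of_nonneg_right
          (pow_le_pow_left₀ (norm_nonneg _) (le_max_right _ _) 2) (dot_self_nonneg _))
      have h4 := le_stageCost hQ hR.posSemidef y (K *ᵥ y)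
      have h5 : cst ℓ x ≤ C := Finset.single_le_sum (f := fun t => cst t x)
        (fun t _ => hcst0 t x) (Finset.mem_range.mpr (Nat.lt_succ_self ℓ))
      have h6 : y ⬝ᵥ y + (K *ᵥ y) ⬝ᵥ (K *ᵥ y) ≤ C / min (sigmaMin Q) (sigmaMin R) := by
        rw [le_div_iff₀ hm0]
        calc _ = min (sigmaMin Q) (sigmaMin R) * (y ⬝ᵥ y + (K *ᵥ y) ⬝ᵥ (K *ᵥ y)) := by ring
          _ ≤ C := h4.trans h5
      rw [e]
      calc _ ≤ 2 * max ‖A‖ ‖B‖ ^ 2 * (y ⬝ᵥ y + (K *ᵥ y) ⬝ᵥ (K *ᵥ y)) := by linarith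
        _ ≤ 2 * max ‖A‖ ‖B‖ ^ 2 * (C / min (sigmaMin Q) (sigmaMin R)) :=
          mul_le_mul_of_nonneg_left h6 (by positivity)
        _ = _ := by ring
    have hC0 : 0 ≤ C := Finset.sum_nonneg fun t _ => hcst0 t x
    have hdev : ∑ t ∈ Finset.range N, stageCost Q R (resp A B v t) (v t) ≤ η ^ 2 * C := by
      refine hcost.trans ?_
      have h1 : -(θ • (L ^ N *ᵥ x)) ⬝ᵥ -(θ • (L ^ N *ᵥ x)) ≤ (N * ε) ^ 2 *
          (2 * max ‖A‖ ‖B‖ ^ 2 / min (sigmaMin Q) (sigmaMin R) * C) := by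
        rw [neg_dotProduct_neg, smul_dotProduct, dotProduct_smul, smul_eq_mul, smul_eq_mul,
          ← mul_assoc, ← sq]
        exact mul_le_mul (pow_le_pow_left₀ hθ0 hθ1 2) hend (dot_self_nonneg _) (sq_nonneg _)
      have h2 : 0 ≤ max ‖Q‖ ‖R‖ * ((1 + (ℓ * a * ‖B‖) ^ 2) / sigmaMin (gramian A B ℓ)) :=
        mul_nonneg (le_max_of_le_left (norm_nonneg _)) (by positivity)
      have h3 := mul_le_mul_of_nonneg_left h1 h2
      have h4 := mul_le_mul_of_nonneg_right hηle hC0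
      calc _ = max ‖Q‖ ‖R‖ * ((1 + (ℓ * a * ‖B‖) ^ 2) / sigmaMin (gramian A B ℓ)) *
            (-(θ • (L ^ N *ᵥ x)) ⬝ᵥ -(θ • (L ^ N *ᵥ x))) := by ring
        _ ≤ _ := h3
        _ = _ := by ring
        _ ≤ _ := h4
    have hbell := bellman_iterate hs0.le hV (x := fun t => L ^ t *ᵥ x + resp A B v t)
      (u := fun t => K *ᵥ (L ^ t *ᵥ x) + v t) (fun t => by
        simp only [resp, pow_succ', ← Matrix.mulVec_mulVec, Matrix.mulVec_add]
        rw [hL, Matrix.add_mulVec, ← Matrix.mulVec_mulVec]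
        abel) N
    rw [hv] at hbell
    have e1 : L ^ N *ᵥ x + -(θ • (L ^ N *ᵥ x)) = (s ^ N)⁻¹ • (L ^ N *ᵥ x) := by
      rw [← sub_eq_add_neg, hθ, sub_smul, one_smul, sub_sub_cancel]
    rw [e1, quad_smul] at hbell
    simp only [resp, pow_zero, Matrix.one_mulVec, add_zero] at hbell
    have h1 : s ^ N * ((s ^ N)⁻¹ ^ 2 * quad P (L ^ N *ᵥ x)) ≤ quad P (L ^ N *ᵥ x) := by
      have : s ^ N * ((s ^ N)⁻¹ ^ 2 * quad P (L ^ N *ᵥ x)) =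
        (s ^ N)⁻¹ * quad P (L ^ N *ᵥ x) := by field_simp
      rw [this]
      exact mul_le_of_le_one_left (quad_nonneg hP _) (inv_le_one_of_one_le₀ hsN)
    -- Splitting with weight `η` matches the deviation cost `η² C`: `(1 + η) + (1 + η⁻¹) η² = (1 +
    -- η)²`.
    have h2 : ∑ t ∈ Finset.range N, s ^ t * stageCost Q R (L ^ t *ᵥ x + resp A B v t)
        (K *ᵥ (L ^ t *ᵥ x) + v t) ≤ s ^ N * ((1 + η) ^ 2 * C) := by
      calc _ ≤ ∑ t ∈ Finset.range N, s ^ N * ((1 + η) * cst t x +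
            (1 + η⁻¹) * stageCost Q R (resp A B v t) (v t)) := by
            refine Finset.sum_le_sum fun t ht => ?_
            refine mul_le_mul (pow_le_pow_right₀ hs1 (Finset.mem_range.mp ht).le)
              (stageCost_add_le hQ hR.posSemidef hη _ _ _ _)
              (stageCost_nonneg hQ hR.posSemidef _ _) (pow_nonneg hs0.le N)
        _ = s ^ N * ((1 + η) * C +
            (1 + η⁻¹) * ∑ t ∈ Finset.range N, stageCost Q R (resp A B v t) (v t)) := by
            rw [← Finset.mul_sum, Finset.sum_add_distrib, ← Finset.mul_sum, ← Finset.mul_sum]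
        _ ≤ s ^ N * ((1 + η) * C + (1 + η⁻¹) * (η ^ 2 * C)) := by
            refine mul_le_mul_of_nonneg_left ?_ (pow_nonneg hs0.le N)
            have := mul_le_mul_of_nonneg_left hdev (by positivity : 0 ≤ 1 + η⁻¹)
            linarith
        _ = _ := by field_simp; ring
    rw [← htele, ← hC]
    linarith
  -- iterate over blocks
  set p := s ^ N * (1 + η) ^ 2
  obtain ⟨D, r, -, hr0, hr1, hdec⟩ := exists_decay (L := L ^ N) hPst hQ0 (fun x => by
    have h1 := htele N x
    have h2 : cst 0 x ≤ ∑ t ∈ Finset.range N, cst t x := Finset.single_le_sum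
      (f := fun t => cst t x) (fun t _ => hcst0 t x) (Finset.mem_range.mpr (Nat.succ_pos ℓ))
    have h3 := sigmaMin_mul_le_stageCost hQ hR.posSemidef (L ^ 0 *ᵥ x) (K *ᵥ (L ^ 0 *ᵥ x))
    simp only [hcst, pow_zero, Matrix.one_mulVec] at h2 h3
    linarith)
  -- By `hblock`, `p P_⋆ - P` does not increase along the stable map `L ^ N`. Hence it is
  -- nonnegative, with the same factor `p` however many blocks are used.
  have := quad_nonneg_of_decay hr0 hr1 hdec (D := p • Pst - P) (fun x => by
    simp only [quad_sub_matrix, quad_smul_matrix]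
    linarith [hblock x]) x
  rw [quad_sub_matrix, quad_smul_matrix] at this
  linarith

/-- Any positive semidefinite supersolution dominates the nominal value. -/
lemma nominal_le_of_super (hQ : Q.PosSemidef) (hR : R.PosDef) (hQ0 : 0 < sigmaMin Q)
    {Pst P Y : Matrix (Fin n) (Fin n) ℝ} (hPst : Pst.PosSemidef)
    (hfix : ric A B Q R Pst = Pst) (hP : P.PosSemidef) (hY : Y.PosSemidef)
    (hPY : ∀ x, quad P x ≤ quad Y x) (h : ric A B Q R Y = P) (x : Fin n → ℝ) :
    quad Pst x ≤ quad P x := by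
  set L := A + B * nominalGain A B R Y
  have h1 : ∀ x, quad P x = stageCost Q R x (nominalGain A B R Y *ᵥ x) + quad Y (L *ᵥ x) :=
    fun x => by rw [← h]; exact quad_ric hR hY x
  -- `P` is itself a Lyapunov function for the loop closed with the gain of `Y`; since that gain is
  -- suboptimal for `P_⋆`, the difference `P - P_⋆` does not increase along the loop.
  obtain ⟨D, r, -, hr0, hr1, hdec⟩ := exists_decay (L := L) hP hQ0 (fun x => by
    rw [h1 x]
    linarith [hPY (L *ᵥ x), sigmaMin_mul_le_stageCost hQ hR.posSemidef x (nominalGain A B R Y *ᵥ x)])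
  have := quad_nonneg_of_decay hr0 hr1 hdec (D := P - Pst) (fun x => by
    simp only [quad_sub_matrix]
    have h2 := quad_ric_le (A := A) (B := B) (Q := Q) hR hPst x (nominalGain A B R Y *ᵥ x)
    rw [hfix, Matrix.mulVec_mulVec, ← Matrix.add_mulVec] at h2
    linarith [h1 x, hPY (L *ᵥ x)]) x
  rw [quad_sub_matrix] at this
  linarith

/-- The gain attached to a solution is stabilising. -/
lemma exists_decay_gain (hQ : Q.PosSemidef) (hR : R.PosDef) (hQ0 : 0 < sigmaMin Q)
    {P Y : Matrix (Fin n) (Fin n) ℝ} (hP : P.PosSemidef) (hY : Y.PosSemidef)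
    (hPY : ∀ x, quad P x ≤ quad Y x) (h : ric A B Q R Y = P) :
    ∃ C r : ℝ, 0 ≤ C ∧ 0 ≤ r ∧ r < 1 ∧
      ∀ t : ℕ, ‖(A + B * nominalGain A B R Y) ^ t‖ ^ 2 ≤ C * r ^ t :=
  exists_decay hP hQ0 fun x => by
    rw [← h, quad_ric hR hY x, h]
    linarith [hPY ((A + B * nominalGain A B R Y) *ᵥ x),
      sigmaMin_mul_le_stageCost hQ hR.posSemidef x (nominalGain A B R Y *ᵥ x)]

end Comparison

/-! ### The critical level -/

section CriticalLevel

variable {n m : ℕ} {A : Matrix (Fin n) (Fin n) ℝ} {B : Matrix (Fin n) (Fin m) ℝ}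
  {Q : Matrix (Fin n) (Fin n) ℝ} {R : Matrix (Fin m) (Fin m) ℝ}

/-- Twice the nominal value is a supersolution at every large enough level. -/
lemma exists_isSuper (hQ : Q.PosSemidef) (hR : R.PosDef) (hQ0 : 0 < sigmaMin Q)
    {Pst : Matrix (Fin n) (Fin n) ℝ} (hPst : IsNominalValue A B Q R Pst) :
    ∃ γ : ℝ, 0 < γ ∧ IsSuper A B Q R γ ((2 : ℝ) • Pst) := by
  obtain ⟨hP, hfix⟩ := hPst
  set q := sigmaMin Q
  set b := ‖Pst‖ + q
  have hb : 0 < b := by positivity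
  have hPb : ∀ x, quad Pst x ≤ b * (x ⬝ᵥ x) := fun x =>
    (quad_le_norm Pst x).trans
      (mul_le_mul_of_nonneg_right (le_add_of_nonneg_right hQ0.le) (dot_self_nonneg x))
  have hX : ((2 : ℝ) • Pst).PosSemidef := hP.smul zero_le_two
  have hXb : ∀ x, quad ((2 : ℝ) • Pst) x ≤ 2 * b * (x ⬝ᵥ x) := fun x => by
    rw [quad_smul_matrix]; linarith [hPb x]
  -- the level is chosen such that the inflation factor is `1 + q / (2 b)`
  set γ := √(2 * b + 2 * b / (q / (2 * b)))
  have hγ : γ ^ 2 = 2 * b + 2 * b / (q / (2 * b)) := Real.sq_sqrt (by positivity)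
  have hlt : 2 * b < γ ^ 2 := by rw [hγ]; linarith [show 0 < 2 * b / (q / (2 * b)) by positivity]
  have hG := posDef_smul_one_sub hX.1 hlt hXb
  refine ⟨γ, Real.sqrt_pos.mpr (by positivity), hX, hG, fun x => ?_⟩
  have hadv := quad_adv_le hX (by positivity) hlt hXb
  have e : 2 * b / (γ ^ 2 - 2 * b) = q / (2 * b) := by
    rw [hγ, add_sub_cancel_left]; field_simp
  rw [e] at hadv
  set K := nominalGain A B R Pst
  have h1 := quad_ric_le (A := A) (B := B) (Q := Q) hR (adv_posSemidef hX hG) x (K *ᵥ x)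
  rw [Matrix.mulVec_mulVec, ← Matrix.add_mulVec] at h1
  have h2 := quad_eq_of_ric_fixed hR hP hfix x
  have h3 := hadv ((A + B * K) *ᵥ x)
  rw [quad_smul_matrix] at h3 ⊢
  have h4 := sigmaMin_mul_le_stageCost hQ hR.posSemidef x (K *ᵥ x)
  set J' := quad Pst ((A + B * K) *ᵥ x)
  -- Twice the nominal value carries one spare copy of the stage cost, and this spare copy pays for
  -- the inflation of the future term.
  have h5 : q / b * J' ≤ stageCost Q R x (K *ᵥ x) := by
    have h6 : J' ≤ quad Pst x := by rw [h2]; linarith [mul_nonneg hQ0.le (dot_self_nonneg x)]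
    calc q / b * J' ≤ q / b * (b * (x ⬝ᵥ x)) :=
          mul_le_mul_of_nonneg_left (h6.trans (hPb x)) (by positivity)
      _ = q * (x ⬝ᵥ x) := by field_simp
      _ ≤ _ := h4
  have e2 : (1 + q / (2 * b)) * (2 * J') = 2 * J' + q / b * J' := by field_simp
  linarith

lemma gammaInf_nonneg : 0 ≤ gammaInf A B Q R := Real.sInf_nonneg fun _ h => h.1.le

lemma exists_robust_level_lt (hQ : Q.PosSemidef) (hR : R.PosDef) (hQ0 : 0 < sigmaMin Q)
    {Pst : Matrix (Fin n) (Fin n) ℝ} (hPst : IsNominalValue A B Q R Pst) {c : ℝ}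
    (hc : gammaInf A B Q R < c) :
    ∃ γ, 0 < γ ∧ γ < c ∧ ∃ P, IsRobustSolution A B Q R γ P := by
  obtain ⟨γ₀, h0, hs⟩ := exists_isSuper hQ hR hQ0 hPst
  obtain ⟨P, hP, -⟩ := exists_minimal_solution hQ hR hs
  have hne : {γ : ℝ | 0 < γ ∧ ∃ P, IsRobustSolution A B Q R γ P}.Nonempty := ⟨γ₀, h0, P, hP⟩
  obtain ⟨γ, hγ, hlt⟩ := exists_lt_of_csInf_lt hne hc
  exact ⟨γ, hγ.1, hlt, hγ.2⟩

/-- Above the critical level the robust value exists and is bounded by `γ_∞² I`. -/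
lemma exists_isRobustValue (hQ : Q.PosSemidef) (hR : R.PosDef) (hQ0 : 0 < sigmaMin Q)
    {Pst : Matrix (Fin n) (Fin n) ℝ} (hPst : IsNominalValue A B Q R Pst) {γ : ℝ}
    (hγ : gammaInf A B Q R < γ) :
    ∃ P, IsRobustValue A B Q R γ P ∧ ∀ x, quad P x ≤ gammaInf A B Q R ^ 2 * (x ⬝ᵥ x) := by
  obtain ⟨γ₁, h1, h1lt, P₁, hP₁⟩ := exists_robust_level_lt hQ hR hQ0 hPst hγ
  obtain ⟨P, hP, hmin⟩ := exists_minimal_solution hQ hR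
    ((hP₁.isSuper hR).mono hR (pow_le_pow_left₀ h1.le h1lt.le 2))
  refine ⟨P, ⟨hP, fun P' hP' => Matrix.le_iff.mp (hmin P' (hP'.isSuper hR))⟩, fun x => ?_⟩
  -- A solution `P₂` at a level `γ₂ < min γ c` is a supersolution at level `γ`, so `P ⪯ P₂ ≺ γ₂² I ⪯
  -- c² I`; then `c` decreases to `γ_∞`.
  have hc : ∀ c > gammaInf A B Q R, quad P x ≤ c ^ 2 * (x ⬝ᵥ x) := by
    intro c hc
    obtain ⟨γ₂, h2, h2lt, P₂, hP₂⟩ := exists_robust_level_lt hQ hR hQ0 hPst (lt_min hγ hc)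
    have hle := hmin P₂ ((hP₂.isSuper hR).mono hR
      (pow_le_pow_left₀ h2.le (h2lt.le.trans (min_le_left _ _)) 2))
    have h3 := quad_le_of_le hle x
    have h4 := quad_nonneg hP₂.2.1.posSemidef x
    rw [quad_sub_matrix, quad_smul_matrix, quad_one] at h4
    have h5 : γ₂ ^ 2 ≤ c ^ 2 := pow_le_pow_left₀ h2.le (h2lt.le.trans (min_le_right _ _)) 2
    linarith [mul_le_mul_of_nonneg_right h5 (dot_self_nonneg x)]
  have hlim : Tendsto (fun c : ℝ => c ^ 2 * (x ⬝ᵥ x))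
      (nhdsWithin (gammaInf A B Q R) (Set.Ioi (gammaInf A B Q R)))
      (nhds (gammaInf A B Q R ^ 2 * (x ⬝ᵥ x))) :=
    ((continuous_pow 2).mul continuous_const).continuousWithinAt
  exact ge_of_tendsto hlim (eventually_nhdsWithin_of_forall hc)

lemma IsRobustValue.quad_le (hQ : Q.PosSemidef) (hR : R.PosDef) (hQ0 : 0 < sigmaMin Q)
    {Pst P : Matrix (Fin n) (Fin n) ℝ} (hPst : IsNominalValue A B Q R Pst) {γ : ℝ}
    (hγ : gammaInf A B Q R < γ) (hP : IsRobustValue A B Q R γ P) (x : Fin n → ℝ) :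
    quad P x ≤ gammaInf A B Q R ^ 2 * (x ⬝ᵥ x) := by
  obtain ⟨P', hP', hb⟩ := exists_isRobustValue hQ hR hQ0 hPst hγ
  exact (quad_le_of_le (Matrix.le_iff.mpr (hP.2 P' hP'.1)) x).trans (hb x)

end CriticalLevel

/-! ### The nominal cost of a stabilising gain -/

section Cost

variable {n m k : ℕ} {A : Matrix (Fin n) (Fin n) ℝ} {B : Matrix (Fin n) (Fin m) ℝ}
  {Q : Matrix (Fin n) (Fin n) ℝ} {R : Matrix (Fin m) (Fin m) ℝ} {σ : ℝ}
  {F : Matrix (Fin m) (Fin n) ℝ}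
  {Ω : Type*} {x₀ : Ω → Fin n → ℝ} {w : ℕ → Ω → Fin n → ℝ}

lemma closedLoop_succ (t : ℕ) (ω : Ω) :
    closedLoop A B σ F x₀ w (t + 1) ω =
      (A + B * F) *ᵥ closedLoop A B σ F x₀ w t ω + σ • w t ω := by
  rw [Matrix.add_mulVec, ← Matrix.mulVec_mulVec]; rfl

variable [MeasurableSpace Ω] {μ : Measure Ω}

lemma integrable_mul_of_memLp {f g : Ω → ℝ} (hf : MemLp f 2 μ) (hg : MemLp g 2 μ) :
    Integrable (fun ω => f ω * g ω) μ := hf.integrable_mul hg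

lemma integrable_bilin {Y : Ω → Fin n → ℝ} {Z : Ω → Fin k → ℝ} (M : Matrix (Fin n) (Fin k) ℝ)
    (hY : ∀ i, MemLp (fun ω => Y ω i) 2 μ) (hZ : ∀ i, MemLp (fun ω => Z ω i) 2 μ) :
    Integrable (fun ω => Y ω ⬝ᵥ M *ᵥ Z ω) μ := by
  simp only [dotProduct, Matrix.mulVec, Finset.mul_sum]
  refine integrable_finsetSum _ fun i _ => integrable_finsetSum _ fun j _ => ?_
  have := (integrable_mul_of_memLp (hY i) (hZ j)).const_mul (M i j)
  refine this.congr (Eventually.of_forall fun ω => ?_)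
  simp only; ring

lemma integral_bilin {Y : Ω → Fin n → ℝ} {Z : Ω → Fin k → ℝ} (M : Matrix (Fin n) (Fin k) ℝ)
    (hY : ∀ i, MemLp (fun ω => Y ω i) 2 μ) (hZ : ∀ i, MemLp (fun ω => Z ω i) 2 μ) :
    ∫ ω, Y ω ⬝ᵥ M *ᵥ Z ω ∂μ = ∑ i, ∑ j, M i j * ∫ ω, Y ω i * Z ω j ∂μ := by
  have e : ∀ ω, Y ω ⬝ᵥ M *ᵥ Z ω = ∑ i, ∑ j, M i j * (Y ω i * Z ω j) := by
    intro ω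
    simp only [dotProduct, Matrix.mulVec, Finset.mul_sum]
    exact Finset.sum_congr rfl fun i _ => Finset.sum_congr rfl fun j _ => by ring
  simp only [e]
  have hint : ∀ i j, Integrable (fun ω => M i j * (Y ω i * Z ω j)) μ := fun i j =>
    (integrable_mul_of_memLp (hY i) (hZ j)).const_mul _
  rw [integral_finsetSum _ fun i _ => integrable_finsetSum _ fun j _ => hint i j]
  refine Finset.sum_congr rfl fun i _ => ?_
  rw [integral_finsetSum _ fun j _ => hint i j]
  exact Finset.sum_congr rfl fun j _ => integral_const_mul _ _

lemma memLp_closedLoop (hN : IsNoise μ x₀ w) (t : ℕ) (i : Fin n) :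
    MemLp (fun ω => closedLoop A B σ F x₀ w t ω i) 2 μ := by
  induction t generalizing i with
  | zero => exact hN.memLp_init i
  | succ t ih =>
    simp only [closedLoop_succ, Pi.add_apply, Pi.smul_apply, smul_eq_mul, Matrix.mulVec,
      dotProduct]
    exact (memLp_finsetSum _ fun j _ => (ih j).const_mul _).add ((hN.memLp_noise t i).const_mul σ)

/-- The state at time `t` is a linear combination of `x₀` and the earlier noises. Zero correlation
with `x₀` is enough; independence is used only among the noises. -/
lemma integral_closedLoop_mul_noise (hN : IsNoise μ x₀ w) (t : ℕ) :
    ∀ s, t ≤ s → ∀ i j, ∫ ω, closedLoop A B σ F x₀ w t ω i * w s ω j ∂μ = 0 := by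
  induction t with
  | zero => exact fun s _ i j => hN.uncorr s i j
  | succ t ih =>
    intro s hs i j
    set L := A + B * F
    have e : ∀ ω, closedLoop A B σ F x₀ w (t + 1) ω i * w s ω j =
        ∑ k, L i k * (closedLoop A B σ F x₀ w t ω k * w s ω j) + σ * (w t ω i * w s ω j) := by
      intro ω
      rw [closedLoop_succ]
      simp only [Pi.add_apply, Pi.smul_apply, smul_eq_mul, Matrix.mulVec, dotProduct]
      rw [add_mul, Finset.sum_mul]
      congr 1
      · exact Finset.sum_congr rfl fun _ _ => by ring
      · ring
    simp only [e]
    have h1 : ∀ k, Integrable (fun ω => L i k * (closedLoop A B σ F x₀ w t ω k * w s ω j)) μ :=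
      fun k => (integrable_mul_of_memLp (memLp_closedLoop hN t k) (hN.memLp_noise s j)).const_mul _
    have h2 : Integrable (fun ω => σ * (w t ω i * w s ω j)) μ :=
      (integrable_mul_of_memLp (hN.memLp_noise t i) (hN.memLp_noise s j)).const_mul _
    have hind : IndepFun (fun ω => w t ω i) (fun ω => w s ω j) μ :=
      (hN.indep.indepFun (by omega : t ≠ s)).comp (measurable_pi_apply i) (measurable_pi_apply j)
    have h3 : ∫ ω, w t ω i * w s ω j ∂μ = 0 := by
      rw [hind.integral_fun_mul_eq_mul_integral (hN.memLp_noise t i).1 (hN.memLp_noise s j).1,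
        hN.mean_noise, zero_mul]
    rw [integral_add (integrable_finsetSum _ fun k _ => h1 k) h2,
      integral_finsetSum _ fun k _ => h1 k, integral_const_mul, h3, mul_zero, add_zero]
    refine Finset.sum_eq_zero fun k _ => ?_
    rw [integral_const_mul, ih s (by omega), mul_zero]

lemma integrable_quad (hN : IsNoise μ x₀ w) (M : Matrix (Fin n) (Fin n) ℝ) (t : ℕ) :
    Integrable (fun ω => quad M (closedLoop A B σ F x₀ w t ω)) μ :=
  integrable_bilin M (memLp_closedLoop hN t) (memLp_closedLoop hN t)

/-- The cross term has zero mean by `integral_closedLoop_mul_noise`, and the identity covariance of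
the noise produces the trace. -/
lemma integral_quad_succ (hN : IsNoise μ x₀ w) {M : Matrix (Fin n) (Fin n) ℝ}
    (hM : M.IsHermitian) (t : ℕ) :
    ∫ ω, quad M (closedLoop A B σ F x₀ w (t + 1) ω) ∂μ =
      ∫ ω, quad ((A + B * F)ᵀ * M * (A + B * F)) (closedLoop A B σ F x₀ w t ω) ∂μ +
        σ ^ 2 * M.trace := by
  set L := A + B * F
  have e : ∀ ω, quad M (closedLoop A B σ F x₀ w (t + 1) ω) =
      quad (Lᵀ * M * L) (closedLoop A B σ F x₀ w t ω) +
        2 * σ * (closedLoop A B σ F x₀ w t ω ⬝ᵥ (Lᵀ * M) *ᵥ w t ω) + σ ^ 2 * quad M (w t ω) := by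
    intro ω
    rw [closedLoop_succ, quad_add hM, quad_smul, quad_transpose_mul_mul, Matrix.mulVec_smul,
      dotProduct_smul, ← Matrix.mulVec_mulVec, dot_mulVec_mulVec Lᵀ, Matrix.transpose_transpose,
      smul_eq_mul]
    ring
  have h1 := integrable_quad (A := A) (B := B) (σ := σ) (F := F) hN (Lᵀ * M * L) t
  have h2 := integrable_bilin (Lᵀ * M) (memLp_closedLoop (A := A) (B := B) (σ := σ) (F := F) hN t)
    (hN.memLp_noise t)
  have h3 : Integrable (fun ω => quad M (w t ω)) μ :=
    integrable_bilin M (hN.memLp_noise t) (hN.memLp_noise t)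
  have h4 : ∫ ω, closedLoop A B σ F x₀ w t ω ⬝ᵥ (Lᵀ * M) *ᵥ w t ω ∂μ = 0 := by
    rw [integral_bilin (Lᵀ * M) (memLp_closedLoop hN t) (hN.memLp_noise t)]
    exact Finset.sum_eq_zero fun i _ => Finset.sum_eq_zero fun j _ => by
      rw [integral_closedLoop_mul_noise hN t t le_rfl, mul_zero]
  have h5 : ∫ ω, quad M (w t ω) ∂μ = M.trace := by
    unfold quad
    rw [integral_bilin M (hN.memLp_noise t) (hN.memLp_noise t)]
    simp [hN.cov_noise, Matrix.trace]
  have h12 : Integrable (fun ω => quad (Lᵀ * M * L) (closedLoop A B σ F x₀ w t ω) +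
      2 * σ * (closedLoop A B σ F x₀ w t ω ⬝ᵥ (Lᵀ * M) *ᵥ w t ω)) μ := h1.add (h2.const_mul _)
  simp only [e]
  rw [integral_add h12 (h3.const_mul _), integral_add h1 (h2.const_mul _),
    integral_const_mul, integral_const_mul, h4, h5]
  ring

lemma stageCost_feedback (x : Fin n → ℝ) :
    stageCost Q R x (F *ᵥ x) = quad (Q + Fᵀ * R * F) x := by
  rw [quad_add_matrix, quad_transpose_mul_mul]; rfl

/-- The nominal cost in terms of the solution of the Lyapunov equation of the closed loop. -/
lemma nominalCost_eq (hN : IsNoise μ x₀ w) (hQ : Q.PosSemidef) (hR : R.PosSemidef)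
    (hQ0 : 0 < sigmaMin Q) {M : Matrix (Fin n) (Fin n) ℝ} (hM : M.PosSemidef)
    (hfix : M = Q + Fᵀ * R * F + (A + B * F)ᵀ * M * (A + B * F)) :
    nominalCost μ A B Q R σ x₀ w F = ENNReal.ofReal (σ ^ 2 * M.trace) := by
  set L := A + B * F with hL
  set X := closedLoop A B σ F x₀ w with hX
  set C := Q + Fᵀ * R * F with hC
  set e : ℕ → ℝ := fun t => ∫ ω, quad M (X t ω) ∂μ with he
  set c : ℕ → ℝ := fun t => ∫ ω, quad C (X t ω) ∂μ with hc
  have hCq : ∀ x, sigmaMin Q * (x ⬝ᵥ x) ≤ quad C x := fun x => by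
    rw [hC, ← stageCost_feedback]; exact sigmaMin_mul_le_stageCost hQ hR x _
  have hCpsd : ∀ x, 0 ≤ quad C x := fun x =>
    (mul_nonneg hQ0.le (dot_self_nonneg x)).trans (hCq x)
  have he0 : ∀ t, 0 ≤ e t := fun t => integral_nonneg fun ω => quad_nonneg hM _
  have hstep : ∀ t, c t = e t - e (t + 1) + σ ^ 2 * M.trace := by
    intro t
    have h1 := integral_quad_succ (A := A) (B := B) (σ := σ) (F := F) hN hM.1 t
    have h2 : e t = c t + ∫ ω, quad (Lᵀ * M * L) (X t ω) ∂μ := by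
      rw [he, hc]
      simp only
      rw [← integral_add (integrable_quad hN C t) (integrable_quad hN _ t)]
      refine integral_congr_ae (Eventually.of_forall fun ω => ?_)
      simp only
      rw [← quad_add_matrix, ← hfix]
    have h3 : e (t + 1) = ∫ ω, quad (Lᵀ * M * L) (X t ω) ∂μ + σ ^ 2 * M.trace := h1
    linarith
  -- the second moments stay bounded
  have hbdd : ∃ K, ∀ t, e t ≤ K := by
    set b := ‖M‖ + sigmaMin Q
    have hb : 0 < b := by positivity
    set α := sigmaMin Q / b
    have hα : 0 < α := div_pos hQ0 hb
    have hα1 : α ≤ 1 := (div_le_one hb).mpr (le_add_of_nonneg_left (norm_nonneg _))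
    have hCM : ∀ x, α * quad M x ≤ quad C x := fun x => by
      refine le_trans ?_ (hCq x)
      have h1 : quad M x ≤ b * (x ⬝ᵥ x) := (quad_le_norm M x).trans
        (mul_le_mul_of_nonneg_right (le_add_of_nonneg_right hQ0.le) (dot_self_nonneg x))
      calc α * quad M x ≤ α * (b * (x ⬝ᵥ x)) := mul_le_mul_of_nonneg_left h1 hα.le
        _ = _ := by simp only [α]; field_simp
    have hce : ∀ t, α * e t ≤ c t := fun t => by
      rw [he, hc]
      simp only
      rw [← integral_const_mul]
      exact integral_mono ((integrable_quad hN M t).const_mul α) (integrable_quad hN C t)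
        fun ω => hCM _
    have htr : 0 ≤ σ ^ 2 * M.trace := mul_nonneg (sq_nonneg _) hM.trace_nonneg
    -- The recursion `e (t + 1) ≤ (1 - α) e t + σ² tr M` has fixed point `σ² tr M / α`; adding `e 0`
    -- also covers the start.
    refine ⟨e 0 + σ ^ 2 * M.trace / α, fun t => ?_⟩
    induction t with
    | zero => linarith [div_nonneg htr hα.le]
    | succ t ih =>
      have h1 := hstep t
      have h2 := hce t
      have h3 : (1 - α) * e t ≤ (1 - α) * (e 0 + σ ^ 2 * M.trace / α) :=
        mul_le_mul_of_nonneg_left ih (by linarith)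
      have h4 : α * (σ ^ 2 * M.trace / α) = σ ^ 2 * M.trace := by field_simp
      nlinarith [he0 0]
  obtain ⟨K, hK⟩ := hbdd
  have hsum : ∀ T, ∑ t ∈ Finset.range T, c t = e 0 - e T + T * (σ ^ 2 * M.trace) := by
    intro T
    induction T with
    | zero => simp
    | succ T ih => rw [Finset.sum_range_succ, ih, hstep]; push_cast; ring
  have hlint : ∀ T : ℕ, ∫⁻ ω, ∑ t ∈ Finset.range T, ENNReal.ofReal
      (stageCost Q R (X t ω) (F *ᵥ X t ω)) ∂μ = ENNReal.ofReal (∑ t ∈ Finset.range T, c t) := by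
    intro T
    simp only [stageCost_feedback]
    rw [lintegral_finsetSum' _ fun t _ => (integrable_quad hN C t).1.aemeasurable.ennreal_ofReal,
      ENNReal.ofReal_sum_of_nonneg fun t _ => integral_nonneg fun ω => hCpsd _]
    refine Finset.sum_congr rfl fun t _ => ?_
    rw [ofReal_integral_eq_lintegral_ofReal (integrable_quad hN C t)
      (Eventually.of_forall fun ω => hCpsd _)]
  have hreal : Tendsto (fun T : ℕ => (∑ t ∈ Finset.range T, c t) / (T : ℝ)) atTop
      (nhds (σ ^ 2 * M.trace)) := by
    -- Bounded second moments make the telescoped boundary term negligible, so the averages converge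
    -- and the limsup is a limit.
    have h1 : Tendsto (fun T : ℕ => (e 0 - e T) / (T : ℝ)) atTop (nhds 0) := by
      refine squeeze_zero_norm (a := fun T : ℕ => (e 0 + K) / (T : ℝ)) (fun T => ?_)
        (tendsto_const_div_atTop_nhds_zero_nat _)
      rw [norm_div, Real.norm_natCast]
      refine div_le_div_of_nonneg_right ?_ (Nat.cast_nonneg T)
      rw [Real.norm_eq_abs, abs_le]
      constructor <;> linarith [he0 0, he0 T, hK T, hK 0]
    have h2 := h1.add_const (σ ^ 2 * M.trace)
    rw [zero_add] at h2
    refine h2.congr' ?_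
    filter_upwards [eventually_gt_atTop 0] with T hT
    have : (T : ℝ) ≠ 0 := by exact_mod_cast hT.ne'
    rw [hsum]
    field_simp
  have hlim := (ENNReal.tendsto_ofReal hreal).congr' (f₂ := fun T : ℕ =>
      (∫⁻ ω, ∑ t ∈ Finset.range T, ENNReal.ofReal
      (stageCost Q R (X t ω) (F *ᵥ X t ω)) ∂μ) / (T : ℝ≥0∞)) (by
    filter_upwards [eventually_gt_atTop 0] with T hT
    rw [hlint, ENNReal.ofReal_div_of_pos (by exact_mod_cast hT), ENNReal.ofReal_natCast])
  exact hlim.limsup_eq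

end Cost

/-! ### Performance difference -/

section PerformanceDifference

variable {n m : ℕ} {A : Matrix (Fin n) (Fin n) ℝ} {B : Matrix (Fin n) (Fin m) ℝ}
  {Q : Matrix (Fin n) (Fin n) ℝ} {R : Matrix (Fin m) (Fin m) ℝ}

/-- By cyclicity this is the trace of `K W Kᵀ`, a sum of values of the form of `W` at the rows of
`K`. -/
lemma trace_mul_le (K : Matrix (Fin m) (Fin n) ℝ) (W : Matrix (Fin n) (Fin n) ℝ) :
    (Kᵀ * K * W).trace ≤ ‖W‖ * (Kᵀ * K).trace := by
  have e1 : (Kᵀ * K * W).trace = (Kᵀᵀ * W * Kᵀ).trace := by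
    rw [Matrix.mul_assoc, Matrix.trace_mul_comm, Matrix.transpose_transpose]
  have e2 : (Kᵀ * K).trace = (Kᵀᵀ * (1 : Matrix (Fin n) (Fin n) ℝ) * Kᵀ).trace := by
    rw [Matrix.trace_mul_comm, Matrix.transpose_transpose, Matrix.mul_one]
  rw [e1, e2, trace_eq_sum_quad, trace_eq_sum_quad, Finset.mul_sum]
  refine Finset.sum_le_sum fun i _ => ?_
  rw [quad_transpose_mul_mul, quad_transpose_mul_mul, quad_one]
  exact quad_le_norm _ _

/-- Passing from `Kᵀ K` to `K Kᵀ` leaves only `m` diagonal entries; this is the source of the input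
dimension in the final bound. -/
lemma trace_transpose_mul_mul_le (M : Matrix (Fin m) (Fin m) ℝ) (K : Matrix (Fin m) (Fin n) ℝ) :
    (Kᵀ * M * K).trace ≤ ‖M‖ * (m * ‖K‖ ^ 2) := by
  have h1 : (Kᵀ * M * K).trace ≤ ‖M‖ * (Kᵀ * (1 : Matrix (Fin m) (Fin m) ℝ) * K).trace := by
    rw [trace_eq_sum_quad, trace_eq_sum_quad, Finset.mul_sum]
    refine Finset.sum_le_sum fun i _ => ?_
    rw [quad_transpose_mul_mul, quad_transpose_mul_mul, quad_one]
    exact quad_le_norm _ _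
  have h2 : (Kᵀ * (1 : Matrix (Fin m) (Fin m) ℝ) * K).trace ≤ m * ‖K‖ ^ 2 := by
    have e : (Kᵀ * (1 : Matrix (Fin m) (Fin m) ℝ) * K).trace =
        (Kᵀᵀ * (1 : Matrix (Fin n) (Fin n) ℝ) * Kᵀ).trace := by
      rw [Matrix.mul_one, Matrix.trace_mul_comm, Matrix.transpose_transpose, Matrix.mul_one]
    rw [e, trace_eq_sum_quad]
    calc _ ≤ ∑ _i : Fin m, ‖K‖ ^ 2 := by
          refine Finset.sum_le_sum fun i _ => ?_
          rw [quad_transpose_mul_mul, quad_one]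
          refine (dot_mulVec_self_le _ _).trans ?_
          rw [norm_transpose]
          simp
      _ = _ := by simp
  exact h1.trans (mul_le_mul_of_nonneg_left h2 (norm_nonneg M))

lemma exists_eq_transpose_mul_self {M : Matrix (Fin m) (Fin m) ℝ} (hM : M.PosSemidef) :
    ∃ N : Matrix (Fin m) (Fin m) ℝ, M = Nᵀ * N := by
  obtain ⟨N, hN⟩ := CStarAlgebra.nonneg_iff_eq_star_mul_self.mp
    (Matrix.nonneg_iff_posSemidef.mpr hM)
  exact ⟨N, hN⟩

lemma summable_conj {L : Matrix (Fin n) (Fin n) ℝ} {C r : ℝ} (hr0 : 0 ≤ r) (hr1 : r < 1)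
    (h : ∀ t : ℕ, ‖L ^ t‖ ^ 2 ≤ C * r ^ t) (D : Matrix (Fin n) (Fin n) ℝ) :
    Summable fun t : ℕ => (L ^ t)ᵀ * D * L ^ t := by
  refine Summable.of_norm_bounded (g := fun t => ‖D‖ * (C * r ^ t))
    (((summable_geometric_of_lt_one hr0 hr1).mul_left C).mul_left ‖D‖) fun t => ?_
  refine (norm_mul_le _ _).trans ?_
  have h1 : ‖(L ^ t)ᵀ * D‖ ≤ ‖L ^ t‖ * ‖D‖ := (norm_mul_le _ _).trans_eq (by rw [norm_transpose])
  calc _ ≤ ‖L ^ t‖ * ‖D‖ * ‖L ^ t‖ := mul_le_mul_of_nonneg_right h1 (norm_nonneg _)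
    _ = ‖D‖ * ‖L ^ t‖ ^ 2 := by ring
    _ ≤ _ := mul_le_mul_of_nonneg_left (h t) (norm_nonneg _)

lemma summable_gramian {L : Matrix (Fin n) (Fin n) ℝ} {C r : ℝ} (hr0 : 0 ≤ r) (hr1 : r < 1)
    (h : ∀ t : ℕ, ‖L ^ t‖ ^ 2 ≤ C * r ^ t) :
    Summable fun t : ℕ => L ^ t * (L ^ t)ᵀ := by
  refine Summable.of_norm_bounded (g := fun t => C * r ^ t)
    ((summable_geometric_of_lt_one hr0 hr1).mul_left C) fun t => ?_
  refine (norm_mul_le _ _).trans ?_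
  rw [norm_transpose, ← sq]
  exact h t

lemma eq_of_quad {P P' : Matrix (Fin n) (Fin n) ℝ} (hP : P.IsHermitian) (hP' : P'.IsHermitian)
    (h : ∀ x, quad P x = quad P' x) : P = P' :=
  le_antisymm (le_of_quad hP hP' fun x => (h x).le) (le_of_quad hP' hP fun x => (h x).ge)

/-- The Lyapunov solution of any stabilising gain, relative to the nominal value. -/
lemma exists_lyapunov_solution (hQ : Q.PosSemidef) (hR : R.PosDef)
    {Pst : Matrix (Fin n) (Fin n) ℝ} (hPst : IsNominalValue A B Q R Pst)
    {F : Matrix (Fin m) (Fin n) ℝ} {C r : ℝ} (hr0 : 0 ≤ r) (hr1 : r < 1)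
    (h : ∀ t : ℕ, ‖(A + B * F) ^ t‖ ^ 2 ≤ C * r ^ t) :
    ∃ M : Matrix (Fin n) (Fin n) ℝ, M.PosSemidef ∧
      M = Q + Fᵀ * R * F + (A + B * F)ᵀ * M * (A + B * F) ∧
      M.trace - Pst.trace ≤ ‖gramianInf (A + B * F) (1 : Matrix (Fin n) (Fin n) ℝ)‖ *
        (‖R + Bᵀ * Pst * B‖ * (m * ‖F - nominalGain A B R Pst‖ ^ 2)) := by
  obtain ⟨hP, hfix⟩ := hPst
  have hfix' : ric A B Q R Pst = Pst := hfix
  set L := A + B * F with hL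
  set M₀ := R + Bᵀ * Pst * B with hM₀
  have hM₀p := posDef_input_weight (B := B) hR hP
  set Δ := F - nominalGain A B R Pst with hΔ
  set D := Δᵀ * M₀ * Δ with hD
  have hDp : D.PosSemidef := posSemidef_transpose_mul_mul hM₀p.posSemidef Δ
  -- Completing the square shows that `P_⋆` solves the Lyapunov equation of `F` up to the excess
  -- `D`, which is quadratic in the gain error. Accumulating `D` along the loop gives the correction
  -- `Y`.
  have hbell : Q + Fᵀ * R * F + Lᵀ * Pst * L = Pst + D := by
    refine eq_of_quad ((hQ.1.add (isHermitian_transpose_mul_mul hR.1 F)).add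
      (isHermitian_transpose_mul_mul hP.1 L)) (hP.1.add hDp.1) fun x => ?_
    have h1 := stageCost_add_quad (A := A) (B := B) (Q := Q) hR hP x (F *ᵥ x)
    rw [hfix', Matrix.mulVec_mulVec, ← Matrix.add_mulVec, ← Matrix.sub_mulVec] at h1
    rw [quad_add_matrix _ (Lᵀ * Pst * L), quad_transpose_mul_mul _ L, ← stageCost_feedback,
      quad_add_matrix Pst, hD, quad_transpose_mul_mul _ Δ]
    exact h1
  have hsum := summable_conj hr0 hr1 h D
  set f : ℕ → Matrix (Fin n) (Fin n) ℝ := fun t => (L ^ t)ᵀ * D * L ^ t with hf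
  set Y := ∑' t, f t with hY
  have hfsucc : ∀ t, f (t + 1) = Lᵀ * f t * L := fun t => by
    simp only [hf, pow_succ, Matrix.transpose_mul, Matrix.mul_assoc]
  have hYfix : Y = D + Lᵀ * Y * L := by
    have h0 : Y = f 0 + ∑' t, f (t + 1) := hsum.tsum_eq_zero_add
    simp only [hfsucc] at h0
    rw [(hsum.mul_left Lᵀ).tsum_mul_right, hsum.tsum_mul_left] at h0
    have hf0 : f 0 = D := by simp [hf]
    rwa [hf0] at h0
  have hYp : Y.PosSemidef := by
    refine isClosed_posSemidef.mem_of_tendsto hsum.hasSum.tendsto_sum_nat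
      (Eventually.of_forall fun N => ?_)
    exact Matrix.posSemidef_sum _ fun t _ => posSemidef_transpose_mul_mul hDp _
  refine ⟨Pst + Y, hP.add hYp, ?_, ?_⟩
  · rw [Matrix.mul_add Lᵀ Pst Y, Matrix.add_mul _ _ L, ← add_assoc, hbell, add_assoc, ← hYfix]
  · have htr : Y.trace = (D * gramianInf L (1 : Matrix (Fin n) (Fin n) ℝ)).trace := by
      have h1 : HasSum (fun t => (f t).trace) Y.trace :=
        hsum.hasSum.map (Matrix.traceAddMonoidHom (Fin n) ℝ)
          (Continuous.matrix_trace continuous_id)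
      have h2 : HasSum (fun t => (D * (L ^ t * (L ^ t)ᵀ)).trace) (D * gramianInf L (1 : Matrix (Fin n) (Fin n) ℝ)).trace := by
        have h3 : gramianInf L (1 : Matrix (Fin n) (Fin n) ℝ) = ∑' t : ℕ, L ^ t * (L ^ t)ᵀ := by simp [gramianInf]
        rw [h3]
        exact ((summable_gramian hr0 hr1 h).hasSum.mul_left D).map
          (Matrix.traceAddMonoidHom (Fin n) ℝ) (Continuous.matrix_trace continuous_id)
      have e : (fun t => (f t).trace) = fun t => (D * (L ^ t * (L ^ t)ᵀ)).trace := by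
        funext t
        change ((L ^ t)ᵀ * D * L ^ t).trace = _
        rw [Matrix.mul_assoc (L ^ t)ᵀ D, Matrix.trace_mul_comm (L ^ t)ᵀ, Matrix.mul_assoc D]
      exact (e ▸ h1).unique h2
    obtain ⟨N, hN⟩ := exists_eq_transpose_mul_self hM₀p.posSemidef
    have hDN : D = (N * Δ)ᵀ * (N * Δ) := by
      rw [hD, hM₀, hN, Matrix.transpose_mul]
      simp only [Matrix.mul_assoc]
    rw [Matrix.trace_add, add_sub_cancel_left, htr]
    calc (D * gramianInf L (1 : Matrix (Fin n) (Fin n) ℝ)).trace ≤ ‖gramianInf L (1 : Matrix (Fin n) (Fin n) ℝ)‖ * D.trace := by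
          rw [hDN]; exact trace_mul_le _ _
      _ ≤ _ := mul_le_mul_of_nonneg_left (trace_transpose_mul_mul_le M₀ Δ) (norm_nonneg _)

/-- Lipschitz dependence of the gain on the value matrix. -/
lemma norm_gain_sub_le (hR : R.PosDef) {Y Pst : Matrix (Fin n) (Fin n) ℝ}
    (hY : Y.PosSemidef) (hPst : Pst.PosSemidef) (hle : ∀ x, quad Pst x ≤ quad Y x)
    (hσ : 0 < sigmaMin (R + Bᵀ * Pst * B)) :
    ‖nominalGain A B R Y - nominalGain A B R Pst‖ ≤
      ‖B‖ * ‖Y - Pst‖ * ‖A + B * nominalGain A B R Pst‖ / sigmaMin (R + Bᵀ * Pst * B) := by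
  set Δ := nominalGain A B R Y - nominalGain A B R Pst
  set σ := sigmaMin (R + Bᵀ * Pst * B)
  set L := A + B * nominalGain A B R Pst
  set S := R + Bᵀ * Y * B
  refine norm_le_of_dot_le (by positivity) fun x => ?_
  have hS : S *ᵥ (Δ *ᵥ x) = -(Bᵀ * (Y - Pst) * L) *ᵥ x := by
    rw [Matrix.mulVec_mulVec, input_weight_mul_gain_sub hR hY hPst]
  -- The domination `P_⋆ ⪯ Y` lets the constant involve `R + Bᵀ P_⋆ B` rather than the inflated
  -- weight.
  have h1 : ∀ y, σ * (y ⬝ᵥ y) ≤ y ⬝ᵥ S *ᵥ y := fun y => by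
    refine (sigmaMin_mul_le_quad (posDef_input_weight (B := B) hR hPst).posSemidef y).trans ?_
    change _ ≤ quad S y
    rw [quad_add_matrix, quad_add_matrix, quad_transpose_mul_mul, quad_transpose_mul_mul]
    linarith [hle (B *ᵥ y)]
  have h2 : ‖-(Bᵀ * (Y - Pst) * L)‖ ≤ ‖B‖ * ‖Y - Pst‖ * ‖L‖ := by
    rw [norm_neg]
    refine (Matrix.l2_opNorm_mul _ _).trans (mul_le_mul_of_nonneg_right ?_ (norm_nonneg _))
    exact (Matrix.l2_opNorm_mul _ _).trans_eq (by rw [norm_transpose])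
  have h3 : (S *ᵥ (Δ *ᵥ x)) ⬝ᵥ (S *ᵥ (Δ *ᵥ x)) ≤ (‖B‖ * ‖Y - Pst‖ * ‖L‖) ^ 2 * (x ⬝ᵥ x) := by
    rw [hS]
    exact (dot_mulVec_self_le _ _).trans
      (mul_le_mul_of_nonneg_right (pow_le_pow_left₀ (norm_nonneg _) h2 2) (dot_self_nonneg x))
  set y := Δ *ᵥ x
  have h4 := dot_sq_le y (S *ᵥ y)
  have h5 : σ ^ 2 * (y ⬝ᵥ y) ≤ (S *ᵥ y) ⬝ᵥ (S *ᵥ y) := by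
    rcases eq_or_lt_of_le (dot_self_nonneg y) with h0 | h0
    · rw [← h0, mul_zero]; exact dot_self_nonneg _
    · refine le_of_mul_le_mul_left ?_ h0
      have h6 : (σ * (y ⬝ᵥ y)) ^ 2 ≤ (y ⬝ᵥ S *ᵥ y) ^ 2 :=
        pow_le_pow_left₀ (mul_nonneg hσ.le h0.le) (h1 y) 2
      calc (y ⬝ᵥ y) * (σ ^ 2 * (y ⬝ᵥ y)) = (σ * (y ⬝ᵥ y)) ^ 2 := by ring
        _ ≤ _ := h6.trans h4
  rw [div_pow, div_mul_eq_mul_div, le_div_iff₀ (pow_pos hσ 2)]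
  linarith

end PerformanceDifference

/-! ### Quantitative bounds -/

section Quantitative

variable {n m : ℕ} {A : Matrix (Fin n) (Fin n) ℝ} {B : Matrix (Fin n) (Fin m) ℝ}

/-- Evaluate the gramian at a unit vector; its `ℓ + 1 ≤ 2 ℓ` terms need `A ^ ℓ`, split as `A ^ (ℓ -
1) * A`. This upper bound later gives a lower bound on the constant in the level condition. -/
lemma sigmaMin_gramian_le [NeZero n] {ℓ : ℕ} (hℓ : 1 ≤ ℓ) {a : ℝ}
    (ha : ∀ j < ℓ, ‖A ^ j‖ ≤ a) :
    sigmaMin (gramian A B ℓ) ≤ 2 * ℓ * (a * ((‖B‖ + 1) * max ‖A‖ ‖B‖)) ^ 2 := by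
  have ha0 : 0 ≤ a := (norm_nonneg _).trans (ha 0 hℓ)
  set e : Fin n → ℝ := Pi.single 0 1
  have he : e ⬝ᵥ e = 1 := by simp [e]
  have h1 := sigmaMin_mul_le_quad (gramian_posSemidef (A := A) (B := B) ℓ) e
  rw [he, mul_one, quad_gramian] at h1
  have hpow : ∀ t ∈ Finset.range (ℓ + 1), ‖A ^ t‖ * ‖B‖ ≤ a * ((‖B‖ + 1) * max ‖A‖ ‖B‖) := by
    intro t ht
    have hB := norm_nonneg B
    have hA := norm_nonneg A
    have hMB : ‖B‖ ≤ max ‖A‖ ‖B‖ := le_max_right _ _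
    have hMA : ‖A‖ ≤ max ‖A‖ ‖B‖ := le_max_left _ _
    rcases Nat.lt_or_ge t ℓ with h | h
    · refine mul_le_mul (ha t h) ?_ hB ha0
      nlinarith
    · have ht' : t = ℓ - 1 + 1 := by have := Finset.mem_range.mp ht; omega
      have h2 : ‖A ^ t‖ ≤ a * ‖A‖ := by
        rw [ht', pow_succ]
        exact (norm_mul_le _ _).trans
          (mul_le_mul_of_nonneg_right (ha _ (by omega)) (norm_nonneg _))
      calc ‖A ^ t‖ * ‖B‖ ≤ a * ‖A‖ * ‖B‖ := mul_le_mul_of_nonneg_right h2 hB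
        _ = a * (‖A‖ * ‖B‖) := by ring
        _ ≤ _ := mul_le_mul_of_nonneg_left (by nlinarith) ha0
  refine h1.trans ((Finset.sum_le_sum (g := fun _ => (a * ((‖B‖ + 1) * max ‖A‖ ‖B‖)) ^ 2)
    fun t ht => ?_).trans ?_)
  · refine (dot_mulVec_self_le _ _).trans ?_
    rw [he, mul_one, norm_transpose]
    exact pow_le_pow_left₀ (norm_nonneg _) ((Matrix.l2_opNorm_mul _ _).trans (hpow t ht)) 2
  · rw [Finset.sum_const, Finset.card_range, nsmul_eq_mul]
    refine mul_le_mul_of_nonneg_right ?_ (sq_nonneg _)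
    have : (1 : ℝ) ≤ ℓ := by exact_mod_cast hℓ
    push_cast
    linarith

/-- Since `ℓ + 2 ≤ 3 ℓ`, the power is at most `exp y` with `y = 3 ε ℓ ≤ 3`. Then `exp 3 ≤ 21` and
`exp y - 1 ≤ y exp y ≤ 21 * 3 ε ℓ`. -/
lemma one_add_pow_bounds {ℓ : ℕ} (hℓ : 1 ≤ ℓ) {ε : ℝ} (hε : 0 < ε) (hεl : ε * ℓ ≤ 1) :
    (1 + ε) ^ (ℓ + 2) ≤ 21 ∧ (1 + ε) ^ (ℓ + 2) - 1 ≤ 63 * (ε * ℓ) := by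
  have hl : (1 : ℝ) ≤ ℓ := by exact_mod_cast hℓ
  obtain ⟨y, hy⟩ : ∃ y : ℝ, y = 3 * (ε * ℓ) := ⟨_, rfl⟩
  have hE : (1 + ε) ^ (ℓ + 2) ≤ Real.exp y := by
    calc (1 + ε) ^ (ℓ + 2) ≤ Real.exp ε ^ (ℓ + 2) := by
          refine pow_le_pow_left₀ (by linarith) ?_ _
          linarith [Real.add_one_le_exp ε]
      _ = Real.exp ((ℓ + 2 : ℕ) * ε) := (Real.exp_nat_mul _ _).symm
      _ ≤ _ := by
          refine Real.exp_le_exp.mpr ?_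
          push_cast
          rw [hy]
          nlinarith
  have hexp3 : Real.exp y ≤ 21 := by
    calc _ ≤ Real.exp ((3 : ℕ) * 1) := Real.exp_le_exp.mpr (by push_cast; linarith)
      _ = Real.exp 1 ^ 3 := Real.exp_nat_mul _ _
      _ ≤ 2.7182818286 ^ 3 := pow_le_pow_left₀ (Real.exp_pos _).le Real.exp_one_lt_d9.le 3
      _ ≤ 21 := by norm_num
  refine ⟨hE.trans hexp3, ?_⟩
  have hy0 : 0 ≤ y := by rw [hy]; positivity
  have h1 : Real.exp y * (1 - y) ≤ 1 := by
    calc _ ≤ Real.exp y * Real.exp (-y) :=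
          mul_le_mul_of_nonneg_left (by linarith [Real.add_one_le_exp (-y)]) (Real.exp_pos _).le
      _ = 1 := by rw [← Real.exp_add, add_neg_cancel, Real.exp_zero]
  nlinarith [mul_le_mul_of_nonneg_right hexp3 hy0]

/-- The constant: `63 * 3/2` from `E - 1` plus `21 * (2 * 3 + 6)` from the square is `346.5`. -/
lemma inflated_product_le {E g ε l G κ : ℝ} (hE21 : E ≤ 21)
    (hE1 : E - 1 ≤ 63 * (ε * l)) (hg0 : 0 ≤ g) (hgG : g ≤ 3 * (ε * G))
    (hg2 : g ^ 2 ≤ 6 * (ε * G)) (hεG : 0 ≤ ε * G) (hlG : ε * l ≤ 3 / 2 * (ε * G)) (hκ : 1 ≤ κ) :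
    E * (1 + √κ * g) ^ 2 - 1 ≤ 350 * (ε * G * κ) := by
  have hκr : √κ ≤ κ := by
    rw [Real.sqrt_le_left (by linarith)]; nlinarith
  have hκs : √κ ^ 2 = κ := Real.sq_sqrt (by linarith)
  have hfin : E * (1 + √κ * g) ^ 2 - 1 = (E - 1) + E * (2 * (√κ * g) + κ * g ^ 2) := by
    calc _ = (E - 1) + E * (2 * (√κ * g) + √κ ^ 2 * g ^ 2) := by ring
      _ = _ := by rw [hκs]
  have h1 : √κ * g ≤ κ * (3 * (ε * G)) := mul_le_mul hκr hgG hg0 (by linarith)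
  have h2 : κ * g ^ 2 ≤ κ * (6 * (ε * G)) := mul_le_mul_of_nonneg_left hg2 (by linarith)
  have h3 : E * (2 * (√κ * g) + κ * g ^ 2) ≤ 21 * (2 * (κ * (3 * (ε * G))) + κ * (6 * (ε * G))) :=
    mul_le_mul hE21 (by linarith) (by positivity) (by norm_num)
  have h5 : ε * G ≤ ε * G * κ := le_mul_of_one_le_right hεG hκ
  rw [hfin]
  linarith

/-- The gramian bound `hW` gives `Y² ≥ l² / 2`, and `3/2` exceeds `√2`. Thus smallness of `ε Y`
forces smallness of `ε l`. -/
lemma scalar_le_of_norm_bound {l b i τ β M Y : ℝ} (hl : 1 ≤ l) (hb : 1 ≤ b) (hi : 0 < i)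
    (hτ : 1 ≤ τ) (hβ : 1 ≤ β) (hM : 0 ≤ M) (hY : Y = l * √l * b * i * τ ^ 2 * β * M)
    (hW : 1 ≤ i ^ 2 * (2 * l * (τ * b * (β * M)) ^ 2)) : l ≤ 3 / 2 * Y := by
  have hY0 : 0 ≤ Y := by rw [hY]; positivity
  have hr : √l ^ 2 = l := Real.sq_sqrt (by linarith)
  refine le_of_sq_le_sq ?_ (by positivity)
  have h1 : Y ^ 2 = l ^ 2 * τ ^ 2 / 2 * (i ^ 2 * (2 * l * (τ * b * (β * M)) ^ 2)) := by
    rw [hY]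
    calc _ = l ^ 2 * √l ^ 2 * b ^ 2 * i ^ 2 * τ ^ 4 * β ^ 2 * M ^ 2 := by ring
      _ = _ := by rw [hr]; ring
  have h2 : l ^ 2 / 2 ≤ l ^ 2 * τ ^ 2 / 2 := by
    have : 1 ≤ τ ^ 2 := one_le_pow₀ hτ
    linarith [le_mul_of_one_le_right (sq_nonneg l) this]
  have h3 : l ^ 2 * τ ^ 2 / 2 ≤ Y ^ 2 := by
    rw [h1]; exact le_mul_of_one_le_right (by positivity) hW
  linarith [mul_pow (3 / 2) Y 2, sq_nonneg l]

/-- The scalar estimate behind the perturbation bound. -/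
lemma inflation_le {ℓ : ℕ} (hℓ : 1 ≤ ℓ) {ε b i τ β M κ : ℝ} (hε : 0 < ε) (hb : 1 ≤ b)
    (hi : 0 < i) (hτ : 1 ≤ τ) (hβ : 1 ≤ β) (hM : 0 ≤ M) (hκ : 1 ≤ κ)
    (hcond : ε * (ℓ * √ℓ * b * i * τ ^ 2 * β * M) ≤ 2 / 3)
    (hW : 1 ≤ i ^ 2 * (2 * ℓ * (τ * b * (β * M)) ^ 2)) :
    (1 + ε) ^ (ℓ + 2) * (1 + √κ * (3 * M * ℓ ^ 2 * τ * b * β * ε * i)) ^ 2 - 1 ≤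
      350 * (ε * (ℓ ^ 2 * √ℓ * b ^ 2 * (1 + i) * τ ^ 3 * β ^ 2 * M) * κ) := by
  have hl : (1 : ℝ) ≤ ℓ := by exact_mod_cast hℓ
  have hrr : √(ℓ : ℝ) * √(ℓ : ℝ) = ℓ := Real.mul_self_sqrt (by linarith)
  have hr1 : 1 ≤ √(ℓ : ℝ) := Real.one_le_sqrt.mpr hl
  obtain ⟨Y, hY⟩ : ∃ Y : ℝ, Y = ℓ * √ℓ * b * i * τ ^ 2 * β * M := ⟨_, rfl⟩
  have hlY := scalar_le_of_norm_bound hl hb hi hτ hβ hM hY hW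
  rw [← hY] at hcond
  have hεl : ε * ℓ ≤ 1 := by linarith [mul_le_mul_of_nonneg_left hlY hε.le]
  obtain ⟨hE21, hE1⟩ := one_add_pow_bounds hℓ hε hεl
  generalize √(ℓ : ℝ) = r at *
  generalize (1 + ε) ^ (ℓ + 2) = E at *
  generalize (ℓ : ℝ) = l at *
  -- `Y` is the quantity of the smallness condition, `G` that of the target, `g` the deviation size
  -- without `√κ`. Both `Y` and `Z` are at most `G`, and `τ g² = 9 (ε Y) (ε Z)`; since `ε Y ≤ 2/3`,
  -- even the square of `g` is linear in `ε G`.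
  obtain ⟨G, hG⟩ : ∃ G : ℝ, G = l ^ 2 * r * b ^ 2 * (1 + i) * τ ^ 3 * β ^ 2 * M := ⟨_, rfl⟩
  obtain ⟨Z, hZ⟩ : ∃ Z : ℝ, Z = M * l ^ 2 * r * b * β * i * τ := ⟨_, rfl⟩
  obtain ⟨g, hg⟩ : ∃ g : ℝ, g = 3 * M * l ^ 2 * τ * b * β * ε * i := ⟨_, rfl⟩
  have hY0 : 0 ≤ Y := by rw [hY]; positivity
  have hZ0 : 0 ≤ Z := by rw [hZ]; positivity
  have hg0 : 0 ≤ g := by rw [hg]; positivity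
  have hG0 : 0 ≤ G := by rw [hG]; positivity
  rw [← hG, ← hg]
  have hYG : Y ≤ G := by
    have e : G = Y * (l * b * τ * β) * ((1 + i) / i) := by
      rw [hG, hY]; field_simp
    have h1 : 1 ≤ l * b * τ * β := one_le_mul_of_one_le_of_one_le (one_le_mul_of_one_le_of_one_le
        (one_le_mul_of_one_le_of_one_le hl hb) hτ) hβ
    have h2 : 1 ≤ (1 + i) / i := by rw [le_div_iff₀ hi]; linarith
    rw [e]
    calc Y = Y * 1 * 1 := by ring
      _ ≤ _ := mul_le_mul (mul_le_mul_of_nonneg_left h1 hY0) h2 zero_le_one (by positivity)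
  have hZG : Z ≤ G := by
    have h1 : b ≤ b ^ 2 := le_self_pow₀ hb (by norm_num)
    have h2 : β ≤ β ^ 2 := le_self_pow₀ hβ (by norm_num)
    have h3 : τ ≤ τ ^ 3 := le_self_pow₀ hτ (by norm_num)
    have h4 : i ≤ 1 + i := by linarith
    calc Z = l ^ 2 * r * b * i * τ * β * M := by rw [hZ]; ring
      _ ≤ G := by rw [hG]; gcongr
  have hεZG : ε * Z ≤ ε * G := mul_le_mul_of_nonneg_left hZG hε.le
  have hεYG : ε * Y ≤ ε * G := mul_le_mul_of_nonneg_left hYG hε.le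
  have hgG : g ≤ 3 * (ε * G) := by
    have h1 : g ≤ 3 * (ε * Z) := by
      have : 3 * (ε * Z) = g * r := by rw [hZ, hg]; ring
      rw [this]; exact le_mul_of_one_le_right hg0 hr1
    linarith
  have hg2 : g ^ 2 ≤ 6 * (ε * G) := by
    have h1 : τ * g ^ 2 = 9 * (ε * Y) * (ε * Z) := by
      rw [hg, hY, hZ]
      calc _ = 9 * M ^ 2 * l ^ 3 * l * τ ^ 3 * b ^ 2 * β ^ 2 * ε ^ 2 * i ^ 2 := by ring
        _ = 9 * M ^ 2 * l ^ 3 * (r * r) * τ ^ 3 * b ^ 2 * β ^ 2 * ε ^ 2 * i ^ 2 := by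
          rw [hrr]
        _ = _ := by ring
    have h2 : g ^ 2 ≤ τ * g ^ 2 := le_mul_of_one_le_left (sq_nonneg g) hτ
    have h3 : 9 * (ε * Y) * (ε * Z) ≤ 6 * (ε * Z) :=
      mul_le_mul_of_nonneg_right (by linarith) (by positivity)
    linarith
  exact inflated_product_le hE21 hE1 hg0 hgG hg2 (by positivity)
    (by linarith [mul_le_mul_of_nonneg_left hlY hε.le]) hκ

end Quantitative

/-! ### The perturbation bound -/

section Perturbation

variable {n m : ℕ} {A : Matrix (Fin n) (Fin n) ℝ} {B : Matrix (Fin n) (Fin m) ℝ}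
  {Q : Matrix (Fin n) (Fin n) ℝ} {R : Matrix (Fin m) (Fin m) ℝ}

lemma neZero_of_gramian_pos [NeZero n] {ℓ : ℕ} (hW : 0 < sigmaMin (gramian A B ℓ)) :
    NeZero m := by
  refine ⟨fun hm => ?_⟩
  subst hm
  have h1 := sigmaMin_mul_le_quad (gramian_posSemidef (A := A) (B := B) ℓ) (Pi.single 0 1)
  rw [quad_gramian] at h1
  simp at h1
  linarith

lemma IsRobustSolution.ric_adv (hR : R.PosDef) {γ : ℝ} {P : Matrix (Fin n) (Fin n) ℝ}
    (h : IsRobustSolution A B Q R γ P) : ric A B Q R (adv γ P) = P :=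
  ((isRobustSolution_iff hR).mp h).2.2

lemma IsRobustSolution.nominal_le (hQ : Q.PosSemidef) (hR : R.PosDef) (hQ0 : 0 < sigmaMin Q)
    {Pst P : Matrix (Fin n) (Fin n) ℝ} (hPst : IsNominalValue A B Q R Pst) {γ : ℝ}
    (h : IsRobustSolution A B Q R γ P) (x : Fin n → ℝ) : quad Pst x ≤ quad P x :=
  nominal_le_of_super hQ hR hQ0 hPst.1 hPst.2 h.1 (adv_posSemidef h.1 h.2.1)
    (quad_le_quad_adv h.1 h.2.1) (h.ric_adv hR) x

/-- If `γ_∞` were `0`, the robust value would be at most `0`; but it dominates `P_⋆ ⪰ Q ≻ 0`. -/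
lemma gammaInf_pos [NeZero n] (hQ : Q.PosSemidef) (hR : R.PosDef) (hQ0 : 0 < sigmaMin Q)
    {Pst : Matrix (Fin n) (Fin n) ℝ} (hPst : IsNominalValue A B Q R Pst) :
    0 < gammaInf A B Q R := by
  obtain ⟨P, hP, hle⟩ := exists_isRobustValue hQ hR hQ0 hPst (lt_add_one (gammaInf A B Q R))
  refine lt_of_le_of_ne gammaInf_nonneg fun h0 => ?_
  set e : Fin n → ℝ := Pi.single 0 1
  have he : e ⬝ᵥ e = 1 := by simp [e]
  have h1 := hle e
  have h2 := hP.1.nominal_le hQ hR hQ0 hPst e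
  have h3 := quad_eq_of_ric_fixed hR hPst.1 hPst.2 e
  have h4 := sigmaMin_mul_le_stageCost hQ hR.posSemidef e (nominalGain A B R Pst *ᵥ e)
  have h5 := quad_nonneg hPst.1 ((A + B * nominalGain A B R Pst) *ᵥ e)
  rw [← h0, he] at h1
  rw [he] at h4
  linarith

/-- Justifies the choice of `η` in `norm_adv_sub_le`, with `β` standing for `‖B‖`. From `N ≤ 2 l`
the left side carries `2 * 4 = 8`, within `9 = 3²`. -/
lemma expansion_le {l N a β M ε s i mx mn κ : ℝ} (hl : 1 ≤ l) (hN : N = l + 1) (ha : 1 ≤ a)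
    (hβ : 0 ≤ β) (hi : i ^ 2 = 1 / s) (hκ : κ = mx / mn) (hκ0 : 0 ≤ κ) :
    mx * ((1 + (l * a * β) ^ 2) / s * ((N * ε) ^ 2 * (2 * M ^ 2 / mn))) ≤
      (√κ * (3 * M * l ^ 2 * a * (β + 1) * ε * i)) ^ 2 := by
  have hκs : √κ ^ 2 = κ := Real.sq_sqrt hκ0
  have e1 : mx * ((1 + (l * a * β) ^ 2) / s * ((N * ε) ^ 2 * (2 * M ^ 2 / mn))) =
      κ * M ^ 2 * ε ^ 2 * i ^ 2 * (2 * ((1 + (l * a * β) ^ 2) * N ^ 2)) := by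
    rw [hκ, hi]; ring
  have e2 : (√κ * (3 * M * l ^ 2 * a * (β + 1) * ε * i)) ^ 2 =
      κ * M ^ 2 * ε ^ 2 * i ^ 2 * (9 * (l ^ 4 * a ^ 2 * (β + 1) ^ 2)) := by
    rw [mul_pow, hκs]; ring
  rw [e1, e2]
  refine mul_le_mul_of_nonneg_left ?_ (by positivity)
  have hla : 1 ≤ (l * a) ^ 2 := one_le_pow₀ (one_le_mul_of_one_le_of_one_le hl ha)
  have h1 : 1 + (l * a * β) ^ 2 ≤ (l * a) ^ 2 * (β + 1) ^ 2 := by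
    have : 0 ≤ (l * a) ^ 2 * β := by positivity
    linarith [mul_pow (l * a) β 2]
  have h2 : N ^ 2 ≤ 4 * l ^ 2 := by rw [hN]; nlinarith
  have h3 := mul_le_mul h1 h2 (sq_nonneg N) (by positivity)
  have h4 : 0 ≤ l ^ 4 * a ^ 2 * (β + 1) ^ 2 := by positivity
  linarith

/-- Distance between the adversarially inflated robust value and the nominal value. -/
lemma norm_adv_sub_le [NeZero n] [NeZero m] (hQ : Q.PosSemidef) (hR : R.PosDef)
    (hQ0 : 0 < sigmaMin Q) {Pst P : Matrix (Fin n) (Fin n) ℝ}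
    (hPst : IsNominalValue A B Q R Pst) {γ : ℝ} (hP : IsRobustSolution A B Q R γ P)
    {g : ℝ} (hg0 : 0 < g) (hg : g < γ ^ 2) (hPg : ∀ x, quad P x ≤ g * (x ⬝ᵥ x))
    {ℓ : ℕ} (hℓ : 1 ≤ ℓ) (hW : 0 < sigmaMin (gramian A B ℓ)) {b i τ : ℝ} (hb : 1 ≤ b)
    (hτ : 1 ≤ τ) (hA : ∀ j < ℓ, ‖A ^ j‖ ≤ τ * b) (hi0 : 0 < i)
    (hi : i ^ 2 = 1 / sigmaMin (gramian A B ℓ))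
    (hcond : g / (γ ^ 2 - g) *
      (ℓ * √ℓ * b * i * τ ^ 2 * (‖B‖ + 1) * max ‖A‖ ‖B‖) ≤ 2 / 3) :
    ‖adv γ P - Pst‖ ≤ 350 * (g / (γ ^ 2 - g) * (ℓ ^ 2 * √ℓ * b ^ 2 * (1 + i) * τ ^ 3 *
      (‖B‖ + 1) ^ 2 * max ‖A‖ ‖B‖) * kappa Q R) * ‖Pst‖ := by
  have hR0 : 0 < sigmaMin R := sigmaMin_pos_of_posDef hR
  have hmn : 0 < min (sigmaMin Q) (sigmaMin R) := lt_min hQ0 hR0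
  have hκ : 1 ≤ kappa Q R := by
    rw [kappa, one_le_div hmn]
    exact ((min_le_left _ _).trans (sigmaMin_le_norm Q)).trans (le_max_left _ _)
  have hadv := adv_posSemidef hP.1 hP.2.1
  have hric := hP.ric_adv hR
  have hM0 : 0 ≤ max ‖A‖ ‖B‖ := (norm_nonneg A).trans (le_max_left _ _)
  have hinfl := quad_adv_le hP.1 hg0 hg hPg
  have hε : 0 < g / (γ ^ 2 - g) := div_pos hg0 (sub_pos.mpr hg)
  set ε := g / (γ ^ 2 - g) with hεdef
  have hV : ∀ x u, quad P x ≤ stageCost Q R x u + (1 + ε) * quad P (A *ᵥ x + B *ᵥ u) :=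
    fun x u => by
      have h1 := quad_ric_le (A := A) (B := B) (Q := Q) hR hadv x u
      rw [hric] at h1
      linarith [hinfl (A *ᵥ x + B *ᵥ u)]
  have hWle := sigmaMin_gramian_le (B := B) hℓ hA
  have hWi : 1 ≤ i ^ 2 * (2 * ℓ * (τ * b * ((‖B‖ + 1) * max ‖A‖ ‖B‖)) ^ 2) := by
    rw [hi, one_div, ← div_eq_inv_mul, one_le_div hW]
    exact hWle
  have hl : (1 : ℝ) ≤ ℓ := by exact_mod_cast hℓ
  have hMpos : 0 < max ‖A‖ ‖B‖ := by
    refine lt_of_le_of_ne hM0 fun h => ?_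
    rw [← h] at hWi
    norm_num at hWi
  have hβ : 1 ≤ ‖B‖ + 1 := by linarith [norm_nonneg B]
  have hbound := inflation_le hℓ hε hb hi0 hτ hβ hM0 hκ hcond hWi
  set η := √(kappa Q R) * (3 * max ‖A‖ ‖B‖ * ℓ ^ 2 * τ * b * (‖B‖ + 1) * ε * i) with hη
  have hη0 : 0 < η := by
    have : 0 < √(kappa Q R) := Real.sqrt_pos.mpr (by linarith)
    positivity
  have hηle := expansion_le (l := ℓ) (N := ((ℓ + 1 : ℕ) : ℝ)) (a := τ * b) (β := ‖B‖)
    (M := max ‖A‖ ‖B‖) (ε := ε) hl (by push_cast; ring) (one_le_mul_of_one_le_of_one_le hτ hb)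
    (norm_nonneg B) hi (rfl : kappa Q R = _) (by linarith)
  have hηeq : √(kappa Q R) * (3 * max ‖A‖ ‖B‖ * ℓ ^ 2 * (τ * b) * (‖B‖ + 1) * ε * i) = η := by
    rw [hη]; ring
  rw [hηeq] at hηle
  have hval := value_le_of_expansion hQ hR hQ0 hR0 hPst.1 hPst.2 hP.1 hε.le hV hW hA hη0 hηle
  have hle : ∀ x, quad Pst x ≤ quad (adv γ P) x := fun x =>
    (hP.nominal_le hQ hR hQ0 hPst x).trans (quad_le_quad_adv hP.1 hP.2.1 x)
  have hsub : (adv γ P - Pst).PosSemidef :=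
    posSemidef_of_quad (hadv.1.sub hPst.1.1) fun x => by
      rw [quad_sub_matrix]; linarith [hle x]
  refine norm_le_norm_of_quad_le hsub (by positivity) fun x => ?_
  rw [quad_sub_matrix]
  -- Passing from `P` to `adv γ P` costs one more factor `1 + ε`, hence the exponent `ℓ + 2`.
  have h1 := mul_le_mul_of_nonneg_left (hval x) (by linarith : 0 ≤ 1 + ε)
  have h2 := mul_le_mul_of_nonneg_right hbound (quad_nonneg hPst.1 x)
  have h3 : (1 + ε) * ((1 + ε) ^ (ℓ + 1) * (1 + η) ^ 2 * quad Pst x) =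
      (1 + ε) ^ (ℓ + 2) * (1 + η) ^ 2 * quad Pst x := by ring
  linarith [hinfl x]

lemma level_bounds {g γ K : ℝ} (hg0 : 0 < g) (hγ0 : 0 < γ) (hK : 0 < K)
    (h : γ ^ 2 ≥ g ^ 2 + 3 / 2 * K * g ^ 2) :
    g < γ ∧ g ^ 2 / (γ ^ 2 - g ^ 2) * K ≤ 2 / 3 := by
  have hg2 : 0 < g ^ 2 := by positivity
  have h1 : 0 < K * g ^ 2 := mul_pos hK hg2
  refine ⟨lt_of_pow_lt_pow_left₀ 2 hγ0.le (by linarith), ?_⟩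
  rw [div_mul_eq_mul_div, div_le_iff₀ (by linarith)]
  linarith

end Perturbation

/-! ### From the gain error to the cost gap. -/

section CostGap

variable {n m : ℕ} {A : Matrix (Fin n) (Fin n) ℝ} {B : Matrix (Fin n) (Fin m) ℝ}
  {Q : Matrix (Fin n) (Fin n) ℝ} {R : Matrix (Fin m) (Fin m) ℝ}

lemma IsNominalValue.lyapunov (hQ : Q.PosSemidef) (hR : R.PosDef)
    {Pst : Matrix (Fin n) (Fin n) ℝ} (hPst : IsNominalValue A B Q R Pst) :
    Pst = Q + (nominalGain A B R Pst)ᵀ * R * nominalGain A B R Pst +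
      (A + B * nominalGain A B R Pst)ᵀ * Pst * (A + B * nominalGain A B R Pst) := by
  refine eq_of_quad hPst.1.1 ((hQ.1.add (isHermitian_transpose_mul_mul hR.1 _)).add
    (isHermitian_transpose_mul_mul hPst.1.1 _)) fun x => ?_
  rw [quad_add_matrix, ← stageCost_feedback, quad_transpose_mul_mul]
  exact quad_eq_of_ric_fixed hR hPst.1 hPst.2 x

/-- The nominal cost gap of a stabilising gain is controlled by its distance to the nominal
gain. -/
lemma nominalCost_gap {Ω : Type*} [MeasurableSpace Ω] {μ : Measure Ω} [IsProbabilityMeasure μ]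
    {x₀ : Ω → Fin n → ℝ} {w : ℕ → Ω → Fin n → ℝ} (hN : IsNoise μ x₀ w) {σ : ℝ}
    (hQ : Q.PosSemidef) (hR : R.PosDef) (hQ0 : 0 < sigmaMin Q)
    {Pst : Matrix (Fin n) (Fin n) ℝ} (hPst : IsNominalValue A B Q R Pst)
    {F : Matrix (Fin m) (Fin n) ℝ} {C r : ℝ} (hr0 : 0 ≤ r) (hr1 : r < 1)
    (h : ∀ t : ℕ, ‖(A + B * F) ^ t‖ ^ 2 ≤ C * r ^ t) :
    nominalCost μ A B Q R σ x₀ w (nominalGain A B R Pst) ≠ ⊤ ∧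
    nominalCost μ A B Q R σ x₀ w F ≠ ⊤ ∧
    (nominalCost μ A B Q R σ x₀ w F).toReal -
      (nominalCost μ A B Q R σ x₀ w (nominalGain A B R Pst)).toReal ≤
      σ ^ 2 * (‖gramianInf (A + B * F) (1 : Matrix (Fin n) (Fin n) ℝ)‖ *
        (‖R + Bᵀ * Pst * B‖ * (m * ‖F - nominalGain A B R Pst‖ ^ 2))) := by
  obtain ⟨M, hM, hfix, hgap⟩ := exists_lyapunov_solution hQ hR hPst hr0 hr1 h
  rw [nominalCost_eq hN hQ hR.posSemidef hQ0 hM hfix,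
    nominalCost_eq hN hQ hR.posSemidef hQ0 hPst.1 (hPst.lyapunov hQ hR)]
  refine ⟨ENNReal.ofReal_ne_top, ENNReal.ofReal_ne_top, ?_⟩
  rw [ENNReal.toReal_ofReal (mul_nonneg (sq_nonneg σ) hM.trace_nonneg),
    ENNReal.toReal_ofReal (mul_nonneg (sq_nonneg σ) hPst.1.trace_nonneg), ← mul_sub]
  exact mul_le_mul_of_nonneg_left hgap (sq_nonneg σ)

/-- Here `122500 = 350²`, and `√l²` raises `l⁴` to `l⁵`. The summand `g` is nonnegative slack. -/
lemma gap_bound_le {σ W N k Δ β D L s ε l b i τ b' M κ p g : ℝ} (hW : 0 ≤ W) (hN : 0 ≤ N)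
    (hk : 0 ≤ k) (hΔ : 0 ≤ Δ) (hβ : 0 ≤ β) (hL : 0 ≤ L) (hs : 0 < s) (hl : 0 ≤ l)
    (hg : 0 ≤ g) (hb' : b' = b ^ 4) (hΔle : Δ ≤ β * D * L / s)
    (hD : D ≤ 350 * (ε * (l ^ 2 * √l * b ^ 2 * (1 + i) * τ ^ 3 * (β + 1) ^ 2 * M) * κ) * p) :
    σ ^ 2 * (W * (N * (k * Δ ^ 2))) ≤
      122500 * σ ^ 2 * ε ^ 2 * k * l ^ 5 * b' * (1 + i) ^ 2 * L ^ 2 * W * τ ^ 6 *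
        (N / s ^ 2) * κ ^ 2 * β ^ 2 * (β + 1) ^ 4 * (M ^ 2 * p ^ 2 + g) := by
  have hr : √l ^ 2 = l := Real.sq_sqrt hl
  have h1 : Δ ≤ β * (350 * (ε * (l ^ 2 * √l * b ^ 2 * (1 + i) * τ ^ 3 * (β + 1) ^ 2 * M) * κ) *
      p) * L / s := hΔle.trans (by gcongr)
  have h2 := pow_le_pow_left₀ hΔ h1 2
  have h3 : σ ^ 2 * (W * (N * (k * Δ ^ 2))) ≤ σ ^ 2 * (W * (N * (k * (β * (350 * (ε *
      (l ^ 2 * √l * b ^ 2 * (1 + i) * τ ^ 3 * (β + 1) ^ 2 * M) * κ) * p) * L / s) ^ 2))) := by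
    gcongr
  refine h3.trans ?_
  calc _ = 122500 * σ ^ 2 * ε ^ 2 * k * (l ^ 4 * √l ^ 2) * b ^ 4 * (1 + i) ^ 2 * L ^ 2 * W *
        τ ^ 6 * (N / s ^ 2) * κ ^ 2 * β ^ 2 * (β + 1) ^ 4 * (M ^ 2 * p ^ 2) := by
        ring
    _ = 122500 * σ ^ 2 * ε ^ 2 * k * l ^ 5 * b' * (1 + i) ^ 2 * L ^ 2 * W *
        τ ^ 6 * (N / s ^ 2) * κ ^ 2 * β ^ 2 * (β + 1) ^ 4 * (M ^ 2 * p ^ 2) := by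
        rw [hr, hb']; ring
    _ ≤ _ := by
        refine mul_le_mul_of_nonneg_left (by linarith) ?_
        rw [hb']
        positivity

end CostGap

end AdvLQR

end

theorem mainTheorem4 :
    ∃ c : ℝ, 0 < c ∧
      ∀ (n m ℓ : ℕ) (A : Matrix (Fin n) (Fin n) ℝ) (B : Matrix (Fin n) (Fin m) ℝ)
        (Q : Matrix (Fin n) (Fin n) ℝ) (R : Matrix (Fin m) (Fin m) ℝ) (σ γ ρ : ℝ),
        Q.PosSemidef → R.PosDef → 0 < σ →
        AdvLQR.IsControllable A B →
        AdvLQR.IsDetectable A (CFC.sqrt Q) →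
        1 ≤ ℓ → ℓ ≤ n →
        0 < AdvLQR.sigmaMin Q →
        0 < AdvLQR.sigmaMin (AdvLQR.gramian A B ℓ) →
        AdvLQR.specRad A < ENNReal.ofReal ρ →
        0 < γ →
        γ ^ 2 ≥ AdvLQR.gammaInf A B Q R ^ 2 +
          3 / 2 * (ℓ : ℝ) ^ (3 / 2 : ℝ) * AdvLQR.beta A B Q R γ ρ ^ (ℓ - 1) *
            AdvLQR.sigmaMin (AdvLQR.gramian A B ℓ) ^ (-(1 / 2) : ℝ) *
            AdvLQR.tau A ρ ^ 2 * (‖B‖ + 1) * max ‖A‖ ‖B‖ * AdvLQR.gammaInf A B Q R ^ 2 →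
        (∃ P, AdvLQR.IsNominalValue A B Q R P) ∧
        (∃ P, AdvLQR.IsRobustValue A B Q R γ P) ∧
        ∀ Pstar Pγ : Matrix (Fin n) (Fin n) ℝ,
          AdvLQR.IsNominalValue A B Q R Pstar →
          AdvLQR.IsRobustValue A B Q R γ Pγ →
          AdvLQR.specRad (A + B * AdvLQR.nominalGain A B R Pstar) < 1 ∧
          AdvLQR.specRad (A + B * AdvLQR.robustGain A B R γ Pγ) < 1 ∧
          ∀ {Ω : Type*} [MeasurableSpace Ω] (μ : MeasureTheory.Measure Ω)
            [MeasureTheory.IsProbabilityMeasure μ]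
            (x₀ : Ω → Fin n → ℝ) (w : ℕ → Ω → Fin n → ℝ),
            AdvLQR.IsNoise μ x₀ w →
            AdvLQR.nominalCost μ A B Q R σ x₀ w (AdvLQR.nominalGain A B R Pstar) ≠ ⊤ ∧
            AdvLQR.nominalCost μ A B Q R σ x₀ w (AdvLQR.robustGain A B R γ Pγ) ≠ ⊤ ∧
            (AdvLQR.nominalCost μ A B Q R σ x₀ w (AdvLQR.robustGain A B R γ Pγ)).toReal -
              (AdvLQR.nominalCost μ A B Q R σ x₀ w (AdvLQR.nominalGain A B R Pstar)).toReal ≤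
              c * σ ^ 2 *
                (AdvLQR.gammaInf A B Q R ^ 2 / (γ ^ 2 - AdvLQR.gammaInf A B Q R ^ 2)) ^ 2 *
                (m : ℝ) * (ℓ : ℝ) ^ 5 * AdvLQR.beta A B Q R γ ρ ^ (4 * (ℓ - 1)) *
                (1 + AdvLQR.sigmaMin (AdvLQR.gramian A B ℓ) ^ (-(1 / 2) : ℝ)) ^ 2 *
                ‖A + B * AdvLQR.nominalGain A B R Pstar‖ ^ 2 *
                ‖AdvLQR.gramianInf (A + B * AdvLQR.robustGain A B R γ Pγ)
                  (1 : Matrix (Fin n) (Fin n) ℝ)‖ *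
                AdvLQR.tau A ρ ^ 6 *
                (‖R + Bᵀ * Pstar * B‖ / AdvLQR.sigmaMin (R + Bᵀ * Pstar * B) ^ 2) *
                AdvLQR.kappa Q R ^ 2 * ‖B‖ ^ 2 * (‖B‖ + 1) ^ 4 *
                (max ‖A‖ ‖B‖ ^ 2 * ‖Pstar‖ ^ 2 + AdvLQR.gammaInf A B Q R ^ 2) := by
  open AdvLQR in
  refine ⟨122500, by norm_num, ?_⟩
  intro n m ℓ A B Q R σ γ ρ hQ hR _ _ _ hℓ hℓn hQ0 hW hρ hγ0 hγ
  have : NeZero n := ⟨by omega⟩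
  have : NeZero m := neZero_of_gramian_pos hW
  obtain ⟨P₀, hP₀⟩ := exists_isNominalValue hQ hR hW
  have hg0 : 0 < gammaInf A B Q R := gammaInf_pos hQ hR hQ0 hP₀
  have hτ : 1 ≤ tau A ρ := one_le_tau hρ
  have hβ1 : 1 ≤ beta A B Q R γ ρ := le_max_left _ _
  have hb : 1 ≤ beta A B Q R γ ρ ^ (ℓ - 1) := one_le_pow₀ hβ1
  have hM0 : 0 ≤ max ‖A‖ ‖B‖ := (norm_nonneg A).trans (le_max_left _ _)
  set i := sigmaMin (gramian A B ℓ) ^ (-(1 / 2) : ℝ) with hidef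
  have hi0 : 0 < i := Real.rpow_pos_of_pos hW _
  have hi : i ^ 2 = 1 / sigmaMin (gramian A B ℓ) := by
    rw [hidef, ← Real.rpow_natCast, ← Real.rpow_mul hW.le]
    norm_num [Real.rpow_neg_one]
  have hl0 : (0 : ℝ) < ℓ := by exact_mod_cast hℓ
  have hpow : (ℓ : ℝ) ^ (3 / 2 : ℝ) = ℓ * √ℓ := by
    rw [Real.sqrt_eq_rpow, ← Real.rpow_one_add' hl0.le (by norm_num)]
    norm_num
  rw [hpow] at hγ
  have hρ0 : 0 < ρ := ENNReal.ofReal_pos.mp (pos_of_gt hρ)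
  -- Only nonnegativity is needed to get `ρ ≤ β`; strict positivity follows later from
  -- `level_bounds`.
  have hsq : 0 ≤ γ ^ 2 - gammaInf A B Q R ^ 2 := by
    have : 0 ≤ 3 / 2 * (ℓ * √ℓ) * beta A B Q R γ ρ ^ (ℓ - 1) * i * tau A ρ ^ 2 * (‖B‖ + 1) *
      max ‖A‖ ‖B‖ * gammaInf A B Q R ^ 2 := by positivity
    linarith
  have hρβ : ρ ≤ beta A B Q R γ ρ := by
    refine le_trans ?_ (le_max_right _ _)
    have : 0 ≤ gammaInf A B Q R ^ 2 * max ‖A‖ ‖B‖ / (γ ^ 2 - gammaInf A B Q R ^ 2) *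
      tau A ρ := by positivity
    linarith
  -- The steering estimate uses powers up to `ℓ - 1` only, so `ρ ^ j ≤ β ^ (ℓ - 1)` suffices.
  have hA : ∀ j < ℓ, ‖A ^ j‖ ≤ tau A ρ * beta A B Q R γ ρ ^ (ℓ - 1) := fun j hj => by
    refine (norm_pow_le_tau hρ j).trans (mul_le_mul_of_nonneg_left ?_ (by linarith))
    exact (pow_le_pow_left₀ hρ0.le hρβ j).trans (pow_le_pow_right₀ hβ1 (by omega))
  have hMpos : 0 < max ‖A‖ ‖B‖ := by
    refine lt_of_le_of_ne hM0 fun h => ?_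
    have h1 := sigmaMin_gramian_le (B := B) hℓ hA
    rw [← h] at h1
    norm_num at h1
    linarith
  have hK : 0 < ℓ * √ℓ * beta A B Q R γ ρ ^ (ℓ - 1) * i * tau A ρ ^ 2 * (‖B‖ + 1) *
      max ‖A‖ ‖B‖ := by positivity
  obtain ⟨hgγ, hcond⟩ := level_bounds hg0 hγ0 hK (hγ.trans_eq' (by ring))
  refine ⟨⟨P₀, hP₀⟩, ?_, ?_⟩
  · obtain ⟨P, hP, -⟩ := exists_isRobustValue hQ hR hQ0 hP₀ hgγ
    exact ⟨P, hP⟩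
  intro Pst Pγ hPst hPγ
  have hadv := adv_posSemidef hPγ.1.1 hPγ.1.2.1
  have hleadv := quad_le_quad_adv hPγ.1.1 hPγ.1.2.1
  have hD := norm_adv_sub_le hQ hR hQ0 hPst hPγ.1 (pow_pos hg0 2)
    (pow_lt_pow_left₀ hgγ hg0.le two_ne_zero) (hPγ.quad_le hQ hR hQ0 hPst hgγ) hℓ hW hb hτ hA
    hi0 hi hcond
  have hs := sigmaMin_pos_of_posDef (posDef_input_weight (B := B) hR hPst.1)
  have hΔ := norm_gain_sub_le (A := A) (B := B) hR hadv hPst.1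
    (fun x => (hPγ.1.nominal_le hQ hR hQ0 hPst x).trans (hleadv x)) hs
  rw [robustGain_eq hR hPγ.1.1 hPγ.1.2.1]
  obtain ⟨C₁, r₁, -, hr₁, hr₁', hdecay₁⟩ :=
    exists_decay_gain hQ hR hQ0 hPst.1 hPst.1 (fun _ => le_rfl) hPst.2
  obtain ⟨C₂, r₂, -, hr₂, hr₂', hdecay₂⟩ :=
    exists_decay_gain hQ hR hQ0 hPγ.1.1 hadv hleadv (hPγ.1.ric_adv hR)
  refine ⟨specRad_lt_one_of_decay hr₁ hr₁' hdecay₁, specRad_lt_one_of_decay hr₂ hr₂' hdecay₂, ?_⟩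
  intro Ω _ μ _ x₀ w hN
  obtain ⟨hfin₁, hfin₂, hgap⟩ := nominalCost_gap hN (σ := σ) hQ hR hQ0 hPst hr₂ hr₂' hdecay₂
  refine ⟨hfin₁, hfin₂, hgap.trans ?_⟩
  exact gap_bound_le (norm_nonneg _) (norm_nonneg _) (Nat.cast_nonneg m) (norm_nonneg _)
    (norm_nonneg _) (norm_nonneg _) hs hl0.le (sq_nonneg _) (by rw [← pow_mul, mul_comm]) hΔ hD
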